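/- An involutory alphabet $\mathcal A=(A,\dagger)$ is a finite set $A$ with a map $\dagger\colon A\to A$ such that $(a^\dagger)^\dagger=a$ for all $a\in A$; put $(a_1\cdots a_n)^\dagger=a_n^\dagger\cdots a_1^\dagger$ on the semigroup $A^+$ of nonempty words. An involution semigroup $(S,\star)$ is a semigroup with a map $\star$ satisfying $(s^\star)^\star=s$ and $(st)^\star=t^\star s^\star$; morphisms of involution semigroups are semigroup morphisms that commute with the involutions. A finite involution semigroup $S$ recognises $L\subseteq A^+$ if $L=h^{-1}(P)$ for some morphism of involution semigroups $h\colon (A^+,\dagger)\to S$ and some $P\subseteq S$. **Languages.** For $w,v\in A^+$ let $\sharp^\dagger(w,v)$ be the number of pairs $(x,y)\in A^*\times A^*$ with $w=xvy$ or $w=xv^\dagger y$. For $t>0$ write $i=^t j$ if $i=j$ or both $i,j\ge t$. For $k,t>0$, two words $w,w'\in A^+$ are equivalent if either $|w|<k$ and $w=w'$, or both have length at least $k$, they have the same prefix of length $k-1$ and the same suffix of length $k-1$, and $\sharp^\dagger(w,v)=^t\sharp^\dagger(w',v)$ for every $v\in A^+$ of length at most $k$. Let $\mathcal{LRTT}(\mathcal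 A)$ be the set of all languages $L\subseteq A^+$ that are, for some $k,t>0$, a union of classes of this equivalence. **Varieties.** An involution variety of languages is a function $\mathcal V$ that maps each involutory alphabet $\mathcal A=(A,\dagger)$ to a Boolean algebra $\mathcal V(\mathcal A)$ of recognisable languages over $A$, such that $\mathcal V(\mathcal A)$ is closed under the quotients $L\mapsto a^{-1}L$ and $L\mapsto La^{-1}$ by letters $a \in A$ and under $L\mapsto L^\dagger=\{w^\dagger\mid w\in L\}$, and such that $h^{-1}(L)\in\mathcal V(\mathcal A)$ whenever $L\in\mathcal V(\mathcal B)$ and $h\colon(A^+,\dagger)\to(B^+,\dagger)$ is a morphism of involution semigroups. A pseudovariety of involution semigroups is a class of finite involution semigroups closed under finite direct products, sub-involution-semigroups and quotients. The syntactic $\star$-semigroup of $L\subseteq A^+$ is the quotient of $A^+$ by the congruence that relates $x,y$ if, for all $u,v\in A^*$, $uxv\in L\Leftrightarrow uyv\in L$ and $uxv\in L^\dagger\Leftrightarrow uyv\in L^\dagger$, with the involution induced by $\dagger$. An involution variety $\mathcal V$ and a pseudovariety $\mathbf V$ of involution semigroups correspond to each other if, for every $\mathcal A$, $\mathcal V(\mathcal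 A)$ is the set of all languages over $\mathcal A$ recognised by members of $\mathbf V$, and $\mathbf V$ is the pseudovariety generated by the syntactic $\star$-semigroups of the languages in $\mathcal V$. **Products.** Let $(S,\star)$ (written additively, not assumed commutative) and $(T,\diamond)$ be finite involution semigroups. An involutory action of $T$ on $S$ is a pair consisting of a left and a right action of $T$ on $S$ by semigroup endomorphisms such that $(ts)t'=t(st')$ and $(st)^\star=t^\diamond s^\star$ for all $s \in S$, $t,t' \in T$; it is locally hermitian if $e s e^\diamond=e s^\star e^\diamond$ for all $s\in S$ and all idempotents $e\in T$. The corresponding locally hermitian semidirect product is $S\times T$ with $(s_1,t_1)(s_2,t_2)=(s_1t_2+t_1s_2,\;t_1t_2)$ and the involution $(s,t)\mapsto(s^\star,t^\diamond)$. The locally hermitian semidirect product of pseudovarieties $\mathbf V$ and $\mathbf W$ is the pseudovariety generated by all locally hermitian semidirect products of some $S\in\mathbf V$ and some $T\in\mathbf W$. Let $\mathbf{Acom}^\star$ be the class of finite involution semigroups whose semigroup is commutative and aperiodic (there is $n$ with $a^{n+1}=a^n$ for all $a$), and $\mathbf{LI}^\star$ the class of those whose semigroup is locally trivial ($ese=e$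 for every element $s$ and every idempotent $e$). **Theorem.** $\mathcal{LRTT}$ is an involution variety of languages, and it corresponds to the locally hermitian semidirect product of the pseudovarieties $\mathbf{Acom}^\star$ and $\mathbf{LI}^\star$. -/

import Mathlib

/-! Involution semigroups are Mathlib's `[Semigroup S] [StarMul S]`; an involutory alphabet is a
finite type with `[InvolutiveStar A]`; the semigroup `A⁺` of nonempty words is `FreeSemigroup A`. -/

namespace InvLang

/-! ### Words over involutory alphabets -/

section Words

variable {A : Type}

/-- A nonempty word as a list of letters. -/
def toList (w : FreeSemigroup A) : List A := w.head :: w.tail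

theorem toList_mul (u v : FreeSemigroup A) : toList (u * v) = toList u ++ toList v := by
  simp [toList]

theorem toList_injective : Function.Injective (toList (A := A)) := by
  rintro ⟨a, l⟩ ⟨b, m⟩ h
  simp only [toList, List.cons.injEq] at h
  exact FreeSemigroup.ext h.1 h.2

variable [InvolutiveStar A]

/-- The involution on `A⁺`: `(a₁ ⋯ aₙ)† = aₙ† ⋯ a₁†` (see `toList_star`). -/
instance : Star (FreeSemigroup A) where
  star w := (FreeSemigroup.lift (fun a : A => MulOpposite.op (FreeSemigroup.of (star a))) w).unop

theorem star_of (a : A) : star (FreeSemigroup.of a) = FreeSemigroup.of (star a) := rfl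

theorem word_star_mul (u v : FreeSemigroup A) : star (u * v) = star v * star u := by
  simp [star]

theorem toList_star (w : FreeSemigroup A) :
    toList (star w) = ((toList w).map star).reverse := by
  induction w using FreeSemigroup.recOnMul with
  | ih1 a => rfl
  | ih2 a w ha hw => simp only [word_star_mul, toList_mul, ha, hw, List.map_append,
      List.reverse_append]

theorem star_comp_star : (star ∘ star : A → A) = id := funext star_star

/-- `A⁺` with the involution `†` is an involution semigroup. -/
instance : StarMul (FreeSemigroup A) where
  star_involutive w := toList_injective (by simp [toList_star, List.map_reverse, star_comp_star])
  star_mul := word_star_mul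

/-- `L† = {w† | w ∈ L}`. -/
def starLang (L : Set (FreeSemigroup A)) : Set (FreeSemigroup A) := star '' L

/-- `L`, as a set of lists. -/
def asLists (L : Set (FreeSemigroup A)) : Set (List A) := toList '' L

end Words

/-! ### Locally-reversible threshold testable languages -/

section LRTT

/-- Equality of `i` and `j` with threshold `t`. -/
def ThresholdEq (t i j : ℕ) : Prop := i = j ∨ (t ≤ i ∧ t ≤ j)

variable {A : Type} [InvolutiveStar A]

/-- The number of occurrences of `v` or `v†` in `w`: the number of pairs `(x, y)` of
(possibly empty) words such that `w = x v y` or `w = x v† y`. -/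
noncomputable def occ (w v : FreeSemigroup A) : ℕ :=
  {p : List A × List A | toList w = p.1 ++ toList v ++ p.2 ∨
    toList w = p.1 ++ toList (star v) ++ p.2}.ncard

/-- The equivalence of words with window size `k` and threshold `t`: either the words are equal
and of length less than `k`, or both have length at least `k`, they have the same prefix and the
same suffix of length `k - 1`, and every nonempty word `v` of length at most `k` has, up to
threshold `t`, the same number of occurrences, counted up to `†`, in both of them. -/
def LREquiv (k t : ℕ) (w w' : FreeSemigroup A) : Prop :=
  (w.length < k ∧ w = w') ∨
  (k ≤ w.length ∧ k ≤ w'.length ∧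
    (toList w).take (k - 1) = (toList w').take (k - 1) ∧
    (toList w).rtake (k - 1) = (toList w').rtake (k - 1) ∧
    ∀ v : FreeSemigroup A, v.length ≤ k → ThresholdEq t (occ w v) (occ w' v))

theorem LREquiv.equivalence (k t : ℕ) : Equivalence (LREquiv (A := A) k t) where
  refl w := by
    rcases lt_or_ge w.length k with h | h
    · exact Or.inl ⟨h, rfl⟩
    · exact Or.inr ⟨h, h, rfl, rfl, fun v _ => Or.inl rfl⟩
  symm := by
    rintro w w' (⟨h, rfl⟩ | ⟨h, h', hp, hs, hv⟩)
    · exact Or.inl ⟨h, rfl⟩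
    · refine Or.inr ⟨h', h, hp.symm, hs.symm, fun v hk => ?_⟩
      have := hv v hk
      unfold ThresholdEq at *
      omega
  trans := by
    rintro w w' w'' (⟨h, rfl⟩ | ⟨h, h', hp, hs, hv⟩) h2
    · exact h2
    · rcases h2 with ⟨h2, rfl⟩ | ⟨_, h3, hp', hs', hv'⟩
      · omega
      · refine Or.inr ⟨h, h3, hp.trans hp', hs.trans hs', fun v hk => ?_⟩
        have := hv v hk
        have := hv' v hk
        unfold ThresholdEq at *
        omega

/-- `L` is a union of classes of `LREquiv k t`, for some `k, t > 0`. -/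
def IsLRTT (L : Set (FreeSemigroup A)) : Prop :=
  ∃ k t : ℕ, 0 < k ∧ 0 < t ∧
    ∃ C : Set (FreeSemigroup A), L = ⋃ u ∈ C, {w | LREquiv k t u w}

end LRTT

/-! ### Bundled involutory alphabets and finite involution semigroups -/

/-- Finite involutory alphabets. -/
structure InvAlphabet : Type 1 where
  carrier : Type
  [finite : Finite carrier]
  [involution : InvolutiveStar carrier]

instance : CoeSort InvAlphabet Type := ⟨InvAlphabet.carrier⟩

attribute [instance] InvAlphabet.finite InvAlphabet.involution

/-- Finite involution semigroups. -/
structure FinStarSemigroup : Type 1 where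
  carrier : Type
  [finite : Finite carrier]
  [semigroup : Semigroup carrier]
  [involution : StarMul carrier]

instance : CoeSort FinStarSemigroup Type := ⟨FinStarSemigroup.carrier⟩

attribute [instance] FinStarSemigroup.finite FinStarSemigroup.semigroup FinStarSemigroup.involution

/-- A semigroup morphism is involutory if it commutes with the involutions. -/
def IsInvolutory {S T : Type} [Mul S] [Star S] [Mul T] [Star T] (h : S →ₙ* T) : Prop :=
  ∀ s, h (star s) = star (h s)

/-- The direct product of a family of involution semigroups, with componentwise operations. -/
def FinStarSemigroup.pi {ι : Type} [Finite ι] (S : ι → FinStarSemigroup) : FinStarSemigroup :=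
  ⟨∀ i, S i⟩

/-! ### Pseudovarieties of involution semigroups and involution varieties of languages -/

/-- A class of finite involution semigroups closed under finite direct products,
sub-involution-semigroups and quotients (the last two up to isomorphism). -/
structure IsPseudovariety (V : Set FinStarSemigroup) : Prop where
  pi_mem : ∀ {ι : Type} [Finite ι] (S : ι → FinStarSemigroup), (∀ i, S i ∈ V) →
    FinStarSemigroup.pi S ∈ V
  sub_mem : ∀ {S T : FinStarSemigroup} (h : S →ₙ* T), IsInvolutory h → Function.Injective h →
    T ∈ V → S ∈ V
  quot_mem : ∀ {S T : FinStarSemigroup} (h : S →ₙ* T), IsInvolutory h → Function.Surjective h →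
    S ∈ V → T ∈ V

/-- The pseudovariety generated by a class of finite involution semigroups. -/
def generated (X : Set FinStarSemigroup) : Set FinStarSemigroup :=
  {S | ∀ V, IsPseudovariety V → X ⊆ V → S ∈ V}

/-- The involution semigroup `S` recognises `L ⊆ A⁺`. -/
def Recognises (S : FinStarSemigroup) {A : InvAlphabet} (L : Set (FreeSemigroup A)) : Prop :=
  ∃ h : FreeSemigroup A →ₙ* S, IsInvolutory h ∧ ∃ P : Set S, L = h ⁻¹' P

/-- `L ⊆ A⁺` is recognised by some finite semigroup. -/
def IsRecognisable {A : Type} (L : Set (FreeSemigroup A)) : Prop :=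
  ∃ (S : Type) (_ : Finite S) (_ : Semigroup S) (h : FreeSemigroup A →ₙ* S) (P : Set S),
    L = h ⁻¹' P

/-- A function that maps each involutory alphabet `A` to a family of languages over `A`. -/
abbrev LanguageClass : Type 1 := (A : InvAlphabet) → Set (Set (FreeSemigroup A))

/-- Involution varieties of languages. -/
structure IsInvolutionVariety (𝒱 : LanguageClass) : Prop where
  recognisable : ∀ {A : InvAlphabet}, ∀ L ∈ 𝒱 A, IsRecognisable L
  empty_mem : ∀ A : InvAlphabet, ∅ ∈ 𝒱 A
  union_mem : ∀ {A : InvAlphabet}, ∀ L ∈ 𝒱 A, ∀ M ∈ 𝒱 A, L ∪ M ∈ 𝒱 A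
  inter_mem : ∀ {A : InvAlphabet}, ∀ L ∈ 𝒱 A, ∀ M ∈ 𝒱 A, L ∩ M ∈ 𝒱 A
  compl_mem : ∀ {A : InvAlphabet}, ∀ L ∈ 𝒱 A, Lᶜ ∈ 𝒱 A
  left_quot_mem : ∀ {A : InvAlphabet} (a : A), ∀ L ∈ 𝒱 A,
    {w | FreeSemigroup.of a * w ∈ L} ∈ 𝒱 A
  right_quot_mem : ∀ {A : InvAlphabet} (a : A), ∀ L ∈ 𝒱 A,
    {w | w * FreeSemigroup.of a ∈ L} ∈ 𝒱 A
  preimage_mem : ∀ {A B : InvAlphabet} (h : FreeSemigroup A →ₙ* FreeSemigroup B),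
    IsInvolutory h → ∀ L ∈ 𝒱 B, h ⁻¹' L ∈ 𝒱 A
  star_mem : ∀ {A : InvAlphabet}, ∀ L ∈ 𝒱 A, starLang L ∈ 𝒱 A

/-! ### Syntactic involution semigroups and the Eilenberg correspondence -/

section Syntactic

variable {A : Type}

/-- The syntactic congruence of `L`: `u x v ∈ L ↔ u y v ∈ L` for all `u, v ∈ A*`. -/
def synCon (L : Set (FreeSemigroup A)) : Con (FreeSemigroup A) where
  r x y := ∀ u v : List A, u ++ toList x ++ v ∈ asLists L ↔ u ++ toList y ++ v ∈ asLists L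
  iseqv := ⟨fun _ _ _ => Iff.rfl, fun h u v => (h u v).symm,
    fun h h' u v => (h u v).trans (h' u v)⟩
  mul' {w x y z} h h' u v := by
    have h1 := h u (toList y ++ v)
    have h2 := h' (u ++ toList x) v
    simp only [toList_mul, List.append_assoc] at h1 h2 ⊢
    exact h1.trans h2

variable [InvolutiveStar A]

/-- The syntactic `⋆`-congruence of `L`: `x ∼_L y` and `x ∼_{L†} y`. -/
def synStarCon (L : Set (FreeSemigroup A)) : Con (FreeSemigroup A) :=
  synCon L ⊓ synCon (starLang L)

theorem synStarCon_iff (L : Set (FreeSemigroup A)) (x y : FreeSemigroup A) :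
    synStarCon L x y ↔ synCon L x y ∧ synCon (starLang L) x y := Iff.rfl

theorem mem_asLists_starLang (L : Set (FreeSemigroup A)) (l : List A) :
    l ∈ asLists (starLang L) ↔ (l.map star).reverse ∈ asLists L := by
  constructor
  · rintro ⟨_, ⟨w, hw, rfl⟩, rfl⟩
    exact ⟨w, hw, by simp [toList_star, List.map_reverse, star_comp_star]⟩
  · rintro ⟨w, hw, h⟩
    exact ⟨star w, ⟨w, hw, rfl⟩, by simp [toList_star, h, List.map_reverse, star_comp_star]⟩

theorem starLang_starLang (L : Set (FreeSemigroup A)) : starLang (starLang L) = L := by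
  simp [starLang]

theorem synCon_star {L : Set (FreeSemigroup A)} {x y : FreeSemigroup A}
    (h : synCon L x y) : synCon (starLang L) (star x) (star y) := by
  intro u v
  have := h (v.map star).reverse (u.map star).reverse
  simpa [mem_asLists_starLang, toList_star, List.map_reverse, star_comp_star] using this

theorem synStarCon_star {L : Set (FreeSemigroup A)} {x y : FreeSemigroup A}
    (h : synStarCon L x y) : synStarCon L (star x) (star y) := by
  rw [synStarCon_iff] at h ⊢
  refine ⟨?_, synCon_star h.1⟩
  have := synCon_star h.2
  rwa [starLang_starLang] at this

/-- The quotient of `A⁺` by the syntactic `⋆`-congruence of `L`. -/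
abbrev Syn (L : Set (FreeSemigroup A)) : Type := (synStarCon L).Quotient

/-- The involution `⟦w⟧ ↦ ⟦w†⟧` of the syntactic `⋆`-semigroup. -/
instance (L : Set (FreeSemigroup A)) : StarMul (Syn L) where
  star := Quotient.map' star (fun _ _ h => synStarCon_star h)
  star_involutive := by
    rintro ⟨w⟩
    exact congrArg (fun x : FreeSemigroup A => (x : Syn L)) (star_star w)
  star_mul := by
    rintro ⟨u⟩ ⟨v⟩
    exact congrArg (fun x : FreeSemigroup A => (x : Syn L)) (star_mul u v)

end Syntactic

/-- The language class associated with a class `V` of involution semigroups: over each involutory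
alphabet, all the languages recognised by members of `V`. -/
def languagesOf (V : Set FinStarSemigroup) : LanguageClass :=
  fun _ => {L | ∃ S ∈ V, Recognises S L}

/-- The pseudovariety associated with a class `𝒱` of (recognisable) languages: the one generated
by the syntactic `⋆`-semigroups of the languages in `𝒱`. -/
def pseudovarietyOf (𝒱 : LanguageClass) : Set FinStarSemigroup :=
  generated {S | ∃ A : InvAlphabet, ∃ L ∈ 𝒱 A, ∃ _ : Finite (Syn L), S = ⟨Syn L⟩}

/-- `𝒱` and `V` correspond to each other under the Eilenberg-type correspondence between involution
varieties of languages and pseudovarieties of involution semigroups. -/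
structure Corresponds (𝒱 : LanguageClass) (V : Set FinStarSemigroup) : Prop where
  isInvolutionVariety : IsInvolutionVariety 𝒱
  isPseudovariety : IsPseudovariety V
  languagesOf_eq : languagesOf V = 𝒱
  pseudovarietyOf_eq : pseudovarietyOf 𝒱 = V

/-! ### Locally hermitian semidirect products -/

/-- An involutory (bilateral) action of the involution semigroup `T` on the involution semigroup
`S`. The operation of `S` is written multiplicatively here. -/
structure InvAction (S T : Type) [Semigroup S] [StarMul S] [Semigroup T] [StarMul T] where
  /-- The left action `(t, s) ↦ ts`. -/
  left : T → S → S
  /-- The right action `(s, t) ↦ st`. -/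
  right : S → T → S
  left_mul : ∀ t s s', left t (s * s') = left t s * left t s'
  mul_left : ∀ t t' s, left (t * t') s = left t (left t' s)
  mul_right : ∀ s s' t, right (s * s') t = right s t * right s' t
  right_mul : ∀ s t t', right s (t * t') = right (right s t) t'
  compatible : ∀ t s t', right (left t s) t' = left t (right s t')
  star_right : ∀ s t, star (right s t) = left (star t) (star s)

section Semidirect

variable {S T : Type} [Semigroup S] [StarMul S] [Semigroup T] [StarMul T]

/-- The action is locally hermitian: `e s e† = e s⋆ e†` for every idempotent `e`. -/
def InvAction.LocallyHermitian (α : InvAction S T) : Prop :=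
  ∀ e : T, IsIdempotentElem e → ∀ s : S,
    α.right (α.left e s) (star e) = α.right (α.left e (star s)) (star e)

/-- The underlying set `S × T` of the semidirect product. -/
@[ext] structure InvAction.Sdp (α : InvAction S T) : Type where
  fst : S
  snd : T

variable (α : InvAction S T)

theorem InvAction.star_left (t : T) (s : S) :
    star (α.left t s) = α.right (star s) (star t) := by
  have := α.star_right (star s) (star t)
  rw [star_star, star_star] at this
  rw [← this, star_star]

/-- `(s₁, t₁)(s₂, t₂) = (s₁t₂ + t₁s₂, t₁t₂)`. -/
instance : Semigroup α.Sdp where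
  mul x y := ⟨α.right x.fst y.snd * α.left x.snd y.fst, x.snd * y.snd⟩
  mul_assoc x y z := by
    apply InvAction.Sdp.ext
    · change α.right (α.right x.fst y.snd * α.left x.snd y.fst) z.snd *
          α.left (x.snd * y.snd) z.fst =
        α.right x.fst (y.snd * z.snd) *
          α.left x.snd (α.right y.fst z.snd * α.left y.snd z.fst)
      rw [α.mul_right, α.right_mul, α.left_mul, α.mul_left, α.compatible, mul_assoc]
    · exact mul_assoc _ _ _

/-- `(s, t)† = (s⋆, t†)`. -/
instance : StarMul α.Sdp where
  star x := ⟨star x.fst, star x.snd⟩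
  star_involutive x := InvAction.Sdp.ext (star_star _) (star_star _)
  star_mul x y := by
    apply InvAction.Sdp.ext
    · change star (α.right x.fst y.snd * α.left x.snd y.fst) =
        α.right (star y.fst) (star x.snd) * α.left (star y.snd) (star x.fst)
      rw [star_mul, α.star_right, α.star_left]
    · exact star_mul _ _

instance [Finite S] [Finite T] : Finite α.Sdp :=
  Finite.of_injective (fun x : α.Sdp => (x.fst, x.snd)) (by
    rintro ⟨a, b⟩ ⟨c, d⟩ h
    simpa using h)

end Semidirect

/-- The locally hermitian semidirect product of `V` and `W`: the pseudovariety generated by all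
locally hermitian semidirect products of a member of `V` and a member of `W`. -/
def lhProduct (V W : Set FinStarSemigroup) : Set FinStarSemigroup :=
  generated {P | ∃ S ∈ V, ∃ T ∈ W, ∃ α : InvAction S T, α.LocallyHermitian ∧ P = ⟨α.Sdp⟩}

/-! ### The pseudovarieties and the variety of the theorem -/

/-- There is an `n` such that `aⁿ⁺¹ = aⁿ` for all `a`; the powers are taken in `S` with an
identity adjoined, so that `n` is positive unless `S` is empty. -/
def IsAperiodic (S : Type) [Semigroup S] : Prop :=
  ∃ n : ℕ, ∀ a : S, (a : WithOne S) ^ (n + 1) = (a : WithOne S) ^ n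

/-- `ese = e` for every `s` and every idempotent `e`. -/
def IsLocallyTrivial (S : Type) [Semigroup S] : Prop :=
  ∀ e : S, IsIdempotentElem e → ∀ s : S, e * s * e = e

/-- Finite involution semigroups whose semigroup reduct is aperiodic and commutative. -/
def AcomStar : Set FinStarSemigroup :=
  {S | IsAperiodic S ∧ ∀ x y : S, x * y = y * x}

/-- Finite involution semigroups whose semigroup reduct is locally trivial. -/
def LIStar : Set FinStarSemigroup := {S | IsLocallyTrivial S}

/-- The class of (generalised) locally-reversible threshold testable languages. -/
def LRTT : LanguageClass := fun _ => {L | IsLRTT L}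

end InvLang

namespace InvLang

/-! ### Pseudovarieties and the languages they recognise -/

/-! Eilenberg's argument works for every pseudovariety together with the languages its members
recognise (`corresponds_of_languagesOf_eq`). So it is enough that the locally hermitian product
recognises exactly the languages in `LRTT` (`languagesOf_lhProduct`).

From languages to semigroups. A word is described by its ends, an element of the locally trivial
semigroup `Ends A n`, and by the multiset of its letters in their contexts. Contexts are seen only
through windows of radius `n`, complete windows only up to reversal, and counted up to a threshold;
this gives the commutative aperiodic semigroup `Windows A n t`. `Ends A n` acts by extending
contexts. An idempotent is represented by a word with at least `n` letters, so surrounding a letter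
by `e` and its star completes the window, after which reversal is invisible: the action is locally
hermitian. The resulting morphism determines the class for `LREquiv` (`LREquiv.of_windowHom_eq`).

From semigroups to languages. A word with prefix `v₀` and suffix `u₀` of length `m` is a walk from
`v₀` to `u₀` in the graph whose edges are the words of length `m + 1`, with reversal as involution.
In a locally hermitian product, for large `m`, the value of a word does not change when the edges
are rearranged into another walk with the same ends (by local triviality the term contributed by a
letter depends only on the ends and on one edge around it, and the terms commute), when a subwalk
from `v` to `star v` is reversed, or when a high power of a closed subwalk is raised by one.
`IsWalkInvariant` states the corresponding identities in a form that passes to divisors and finite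
products, hence to the whole generated pseudovariety.

The rest is combinatorics of graphs with involution. By the first two invariances the value depends
only on the multiset of edges up to reversal: one walk is transformed into another edge by edge
(`InvGraph.Invariant.eq_of_edgeClasses_eq`). If such a multiset contains another one with the same
ends, their difference is balanced, and balanced multisets are sums of closed walks
(`InvGraph.Balanced.mem_cyclic`), which can be pumped. If no threshold were sufficient, then along
an ultrafilter of counterexamples each edge count would be constant or unbounded, and the unbounded
parts of the two walks could be pumped to a common multiset (`InvGraph.Invariant.exists_threshold`).
The edge counts are exactly the numbers `occ` for words of length `m + 1`. -/

theorem isPseudovariety_generated (X : Set FinStarSemigroup) : IsPseudovariety (generated X) where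
  pi_mem S hS V hV hX := hV.pi_mem S fun i => hS i V hV hX
  sub_mem h hh hi hT V hV hX := hV.sub_mem h hh hi (hT V hV hX)
  quot_mem h hh hs hS V hV hX := hV.quot_mem h hh hs (hS V hV hX)

theorem subset_generated (X : Set FinStarSemigroup) : X ⊆ generated X :=
  fun _ hS _ _ hX => hX hS

/-- The projection of a direct product to a factor. -/
def piProj {ι : Type} [Finite ι] (S : ι → FinStarSemigroup) (i : ι) :
    FinStarSemigroup.pi S →ₙ* S i where
  toFun f := f i
  map_mul' _ _ := rfl

/-- The morphism to a direct product given by its components. -/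
def piLift {ι : Type} [Finite ι] {R : Type} [Mul R] (S : ι → FinStarSemigroup)
    (h : ∀ i, R →ₙ* S i) : R →ₙ* FinStarSemigroup.pi S where
  toFun x i := h i x
  map_mul' x y := funext fun i => map_mul (h i) x y

theorem isInvolutory_piLift {ι : Type} [Finite ι] {R : Type} [Mul R] [Star R]
    (S : ι → FinStarSemigroup) (h : ∀ i, R →ₙ* S i) (hh : ∀ i, IsInvolutory (h i)) :
    IsInvolutory (piLift S h) :=
  fun x => funext fun i => hh i x

/-- The product of two recognisers handles every Boolean connective `f` at once; complements are the
case `M = L`. -/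
theorem IsPseudovariety.exists_pair_recognises {V : Set FinStarSemigroup} (hV : IsPseudovariety V)
    {A : InvAlphabet} {L M : Set (FreeSemigroup A)} (hL : L ∈ languagesOf V A)
    (hM : M ∈ languagesOf V A) (f : Prop → Prop → Prop) :
    {w | f (w ∈ L) (w ∈ M)} ∈ languagesOf V A := by
  obtain ⟨S, hS, h, hh, P, rfl⟩ := hL
  obtain ⟨T, hT, g, hg, Q, rfl⟩ := hM
  let F : Bool → FinStarSemigroup := fun b => bif b then S else T
  let k : ∀ b, FreeSemigroup A →ₙ* F b := fun b => match b with
    | true => h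
    | false => g
  refine ⟨FinStarSemigroup.pi F, hV.pi_mem F ?_, piLift F k, isInvolutory_piLift F k ?_,
    {x | f (x true ∈ P) (x false ∈ Q)}, rfl⟩
  · rintro (_ | _)
    · exact hT
    · exact hS
  · rintro (_ | _)
    · exact hg
    · exact hh

theorem IsPseudovariety.isInvolutionVariety {V : Set FinStarSemigroup} (hV : IsPseudovariety V) :
    IsInvolutionVariety (languagesOf V) where
  recognisable := by
    rintro A _ ⟨S, _, h, _, P, rfl⟩
    exact ⟨S, inferInstance, inferInstance, h, P, rfl⟩
  empty_mem A := by
    -- The empty product is the one-element semigroup, which belongs to every pseudovariety.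
    refine ⟨FinStarSemigroup.pi (fun i : Empty => i.elim), hV.pi_mem _ (fun i => i.elim),
      piLift _ (fun i => i.elim), isInvolutory_piLift _ _ (fun i => i.elim), ∅, rfl⟩
  union_mem _ hL _ hM := hV.exists_pair_recognises hL hM (· ∨ ·)
  inter_mem _ hL _ hM := hV.exists_pair_recognises hL hM (· ∧ ·)
  compl_mem _ hL := hV.exists_pair_recognises hL hL (fun p _ => ¬ p)
  left_quot_mem := by
    rintro A a _ ⟨S, hS, h, hh, P, rfl⟩
    exact ⟨S, hS, h, hh, {s | h (FreeSemigroup.of a) * s ∈ P}, by ext w; simp⟩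
  right_quot_mem := by
    rintro A a _ ⟨S, hS, h, hh, P, rfl⟩
    exact ⟨S, hS, h, hh, {s | s * h (FreeSemigroup.of a) ∈ P}, by ext w; simp⟩
  preimage_mem := by
    rintro A B g hg _ ⟨S, hS, h, hh, P, rfl⟩
    exact ⟨S, hS, h.comp g, fun w => by simp [hg w, hh (g w)], P, rfl⟩
  star_mem := by
    rintro A _ ⟨S, hS, h, hh, P, rfl⟩
    refine ⟨S, hS, h, hh, {s | star s ∈ P}, ?_⟩
    ext w
    constructor
    · rintro ⟨v, hv, rfl⟩
      simpa [hh v] using hv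
    · intro hw
      exact ⟨star w, by simpa [hh w] using hw, star_star w⟩

/-! ### The Eilenberg correspondence for the languages of a pseudovariety -/

theorem asLists_toList {A : Type} (L : Set (FreeSemigroup A)) (w : FreeSemigroup A) :
    toList w ∈ asLists L ↔ w ∈ L :=
  toList_injective.mem_set_image

theorem toList_ne_nil {A : Type} (w : FreeSemigroup A) : toList w ≠ [] := by simp [toList]

theorem exists_toList_eq {A : Type} {l : List A} (hl : l ≠ []) :
    ∃ w : FreeSemigroup A, toList w = l := by
  cases l with
  | nil => exact absurd rfl hl
  | cons a l => exact ⟨⟨a, l⟩, rfl⟩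

theorem synCon_of_map_eq {A S : Type} [Semigroup S] (h : FreeSemigroup A →ₙ* S) (P : Set S)
    {x y : FreeSemigroup A} (hxy : h x = h y) : synCon (h ⁻¹' P) x y := by
  have key : ∀ z : FreeSemigroup A, ∀ u v : List A, ∃ w, toList w = u ++ toList z ++ v := by
    intro z u v
    exact exists_toList_eq (by simp [toList_ne_nil])
  have inv : ∀ u v : List A, ∀ w w', toList w = u ++ toList x ++ v →
      toList w' = u ++ toList y ++ v → h w = h w' := by
    intro u v w w' hw hw'
    -- `h` has no value at the empty word, so empty contexts are treated separately.
    rcases u with _ | ⟨a, u⟩ <;> rcases v with _ | ⟨b, v⟩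
    · have h1 : w = x := toList_injective (by simpa using hw)
      have h2 : w' = y := toList_injective (by simpa using hw')
      rw [h1, h2, hxy]
    · have h1 : w = x * ⟨b, v⟩ := toList_injective (by simpa [toList] using hw)
      have h2 : w' = y * ⟨b, v⟩ := toList_injective (by simpa [toList] using hw')
      rw [h1, h2, map_mul, map_mul, hxy]
    · have h1 : w = ⟨a, u⟩ * x := toList_injective (by simpa [toList] using hw)
      have h2 : w' = ⟨a, u⟩ * y := toList_injective (by simpa [toList] using hw')
      rw [h1, h2, map_mul, map_mul, hxy]
    · have h1 : w = ⟨a, u⟩ * x * ⟨b, v⟩ := toList_injective (by simpa [toList] using hw)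
      have h2 : w' = ⟨a, u⟩ * y * ⟨b, v⟩ := toList_injective (by simpa [toList] using hw')
      rw [h1, h2, map_mul, map_mul, map_mul, map_mul, hxy]
  intro u v
  obtain ⟨w, hw⟩ := key x u v
  obtain ⟨w', hw'⟩ := key y u v
  rw [← hw, ← hw', asLists_toList, asLists_toList, Set.mem_preimage, Set.mem_preimage,
    inv u v w w' hw hw']

theorem starLang_preimage {A S : Type} [InvolutiveStar A] [Semigroup S] [StarMul S]
    (h : FreeSemigroup A →ₙ* S) (hh : IsInvolutory h) (P : Set S) :
    starLang (h ⁻¹' P) = h ⁻¹' (star '' P) := by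
  ext w
  constructor
  · rintro ⟨v, hv, rfl⟩
    exact ⟨h v, hv, (hh v).symm⟩
  · rintro ⟨s, hs, hw⟩
    exact ⟨star w, by simpa [hh w, ← hw] using hs, star_star w⟩

theorem synStarCon_of_map_eq {A S : Type} [InvolutiveStar A] [Semigroup S] [StarMul S]
    (h : FreeSemigroup A →ₙ* S) (hh : IsInvolutory h) (P : Set S)
    {x y : FreeSemigroup A} (hxy : h x = h y) : synStarCon (h ⁻¹' P) x y := by
  rw [synStarCon_iff, starLang_preimage h hh]
  exact ⟨synCon_of_map_eq h P hxy, synCon_of_map_eq h _ hxy⟩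

/-- The image of a morphism of involution semigroups. -/
def starRange {R : Type} [Semigroup R] [StarMul R] {S : FinStarSemigroup} (h : R →ₙ* S)
    (hh : IsInvolutory h) : FinStarSemigroup :=
  letI : StarMul (MulHom.srange h) :=
    { star := fun x => ⟨star x.1, by
        obtain ⟨_, r, rfl⟩ := x
        exact ⟨star r, hh r⟩⟩
      star_involutive := fun x => Subtype.ext (star_star x.1)
      star_mul := fun x y => Subtype.ext (star_mul x.1 y.1) }
  ⟨MulHom.srange h⟩

/-- The kernel of a recognising morphism refines the syntactic congruence, so the syntactic
semigroup is a quotient of the image of that morphism and hence a divisor of a member of `V`. -/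
theorem IsPseudovariety.syn_mem {V : Set FinStarSemigroup} (hV : IsPseudovariety V)
    {A : InvAlphabet} {L : Set (FreeSemigroup A)} (hL : L ∈ languagesOf V A)
    [hfin : Finite (Syn L)] : (⟨Syn L⟩ : FinStarSemigroup) ∈ V := by
  obtain ⟨S, hS, h, hh, P, rfl⟩ := hL
  have hR : starRange h hh ∈ V :=
    hV.sub_mem (S := starRange h hh) (T := S)
      { toFun := fun x => x.1, map_mul' := fun _ _ => rfl } (fun _ => rfl)
      Subtype.val_injective hS
  -- An arbitrary choice of preimage words. It induces a morphism because words with the same value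
  -- are syntactically equivalent.
  let σ : MulHom.srange h → FreeSemigroup A := fun x => x.2.choose
  have hσ : ∀ x, h (σ x) = x.1 := fun x => x.2.choose_spec
  have mk_eq : ∀ x y : FreeSemigroup A, h x = h y → (x : Syn (h ⁻¹' P)) = y := fun x y hxy =>
    (Con.eq _).2 (synStarCon_of_map_eq h hh P hxy)
  refine hV.quot_mem (S := starRange h hh) (T := ⟨Syn (h ⁻¹' P)⟩)
    { toFun := fun x => (σ x : Syn (h ⁻¹' P)), map_mul' := fun x y => ?_ } ?_ ?_ hR
  · refine mk_eq _ (σ x * σ y) ?_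
    rw [map_mul]
    exact (hσ _).trans (congrArg₂ (· * ·) (hσ x).symm (hσ y).symm)
  · intro x
    refine mk_eq _ (star (σ x)) ?_
    rw [hh]
    exact (hσ _).trans (congrArg star (hσ x).symm)
  · rintro ⟨w⟩
    exact ⟨⟨h w, w, rfl⟩, mk_eq _ _ (hσ _)⟩

theorem finite_syn {A S : Type} [InvolutiveStar A] [Semigroup S] [StarMul S] [Finite S]
    (h : FreeSemigroup A →ₙ* S) (hh : IsInvolutory h) (P : Set S) :
    Finite (Syn (h ⁻¹' P)) := by
  have hi : Function.Injective (fun x : Syn (h ⁻¹' P) => h x.out) := by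
    intro x y hxy
    have := synStarCon_of_map_eq h hh P hxy
    rw [← Quotient.out_eq x, ← Quotient.out_eq y]
    exact Quotient.sound this
  exact Finite.of_injective _ hi

/-- The evaluation morphism `S⁺ → S`. -/
def evalHom (S : Type) [Semigroup S] : FreeSemigroup S →ₙ* S := FreeSemigroup.lift id

theorem isInvolutory_evalHom (S : Type) [Semigroup S] [StarMul S] : IsInvolutory (evalHom S) := by
  intro w
  induction w using FreeSemigroup.recOnMul with
  | ih1 a => rfl
  | ih2 a w ha hw => rw [star_mul, map_mul, map_mul, star_mul, ha, hw]

/-- For the harder inclusion, take `S` itself as the alphabet: `S` embeds into the product over `s`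
of the syntactic semigroups of the languages of words with value `s`, the empty context being enough
to separate letters. -/
theorem IsPseudovariety.pseudovarietyOf_languagesOf {V : Set FinStarSemigroup}
    (hV : IsPseudovariety V) : pseudovarietyOf (languagesOf V) = V := by
  apply Set.Subset.antisymm
  · intro S hS
    refine hS V hV ?_
    rintro _ ⟨A, L, hL, hf, rfl⟩
    exact hV.syn_mem hL
  · intro S hS
    let A : InvAlphabet := ⟨S⟩
    let L : S → Set (FreeSemigroup A) := fun s => evalHom S ⁻¹' {s}
    have hL : ∀ s, L s ∈ languagesOf V A := fun s =>
      ⟨S, hS, evalHom S, isInvolutory_evalHom S, {s}, rfl⟩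
    have hf : ∀ s, Finite (Syn (L s)) := fun s => finite_syn _ (isInvolutory_evalHom S) _
    have mk_eq : ∀ s, ∀ x y : FreeSemigroup A, evalHom S x = evalHom S y →
        (x : Syn (L s)) = y := fun s x y hxy =>
      (Con.eq _).2 (synStarCon_of_map_eq _ (isInvolutory_evalHom S) _ hxy)
    let Q : S → FinStarSemigroup := fun s => ⟨Syn (L s)⟩
    let j : ∀ s, S →ₙ* Q s := fun s =>
      { toFun := fun x => ((FreeSemigroup.of x : FreeSemigroup A) : Syn (L s))
        map_mul' := fun x y => mk_eq s _ (FreeSemigroup.of x * FreeSemigroup.of y) (by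
          rw [map_mul]; rfl) }
    have hW := isPseudovariety_generated
      {S | ∃ A : InvAlphabet, ∃ L ∈ languagesOf V A, ∃ _ : Finite (Syn L), S = ⟨Syn L⟩}
    refine hW.sub_mem (piLift Q j) (isInvolutory_piLift Q j fun s x => rfl) ?_
      (hW.pi_mem Q fun s => subset_generated _ ⟨A, L s, hL s, hf s, rfl⟩)
    intro x y hxy
    have h1 : synStarCon (L x) (FreeSemigroup.of x) (FreeSemigroup.of y) :=
      (Con.eq _).1 (congrFun hxy x)
    have h2 := h1.1 [] []
    simp only [List.nil_append, List.append_nil, asLists_toList] at h2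
    exact (h2.1 rfl).symm

theorem corresponds_of_languagesOf_eq {𝒱 : LanguageClass} {V : Set FinStarSemigroup}
    (hV : IsPseudovariety V) (h : languagesOf V = 𝒱) : Corresponds 𝒱 V := by
  subst h
  exact ⟨hV.isInvolutionVariety, hV, rfl, hV.pseudovarietyOf_languagesOf⟩

/-! ### The involution on lists -/

section Lists

variable {A : Type}

/-- Reversal is needed on possibly empty lists: they are the contexts of a letter and the vertices
of the graph of words. -/
instance [InvolutiveStar A] : InvolutiveStar (List A) where
  star l := (l.map star).reverse
  star_involutive l := by simp [List.map_reverse, Function.comp_def]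

theorem star_list_def [InvolutiveStar A] (l : List A) : star l = (l.map star).reverse := rfl

theorem star_list_append [InvolutiveStar A] (l m : List A) :
    star (l ++ m) = star m ++ star l := by simp [star_list_def]

theorem star_list_cons [InvolutiveStar A] (a : A) (l : List A) :
    star (a :: l) = star l ++ [star a] := by simp [star_list_def]

theorem length_star_list [InvolutiveStar A] (l : List A) : (star l).length = l.length := by
  simp [star_list_def]

theorem take_star_list [InvolutiveStar A] (n : ℕ) (l : List A) :
    (star l).take n = star (l.rtake n) := by
  simp [star_list_def, List.rtake_eq_reverse_take_reverse, List.map_reverse]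

theorem rtake_star_list [InvolutiveStar A] (n : ℕ) (l : List A) :
    (star l).rtake n = star (l.take n) := by
  simp [star_list_def, List.rtake_eq_reverse_take_reverse]

theorem toList_star_eq [InvolutiveStar A] (w : FreeSemigroup A) :
    toList (star w) = star (toList w) := toList_star w

theorem star_prefix_star [InvolutiveStar A] {l m : List A} : star l <+: star m ↔ l <:+ m := by
  constructor
  · rintro ⟨t, ht⟩
    exact ⟨star t, by rw [← star_star m, ← ht, star_list_append, star_star]⟩
  · rintro ⟨t, rfl⟩
    exact ⟨star t, by rw [star_list_append]⟩

theorem star_suffix_star [InvolutiveStar A] {l m : List A} : star l <:+ star m ↔ l <+: m := by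
  rw [← star_prefix_star, star_star, star_star]

theorem take_append_take (n : ℕ) (l m : List A) :
    (l.take n ++ m.take n).take n = (l ++ m).take n := by
  rw [List.take_append, List.take_append, List.take_take, List.take_take, List.length_take]
  congr 2 <;> omega

theorem rtake_append_rtake (n : ℕ) (l m : List A) :
    (l.rtake n ++ m.rtake n).rtake n = (l ++ m).rtake n := by
  simp only [List.rtake_eq_reverse_take_reverse, List.reverse_append, List.reverse_reverse]
  rw [take_append_take]

theorem take_append_congr {n : ℕ} {l l' m m' : List A} (h : l.take n = l'.take n)
    (h' : m.take n = m'.take n) : (l ++ m).take n = (l' ++ m').take n := by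
  rw [← take_append_take, h, h', take_append_take]

theorem rtake_append_congr {n : ℕ} {l l' m m' : List A} (h : l.rtake n = l'.rtake n)
    (h' : m.rtake n = m'.rtake n) : (l ++ m).rtake n = (l' ++ m').rtake n := by
  rw [← rtake_append_rtake, h, h', rtake_append_rtake]

theorem length_rtake (n : ℕ) (l : List A) : (l.rtake n).length = min n l.length := by
  simp [List.rtake_eq_reverse_take_reverse]

theorem rtake_of_length_le {n : ℕ} {l : List A} (h : l.length ≤ n) : l.rtake n = l := by
  simp [List.rtake_eq_reverse_take_reverse, List.take_of_length_le, h]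

theorem take_append_of_le {n : ℕ} {l : List A} (h : n ≤ l.length) (m : List A) :
    (l ++ m).take n = l.take n := List.take_append_of_le_length h

theorem rtake_append_of_le {n : ℕ} {m : List A} (h : n ≤ m.length) (l : List A) :
    (l ++ m).rtake n = m.rtake n := by
  simp only [List.rtake_eq_reverse_take_reverse, List.reverse_append]
  rw [take_append_of_le (by simpa using h)]

theorem take_take_self (n : ℕ) (l : List A) : (l.take n).take n = l.take n := by simp

theorem rtake_rtake_self (n : ℕ) (l : List A) : (l.rtake n).rtake n = l.rtake n :=
  rtake_of_length_le (by rw [length_rtake]; exact min_le_left _ _)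

end Lists

/-! ### Equality up to a threshold -/

theorem ThresholdEq.refl (t i : ℕ) : ThresholdEq t i i := Or.inl rfl

theorem ThresholdEq.symm {t i j : ℕ} (h : ThresholdEq t i j) : ThresholdEq t j i := by
  unfold ThresholdEq at *; omega

theorem ThresholdEq.trans {t i j k : ℕ} (h : ThresholdEq t i j) (h' : ThresholdEq t j k) :
    ThresholdEq t i k := by
  unfold ThresholdEq at *; omega

theorem ThresholdEq.add {t i j i' j' : ℕ} (h : ThresholdEq t i j) (h' : ThresholdEq t i' j') :
    ThresholdEq t (i + i') (j + j') := by
  unfold ThresholdEq at *; omega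

theorem ThresholdEq.mono {t t' i j : ℕ} (h : ThresholdEq t' i j) (ht : t ≤ t') :
    ThresholdEq t i j := by
  unfold ThresholdEq at *; omega

/-! ### The locally trivial semigroup of prefixes and suffixes -/

section Ends

variable {A : Type}

/-- Having the same prefix and the same suffix of length `n`. -/
def endsCon (A : Type) (n : ℕ) : Con (FreeSemigroup A) where
  r u v := (toList u).take n = (toList v).take n ∧ (toList u).rtake n = (toList v).rtake n
  iseqv := ⟨fun _ => ⟨rfl, rfl⟩, fun h => ⟨h.1.symm, h.2.symm⟩,
    fun h h' => ⟨h.1.trans h'.1, h.2.trans h'.2⟩⟩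
  mul' h h' := by
    rw [toList_mul, toList_mul]
    exact ⟨take_append_congr h.1 h'.1, rtake_append_congr h.2 h'.2⟩

theorem endsCon_iff {n : ℕ} {u v : FreeSemigroup A} : endsCon A n u v ↔
    (toList u).take n = (toList v).take n ∧ (toList u).rtake n = (toList v).rtake n := Iff.rfl

/-- The quotient of `A⁺` by `endsCon A n`. -/
abbrev Ends (A : Type) (n : ℕ) : Type := (endsCon A n).Quotient

instance [InvolutiveStar A] (n : ℕ) : StarMul (Ends A n) where
  star := Quotient.map' star (fun u v h => by
    change endsCon A n _ _
    rw [endsCon_iff, toList_star_eq, toList_star_eq, take_star_list, take_star_list,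
      rtake_star_list, rtake_star_list]
    exact ⟨congrArg star h.2, congrArg star h.1⟩)
  star_involutive := by
    rintro ⟨w⟩
    exact congrArg (fun x : FreeSemigroup A => (x : Ends A n)) (star_star w)
  star_mul := by
    rintro ⟨u⟩ ⟨v⟩
    exact congrArg (fun x : FreeSemigroup A => (x : Ends A n)) (star_mul u v)

instance [Finite A] (n : ℕ) : Finite (Ends A n) := by
  have : Finite {l : List A // l.length ≤ n} := (List.finite_length_le A n).to_subtype
  let f : Ends A n → {l : List A // l.length ≤ n} × {l : List A // l.length ≤ n} := fun x =>
    Quotient.liftOn' x (fun w => (⟨(toList w).take n, by simp⟩,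
      ⟨(toList w).rtake n, by rw [length_rtake]; exact min_le_left _ _⟩)) (by
        rintro u v ⟨h, h'⟩
        simp [h, h'])
  refine Finite.of_injective f ?_
  rintro ⟨u⟩ ⟨v⟩ h
  have h' := Prod.ext_iff.1 h
  exact (Con.eq _).2 ⟨congrArg Subtype.val h'.1, congrArg Subtype.val h'.2⟩

/-- A word shorter than `n` is separated from its square by the length of the prefix. This bound
yields both local triviality and the locally hermitian law. -/
theorem le_length_of_isIdempotentElem {n : ℕ} {u : FreeSemigroup A}
    (h : IsIdempotentElem (u : Ends A n)) : n ≤ (toList u).length := by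
  have h1 : endsCon A n (u * u) u := (Con.eq _).1 h
  have h2 := congrArg List.length h1.1
  rw [toList_mul, List.length_take, List.length_take, List.length_append] at h2
  have : 0 < (toList u).length := by simp [toList]
  omega

theorem isLocallyTrivial_ends (A : Type) (n : ℕ) : IsLocallyTrivial (Ends A n) := by
  rintro ⟨u⟩ hu ⟨v⟩
  have hn := le_length_of_isIdempotentElem (u := u) hu
  refine (Con.eq _).2 (endsCon_iff.2 ?_)
  rw [toList_mul, toList_mul, List.append_assoc]
  exact ⟨take_append_of_le hn _, by rw [← List.append_assoc]; exact rtake_append_of_le hn _⟩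

end Ends

/-! ### Factorisations of a word at a letter -/

section Splits

variable {A : Type}

/-- A word with a distinguished letter. -/
abbrev Split (A : Type) : Type := List A × A × List A

/-- The factorisations `x a y` of a word. -/
def splits : List A → Multiset (Split A)
  | [] => 0
  | a :: l => ([], a, l) ::ₘ (splits l).map (fun p => (a :: p.1, p.2.1, p.2.2))

/-- Extension to the left. -/
def padLeft (u : List A) (p : Split A) : Split A := (u ++ p.1, p.2.1, p.2.2)

/-- Extension to the right. -/
def padRight (u : List A) (p : Split A) : Split A := (p.1, p.2.1, p.2.2 ++ u)

/-- Reversal of a word with a distinguished letter. -/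
def starSplit [InvolutiveStar A] (p : Split A) : Split A := (star p.2.2, star p.2.1, star p.1)

theorem starSplit_starSplit [InvolutiveStar A] (p : Split A) : starSplit (starSplit p) = p := by
  simp [starSplit]

theorem splits_cons (a : A) (l : List A) :
    splits (a :: l) = ([], a, l) ::ₘ (splits l).map (padLeft [a]) := rfl

theorem splits_append (l m : List A) :
    splits (l ++ m) = (splits l).map (padRight m) + (splits m).map (padLeft l) := by
  induction l with
  | nil =>
    have : (padLeft ([] : List A)) = id := rfl
    rw [this]
    simp [splits]
  | cons a l ih =>
    rw [List.cons_append, splits_cons, ih, splits_cons, Multiset.map_cons, Multiset.map_add,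
      Multiset.map_map, Multiset.map_map, Multiset.map_map, Multiset.cons_add]
    rfl

theorem splits_star [InvolutiveStar A] (l : List A) :
    splits (star l) = (splits l).map starSplit := by
  induction l with
  | nil => rfl
  | cons a l ih =>
    have h1 : splits [star a] = {([], star a, [])} := rfl
    have h2 : padRight [star a] ∘ starSplit = starSplit ∘ padLeft [a] := by
      funext p
      simp [padRight, padLeft, starSplit, star_list_cons]
    have h3 : starSplit ([], a, l) = (star l, star a, []) := rfl
    rw [star_list_cons, splits_append, ih, h1, splits_cons, Multiset.map_cons, Multiset.map_map,
      Multiset.map_map, h2, h3, Multiset.map_singleton, add_comm, Multiset.singleton_add]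
    simp [padLeft]

/-- Properties of words with a distinguished letter depending only on the window of radius `n`
around this letter and, if the window is complete, only up to reversal. -/
structure IsWindowTest [InvolutiveStar A] (n : ℕ) (P : Split A → Prop) : Prop where
  trunc : ∀ p, P p ↔ P (p.1.rtake n, p.2.1, p.2.2.take n)
  star_iff : ∀ p : Split A, n ≤ p.1.length → n ≤ p.2.2.length → (P p ↔ P (starSplit p))

variable [InvolutiveStar A] {n t : ℕ} {P : Split A → Prop}

theorem IsWindowTest.congr (hP : IsWindowTest n P) {x x' y y' : List A} {a : A}
    (hx : x.rtake n = x'.rtake n) (hy : y.take n = y'.take n) : P (x, a, y) ↔ P (x', a, y') := by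
  rw [hP.trunc, hP.trunc (x', a, y')]
  simp only [hx, hy]

/-- Reversal invariance is required only where the window is already complete, and there the padding
lies outside the window, before and after reversal. -/
theorem IsWindowTest.padLeft (hP : IsWindowTest n P) (u : List A) :
    IsWindowTest n (fun p => P (padLeft u p)) where
  trunc p := hP.congr (rtake_append_congr rfl (rtake_rtake_self _ _).symm)
    (take_take_self _ _).symm
  star_iff p h1 h2 := by
    rw [← iff_comm]
    refine (hP.congr (x' := star p.2.2) (y' := star p.1) ?_ rfl).trans
      ((hP.star_iff p h1 h2).symm.trans (hP.congr ?_ rfl))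
    · exact rtake_append_of_le (h2.trans_eq (length_star_list _).symm) _
    · exact (rtake_append_of_le h1 _).symm

theorem IsWindowTest.padRight (hP : IsWindowTest n P) (u : List A) :
    IsWindowTest n (fun p => P (padRight u p)) where
  trunc p := hP.congr (rtake_rtake_self _ _).symm
    (take_append_congr (take_take_self _ _).symm rfl)
  star_iff p h1 h2 := by
    rw [← iff_comm]
    refine (hP.congr (x' := star p.2.2) (y' := star p.1) rfl ?_).trans
      ((hP.star_iff p h1 h2).symm.trans (hP.congr rfl ?_))
    · exact take_append_of_le (h1.trans_eq (length_star_list _).symm) _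
    · exact (take_append_of_le h2 _).symm

theorem IsWindowTest.starSplit (hP : IsWindowTest n P) :
    IsWindowTest n (fun p => P (starSplit p)) where
  trunc p := hP.congr (by rw [rtake_star_list, rtake_star_list, take_take_self])
    (by rw [take_star_list, take_star_list, rtake_rtake_self])
  star_iff p h1 h2 := by
    rw [starSplit_starSplit]
    exact (hP.star_iff p h1 h2).symm

open Classical in
/-- Multisets of words with a distinguished letter are equivalent if they have as many members,
up to the threshold `t`, with each property `IsWindowTest n`. -/
def windowCon (A : Type) [InvolutiveStar A] (n t : ℕ) :
    Con (Multiplicative (Multiset (Split A))) where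
  r f g := ∀ P : Split A → Prop, IsWindowTest n P →
    ThresholdEq t (f.toAdd.countP P) (g.toAdd.countP P)
  iseqv := ⟨fun _ _ _ => ThresholdEq.refl _ _, fun h P hP => (h P hP).symm,
    fun h h' P hP => (h P hP).trans (h' P hP)⟩
  mul' h h' P hP := by
    rw [toAdd_mul, toAdd_mul, Multiset.countP_add, Multiset.countP_add]
    exact (h P hP).add (h' P hP)

/-- The quotient of the multisets of words with a distinguished letter by `windowCon`. -/
abbrev Windows (A : Type) [InvolutiveStar A] (n t : ℕ) : Type := (windowCon A n t).Quotient

/-- The class of a multiset. -/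
def Windows.mk (n t : ℕ) (f : Multiset (Split A)) : Windows A n t :=
  ((Multiplicative.ofAdd f : Multiplicative (Multiset (Split A))) : Windows A n t)

open Classical in
theorem Windows.mk_eq_mk {f g : Multiset (Split A)} : Windows.mk n t f = Windows.mk n t g ↔
    ∀ P : Split A → Prop, IsWindowTest n P → ThresholdEq t (f.countP P) (g.countP P) :=
  Con.eq _

theorem Windows.mk_add (f g : Multiset (Split A)) :
    Windows.mk n t (f + g) = Windows.mk n t f * Windows.mk n t g := rfl

theorem Windows.exists_mk (s : Windows A n t) : ∃ f, s = Windows.mk n t f := by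
  obtain ⟨f, rfl⟩ := Con.mk'_surjective s
  exact ⟨f.toAdd, rfl⟩

-- Counting `P` on an image is counting `P ∘ φ`, again a window test. The involution and both
-- actions on `Windows A n t` are defined through such maps.
open Classical in
theorem Windows.mk_map_congr {φ ψ : Split A → Split A} {f g : Multiset (Split A)}
    (hφ : ∀ P, IsWindowTest n P → IsWindowTest n fun p => P (φ p))
    (h : ∀ P, IsWindowTest n P → ∀ p, P (φ p) ↔ P (ψ p))
    (hfg : Windows.mk n t f = Windows.mk n t g) :
    Windows.mk n t (f.map φ) = Windows.mk n t (g.map ψ) := by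
  rw [mk_eq_mk] at hfg ⊢
  intro P hP
  simp only [Multiset.countP_map, ← Multiset.countP_eq_card_filter]
  rw [Multiset.countP_congr (s := g) (s' := g) rfl
      (p' := fun p => P (φ p)) fun p _ => propext (h P hP p).symm]
  exact hfg _ (hφ P hP)

instance : StarMul (Windows A n t) where
  star := Quotient.map' (fun f => Multiplicative.ofAdd (f.toAdd.map starSplit)) (fun f g h =>
    (Con.eq _).1 (Windows.mk_map_congr (f := f.toAdd) (g := g.toAdd)
      (fun _ hP => hP.starSplit) (fun _ _ _ => Iff.rfl) ((Con.eq _).2 h)))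
  star_involutive s := by
    obtain ⟨f, rfl⟩ := s.exists_mk
    refine congrArg (Windows.mk n t) ?_
    rw [toAdd_ofAdd, toAdd_ofAdd, Multiset.map_map]
    conv_rhs => rw [← Multiset.map_id f]
    exact Multiset.map_congr rfl fun p _ => starSplit_starSplit p
  star_mul s s' := by
    obtain ⟨f, rfl⟩ := s.exists_mk
    obtain ⟨g, rfl⟩ := s'.exists_mk
    refine Eq.trans ?_ (mul_comm (Windows.mk n t (f.map starSplit)) _)
    exact congrArg (Windows.mk n t) (Multiset.map_add _ _ _)

theorem Windows.star_mk (f : Multiset (Split A)) :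
    star (Windows.mk n t f) = Windows.mk n t (f.map starSplit) := rfl

-- A window test is a set of truncated windows, and there are finitely many of these sets; a class
-- is determined by the counts for each of them, cut off at `t`.
open Classical in
instance [Finite A] : Finite (Windows A n t) := by
  have : Finite {l : List A // l.length ≤ n} := (List.finite_length_le A n).to_subtype
  let Y : Type := {l : List A // l.length ≤ n} × A × {l : List A // l.length ≤ n}
  let tr : Split A → Y := fun p =>
    (⟨p.1.rtake n, by rw [length_rtake]; exact min_le_left _ _⟩, p.2.1, ⟨p.2.2.take n, by simp⟩)
  let f : Windows A n t → (Set Y → Fin (t + 1)) := fun s B =>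
    if h : IsWindowTest n (fun p => tr p ∈ B) then
      Quotient.liftOn' s (fun g => ⟨min t (g.toAdd.countP fun p => tr p ∈ B), by omega⟩) (by
        intro g g' hg
        have := hg _ h
        unfold ThresholdEq at this
        rw [Fin.mk.injEq]
        omega)
    -- Sets of windows that are not tests carry no information.
    else 0
  refine Finite.of_injective f ?_
  intro s s' hs
  obtain ⟨g, rfl⟩ := s.exists_mk
  obtain ⟨g', rfl⟩ := s'.exists_mk
  rw [Windows.mk_eq_mk]
  intro P hP
  let B : Set Y := {y | P (y.1.1, y.2.1, y.2.2.1)}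
  have hB : (fun p => tr p ∈ B) = P := funext fun p => propext (hP.trunc p).symm
  have h1 := congrFun hs B
  have hPB : IsWindowTest n (fun p => tr p ∈ B) := by rwa [hB]
  simp only [f, dif_pos hPB] at h1
  have h2 := congrArg Fin.val h1
  change min t (g.countP fun p => tr p ∈ B) = min t (g'.countP fun p => tr p ∈ B) at h2
  have h3 : ∀ k : Multiset (Split A), k.countP (fun p => tr p ∈ B) = k.countP P := fun k =>
    Multiset.countP_congr rfl fun p _ => congrFun hB p
  rw [h3, h3] at h2
  unfold ThresholdEq
  omega

open Classical in
theorem isAperiodic_windows (A : Type) [InvolutiveStar A] (n t : ℕ) :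
    IsAperiodic (Windows A n t) := by
  -- A nonzero count repeated `t + 1` times reaches the threshold. The exponent is positive even for
  -- `t = 0`, so the powers stay clear of the adjoined identity.
  refine ⟨t + 1, fun s => ?_⟩
  have coe_pow : ∀ k : ℕ,
      (s : WithOne (Windows A n t)) ^ (k + 1) = ((s ^ (k + 1) : Windows A n t)) := by
    intro k
    induction k with
    | zero => simp
    | succ k ih => rw [pow_succ, ih, ← WithOne.coe_mul, ← pow_succ]
  rw [coe_pow, coe_pow]
  congr 1
  obtain ⟨f, rfl⟩ := s.exists_mk
  have mk_pow : ∀ k : ℕ, Windows.mk n t f ^ k = Windows.mk n t (k • f) := fun k => rfl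
  rw [mk_pow, mk_pow, Windows.mk_eq_mk]
  intro P hP
  rw [Multiset.countP_nsmul, Multiset.countP_nsmul]
  rcases Nat.eq_zero_or_pos (f.countP P) with h | h
  · rw [h]; exact Or.inl rfl
  · right
    constructor <;> nlinarith

end Splits

/-! ### Counting factors -/

section Factors

variable {A : Type}

/-- The factors of length `k` of a word, from left to right. -/
def windows (k : ℕ) : List A → List (List A)
  | [] => []
  | a :: l => if k ≤ l.length + 1 then (a :: l).take k :: windows k l else []

/-- At most one factor starts at the first letter, the others lie in the tail. Finiteness is carried
along because `ncard` behaves well under insertion only for finite sets. -/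
theorem finite_factors_and_ncard {k : ℕ} (hk : 0 < k) {Q : List A → Prop} [DecidablePred Q]
    (hQ : ∀ u, Q u → u.length = k) (w : List A) :
    {p : List A × List A | ∃ u, Q u ∧ w = p.1 ++ u ++ p.2}.Finite ∧
      {p : List A × List A | ∃ u, Q u ∧ w = p.1 ++ u ++ p.2}.ncard = (windows k w).countP Q := by
  induction w with
  | nil =>
    have : {p : List A × List A | ∃ u, Q u ∧ [] = p.1 ++ u ++ p.2} = ∅ := by
      ext p
      simp only [Set.mem_ofPred_eq, Set.mem_empty_iff_false, iff_false]
      rintro ⟨u, hu, h⟩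
      have h1 := congrArg List.length h
      have := hQ u hu
      simp only [List.length_append, List.length_nil] at h1
      omega
    rw [this]
    simp [windows]
  | cons a l ih =>
    by_cases hkl : k ≤ l.length + 1
    · obtain ⟨hf, hn⟩ := ih
      set φ : List A × List A → List A × List A := fun p => (a :: p.1, p.2) with hφ
      have hφi : Function.Injective φ := by
        rintro ⟨x, y⟩ ⟨x', y'⟩ h
        simpa [hφ] using h
      have himg : (φ '' {p : List A × List A | ∃ u, Q u ∧ l = p.1 ++ u ++ p.2}).Finite :=
        hf.image φ
      have hcard := Set.ncard_image_of_injective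
        {p : List A × List A | ∃ u, Q u ∧ l = p.1 ++ u ++ p.2} hφi
      by_cases hq : Q ((a :: l).take k)
      · have hset : {p : List A × List A | ∃ u, Q u ∧ a :: l = p.1 ++ u ++ p.2} =
            insert ([], (a :: l).drop k)
              (φ '' {p : List A × List A | ∃ u, Q u ∧ l = p.1 ++ u ++ p.2}) := by
          ext ⟨x, y⟩
          simp only [Set.mem_ofPred_eq, Set.mem_insert_iff, Set.mem_image]
          constructor
          · rintro ⟨u, hu, h⟩
            cases x with
            | nil =>
              left
              rw [h, ← hQ u hu]
              simp
            | cons b x =>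
              rw [List.cons_append, List.cons_append, List.cons.injEq] at h
              right
              exact ⟨(x, y), ⟨u, hu, h.2⟩, by rw [hφ, h.1]⟩
          · rintro (h | ⟨⟨x', y'⟩, ⟨u, hu, h⟩, h'⟩)
            · obtain ⟨rfl, rfl⟩ := Prod.mk.inj h
              exact ⟨_, hq, by simp⟩
            · obtain ⟨rfl, rfl⟩ := Prod.mk.inj h'
              exact ⟨u, hu, by simpa using h⟩
        rw [hset]
        refine ⟨himg.insert _, ?_⟩
        rw [Set.ncard_insert_of_notMem (by simp [hφ]) himg, hcard, hn, windows, if_pos hkl,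
          List.countP_cons_of_pos (by simpa using hq)]
      · have hset : {p : List A × List A | ∃ u, Q u ∧ a :: l = p.1 ++ u ++ p.2} =
            φ '' {p : List A × List A | ∃ u, Q u ∧ l = p.1 ++ u ++ p.2} := by
          ext ⟨x, y⟩
          simp only [Set.mem_ofPred_eq, Set.mem_image]
          constructor
          · rintro ⟨u, hu, h⟩
            cases x with
            | nil =>
              exfalso
              apply hq
              rw [h, ← hQ u hu]
              simpa using hu
            | cons b x =>
              rw [List.cons_append, List.cons_append, List.cons.injEq] at h
              exact ⟨(x, y), ⟨u, hu, h.2⟩, by rw [hφ, h.1]⟩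
          · rintro ⟨⟨x', y'⟩, ⟨u, hu, h⟩, h'⟩
            obtain ⟨rfl, rfl⟩ := Prod.mk.inj h'
            exact ⟨u, hu, by simpa using h⟩
        rw [hset]
        refine ⟨himg, ?_⟩
        rw [hcard, hn, windows, if_pos hkl, List.countP_cons_of_neg (by simpa using hq)]
    · have hset : {p : List A × List A | ∃ u, Q u ∧ a :: l = p.1 ++ u ++ p.2} = ∅ := by
        ext p
        simp only [Set.mem_ofPred_eq, Set.mem_empty_iff_false, iff_false]
        rintro ⟨u, hu, h⟩
        have h1 := congrArg List.length h
        have := hQ u hu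
        simp only [List.length_append, List.length_cons] at h1
        omega
      rw [hset, windows, if_neg hkl]
      simp

/-- The number of occurrences of a word as a factor. -/
noncomputable def factorCount (v w : List A) : ℕ :=
  {p : List A × List A | w = p.1 ++ v ++ p.2}.ncard

open Classical in
theorem factorCount_eq {v : List A} (hv : v ≠ []) (w : List A) :
    factorCount v w = (windows v.length w).countP (· = v) := by
  rw [← (finite_factors_and_ncard (List.length_pos_iff.2 hv) (Q := (· = v))
    (fun u hu => by rw [hu]) w).2]
  simp [factorCount]

theorem factorCount_star [InvolutiveStar A] (v w : List A) :
    factorCount (star v) (star w) = factorCount v w := by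
  have hi : Function.Injective
      (fun p : List A × List A => ((star p.2, star p.1) : List A × List A)) := by
    rintro ⟨x, y⟩ ⟨x', y'⟩ h
    simp only [Prod.mk.injEq, star_inj] at h
    rw [h.1, h.2]
  unfold factorCount
  rw [← Set.ncard_image_of_injective {p : List A × List A | w = p.1 ++ v ++ p.2} hi]
  congr 1
  ext ⟨x, y⟩
  simp only [Set.mem_ofPred_eq, Set.mem_image, Prod.mk.injEq]
  constructor
  · intro h
    refine ⟨(star y, star x), ?_, star_star _, star_star _⟩
    change star w = x ++ star v ++ y at h
    change w = star y ++ v ++ star x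
    rw [← star_star w, h]
    simp [star_list_append]
  · rintro ⟨⟨x', y'⟩, h, h1, h2⟩
    change w = x' ++ v ++ y' at h
    rw [h, ← h1, ← h2]
    simp [star_list_append]

-- Occurrences of `v` are indexed by the letter at which they start; in `countP_splits_suffix`,
-- those of `star v` by the letter at which they end.
open Classical in
theorem countP_splits_prefix {v : List A} (hv : v ≠ []) (w : List A) :
    (splits w).countP (fun p => v <+: p.2.1 :: p.2.2) = factorCount v w := by
  rw [factorCount_eq hv]
  induction w with
  | nil => simp [splits, windows]
  | cons a l ih =>
    rw [splits_cons, windows, Multiset.countP_cons, Multiset.countP_map,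
      ← Multiset.countP_eq_card_filter]
    change (splits l).countP (fun p => v <+: p.2.1 :: p.2.2) + _ = _
    rw [ih]
    split_ifs with h1 h2 h2
    · rw [List.countP_cons_of_pos (by simpa using (List.prefix_iff_eq_take.1 h1).symm)]
    · have := h1.length_le
      simp only [List.length_cons] at this
      omega
    · rw [List.countP_cons_of_neg, add_zero]
      simp only [decide_eq_true_eq]
      intro h
      exact h1 (List.prefix_iff_eq_take.2 h.symm)
    · have : windows v.length l = [] := by
        cases l with
        | nil => rfl
        | cons b l => rw [windows, if_neg]; simp only [List.length_cons] at h2; omega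
      rw [this, add_zero]

variable [InvolutiveStar A]

open Classical in
theorem occ_eq (w v : FreeSemigroup A) : occ w v =
    (windows (toList v).length (toList w)).countP
      (fun x => x = toList v ∨ x = star (toList v)) := by
  rw [← (finite_factors_and_ncard (List.length_pos_iff.2 (toList_ne_nil v))
    (Q := fun x => x = toList v ∨ x = star (toList v)) ?_ (toList w)).2]
  · unfold occ
    congr 1
    ext p
    simp only [Set.mem_ofPred_eq, toList_star_eq, or_and_right, exists_or, exists_eq_left]
  · rintro u (rfl | rfl)
    · rfl
    · exact length_star_list _

theorem occ_of_star_eq {v : FreeSemigroup A} (h : star (toList v) = toList v)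
    (w : FreeSemigroup A) : occ w v = factorCount (toList v) (toList w) := by
  classical
  rw [occ_eq, factorCount_eq (toList_ne_nil v), h]
  simp

theorem occ_of_star_ne {v : FreeSemigroup A} (h : star (toList v) ≠ toList v)
    (w : FreeSemigroup A) : occ w v =
      factorCount (toList v) (toList w) + factorCount (star (toList v)) (toList w) := by
  classical
  have hv' : star (toList v) ≠ [] := by
    rw [← toList_star_eq]
    exact toList_ne_nil _
  rw [occ_eq, factorCount_eq (toList_ne_nil v), factorCount_eq hv', length_star_list]
  induction windows (toList v).length (toList w) with
  | nil => rfl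
  | cons x l ih =>
    rw [List.countP_cons, List.countP_cons, List.countP_cons, ih]
    by_cases h1 : x = toList v
    · have h2 : x ≠ star (toList v) := fun h2 => h (h2.symm.trans h1)
      simp only [h1, h1 ▸ h2, true_or, decide_true, decide_false, if_true, if_false,
        Bool.false_eq_true]
      omega
    · simp only [h1, false_or, decide_false, Bool.false_eq_true, if_false]
      omega

/-- Thresholds for the two orientations of a word together give thresholds for `occ`. -/
theorem thresholdEq_occ {t : ℕ} {w w' v : FreeSemigroup A}
    (h : ThresholdEq (2 * t)
      (factorCount (toList v) (toList w) + factorCount (star (toList v)) (toList w))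
      (factorCount (toList v) (toList w') + factorCount (star (toList v)) (toList w'))) :
    ThresholdEq t (occ w v) (occ w' v) := by
  -- If `v` is its own reversal, the sum of the two counts is twice `occ w v`; this is why the
  -- threshold is doubled.
  by_cases hs : star (toList v) = toList v
  · rw [hs] at h
    rw [occ_of_star_eq hs, occ_of_star_eq hs]
    unfold ThresholdEq at *
    omega
  · rw [occ_of_star_ne hs, occ_of_star_ne hs]
    exact h.mono (by omega)

open Classical in
theorem countP_splits_suffix {v : List A} (hv : v ≠ []) (w : List A) :
    (splits w).countP (fun p => star v <:+ p.1 ++ [p.2.1]) = factorCount (star v) w := by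
  have h1 : splits w = (splits (star w)).map starSplit := by rw [← splits_star, star_star]
  have h2 : ∀ p : Split A, (star v <:+ (starSplit p).1 ++ [(starSplit p).2.1]) =
      (v <+: p.2.1 :: p.2.2) := by
    intro p
    have : (starSplit p).1 ++ [(starSplit p).2.1] = star (p.2.1 :: p.2.2) := by
      rw [star_list_cons]
      rfl
    rw [this, star_suffix_star]
  rw [h1, Multiset.countP_map, ← Multiset.countP_eq_card_filter]
  simp only [h2]
  rw [countP_splits_prefix hv, ← factorCount_star, star_star]

end Factors

theorem length_toList {A : Type} (w : FreeSemigroup A) : (toList w).length = w.length := rfl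

/-- Inclusion and exclusion. It is applied to two properties that reversal exchanges: neither need
be a window test, but their disjunction and conjunction are. -/
theorem countP_or_add_countP_and {α : Type} {P Q R S : α → Prop} [DecidablePred P]
    [DecidablePred Q] [DecidablePred R] [DecidablePred S] (hR : ∀ p, R p ↔ P p ∨ Q p)
    (hS : ∀ p, S p ↔ P p ∧ Q p) (m : Multiset α) :
    m.countP R + m.countP S = m.countP P + m.countP Q := by
  induction m using Multiset.induction with
  | empty => simp
  | cons p m ih =>
    have hR' := hR p
    have hS' := hS p
    simp only [Multiset.countP_cons]
    by_cases hp : P p <;> by_cases hq : Q p <;> simp only [hp, hq, true_or, or_true, and_self,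
      or_self, and_false, false_and, iff_true, iff_false] at hR' hS' <;>
      simp only [hp, hq, hR', hS', if_true, if_false] <;> omega

/-! ### Recognising locally-reversible threshold testable languages -/

section Recogniser

variable {A : Type} [InvolutiveStar A] {n t : ℕ}

theorem Windows.mk_padLeft_congr {u u' : List A} (hu : u.rtake n = u'.rtake n)
    {f g : Multiset (Split A)} (h : Windows.mk n t f = Windows.mk n t g) :
    Windows.mk n t (f.map (padLeft u)) = Windows.mk n t (g.map (padLeft u')) :=
  Windows.mk_map_congr (fun _ hP => hP.padLeft u)
    (fun _ hP _ => hP.congr (rtake_append_congr hu rfl) rfl) h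

theorem Windows.mk_padRight_congr {u u' : List A} (hu : u.take n = u'.take n)
    {f g : Multiset (Split A)} (h : Windows.mk n t f = Windows.mk n t g) :
    Windows.mk n t (f.map (padRight u)) = Windows.mk n t (g.map (padRight u')) :=
  Windows.mk_map_congr (fun _ hP => hP.padRight u)
    (fun _ hP _ => hP.congr rfl (take_append_congr rfl hu)) h

/-- The left action of `Ends A n` on `Windows A n t`. -/
def Windows.left : Ends A n → Windows A n t → Windows A n t :=
  Quotient.map₂ (fun u f => Multiplicative.ofAdd (f.toAdd.map (padLeft (toList u))))
    (fun _ _ hu _ _ hf => (Con.eq _).1 (Windows.mk_padLeft_congr hu.2 ((Con.eq _).2 hf)))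

/-- The right action of `Ends A n` on `Windows A n t`. -/
def Windows.right : Windows A n t → Ends A n → Windows A n t :=
  Quotient.map₂ (fun f u => Multiplicative.ofAdd (f.toAdd.map (padRight (toList u))))
    (fun _ _ hf _ _ hu => (Con.eq _).1 (Windows.mk_padRight_congr hu.1 ((Con.eq _).2 hf)))

theorem Windows.left_mk (u : FreeSemigroup A) (f : Multiset (Split A)) :
    Windows.left (u : Ends A n) (Windows.mk n t f) =
      Windows.mk n t (f.map (padLeft (toList u))) := rfl

theorem Windows.right_mk (u : FreeSemigroup A) (f : Multiset (Split A)) :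
    Windows.right (Windows.mk n t f) (u : Ends A n) =
      Windows.mk n t (f.map (padRight (toList u))) := rfl

theorem Ends.star_coe (u : FreeSemigroup A) :
    star (u : Ends A n) = ((star u : FreeSemigroup A) : Ends A n) := rfl

theorem Ends.exists_coe {A : Type} {n : ℕ} (e : Ends A n) : ∃ u : FreeSemigroup A, e = u :=
  Quotient.inductionOn' e fun u => ⟨u, rfl⟩

/-- The action of the prefixes and suffixes on the multisets of windows. -/
def windowAction (A : Type) [InvolutiveStar A] (n t : ℕ) :
    InvAction (Windows A n t) (Ends A n) where
  left := Windows.left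
  right := Windows.right
  left_mul e s s' := by
    obtain ⟨u, rfl⟩ := e.exists_coe
    obtain ⟨f, rfl⟩ := s.exists_mk
    obtain ⟨g, rfl⟩ := s'.exists_mk
    rw [← Windows.mk_add, Windows.left_mk, Windows.left_mk, Windows.left_mk, ← Windows.mk_add,
      Multiset.map_add]
  mul_left e e' s := by
    obtain ⟨u, rfl⟩ := e.exists_coe
    obtain ⟨v, rfl⟩ := e'.exists_coe
    obtain ⟨f, rfl⟩ := s.exists_mk
    rw [← Con.coe_mul, Windows.left_mk, Windows.left_mk, Windows.left_mk, Multiset.map_map,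
      toList_mul]
    congr 2
    funext p
    simp [padLeft]
  mul_right s s' e := by
    obtain ⟨u, rfl⟩ := e.exists_coe
    obtain ⟨f, rfl⟩ := s.exists_mk
    obtain ⟨g, rfl⟩ := s'.exists_mk
    rw [← Windows.mk_add, Windows.right_mk, Windows.right_mk, Windows.right_mk,
      ← Windows.mk_add, Multiset.map_add]
  right_mul s e e' := by
    obtain ⟨u, rfl⟩ := e.exists_coe
    obtain ⟨v, rfl⟩ := e'.exists_coe
    obtain ⟨f, rfl⟩ := s.exists_mk
    rw [← Con.coe_mul, Windows.right_mk, Windows.right_mk, Windows.right_mk, Multiset.map_map,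
      toList_mul]
    congr 2
    funext p
    simp [padRight]
  compatible e s e' := by
    obtain ⟨u, rfl⟩ := e.exists_coe
    obtain ⟨v, rfl⟩ := e'.exists_coe
    obtain ⟨f, rfl⟩ := s.exists_mk
    rw [Windows.left_mk, Windows.right_mk, Windows.right_mk, Windows.left_mk, Multiset.map_map,
      Multiset.map_map]
    rfl
  star_right s e := by
    obtain ⟨u, rfl⟩ := e.exists_coe
    obtain ⟨f, rfl⟩ := s.exists_mk
    rw [Windows.right_mk, Windows.star_mk, Windows.star_mk, Ends.star_coe, Windows.left_mk,
      Multiset.map_map, Multiset.map_map, toList_star_eq]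
    congr 2
    funext p
    simp [padLeft, padRight, starSplit, star_list_append]

-- A representative `u` of an idempotent has at least `n` letters, so in `u p u†` the window around
-- the distinguished letter of `p` is complete, and reversing all of it replaces `p` by its
-- reversal.
open Classical in
theorem locallyHermitian_windowAction (A : Type) [InvolutiveStar A] (n t : ℕ) :
    (windowAction A n t).LocallyHermitian := by
  intro e he s
  obtain ⟨u, rfl⟩ := e.exists_coe
  obtain ⟨f, rfl⟩ := s.exists_mk
  have hn := le_length_of_isIdempotentElem he
  change Windows.right (Windows.left (u : Ends A n) (Windows.mk n t f)) (star (u : Ends A n)) =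
    Windows.right (Windows.left (u : Ends A n) (star (Windows.mk n t f))) (star (u : Ends A n))
  rw [Windows.star_mk, Windows.left_mk, Windows.left_mk, Ends.star_coe, Windows.right_mk,
    Windows.right_mk, toList_star_eq, Multiset.map_map, Multiset.map_map, Multiset.map_map]
  refine Windows.mk_map_congr (fun P hP => (hP.padRight _).padLeft _) ?_ rfl
  intro P hP p
  have h := hP.star_iff (padRight (star (toList u)) (padLeft (toList u) p))
    (by simp only [padRight, padLeft, List.length_append]; omega)
    (by simp only [padRight, padLeft, List.length_append, length_star_list]; omega)
  rw [Function.comp_apply, h]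
  simp [padLeft, padRight, starSplit, star_list_append]

/-- The morphism mapping a word to its windows, prefix and suffix. -/
def windowHom (A : Type) [InvolutiveStar A] (n t : ℕ) :
    FreeSemigroup A →ₙ* (windowAction A n t).Sdp where
  toFun w := ⟨Windows.mk n t (splits (toList w)), (w : Ends A n)⟩
  map_mul' u v := by
    apply InvAction.Sdp.ext
    · change Windows.mk n t (splits (toList (u * v))) =
        Windows.right (Windows.mk n t (splits (toList u))) (v : Ends A n) *
          Windows.left (u : Ends A n) (Windows.mk n t (splits (toList v)))
      rw [toList_mul, splits_append, Windows.mk_add, Windows.right_mk, Windows.left_mk]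
    · rfl

theorem isInvolutory_windowHom (A : Type) [InvolutiveStar A] (n t : ℕ) :
    IsInvolutory (windowHom A n t) := by
  intro w
  apply InvAction.Sdp.ext
  · change Windows.mk n t (splits (toList (star w))) =
      star (Windows.mk n t (splits (toList w)))
    rw [toList_star_eq, splits_star, Windows.star_mk]
  · rfl

theorem LREquiv.of_windowHom_eq {k t : ℕ} (hk : 0 < k) {w w' : FreeSemigroup A}
    (h : windowHom A k (2 * t) w = windowHom A k (2 * t) w') : LREquiv k t w w' := by
  classical
  have h1 : Windows.mk k (2 * t) (splits (toList w)) =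
      Windows.mk k (2 * t) (splits (toList w')) := congrArg InvAction.Sdp.fst h
  have h2 : endsCon A k w w' := (Con.eq _).1 (congrArg InvAction.Sdp.snd h)
  rw [endsCon_iff] at h2
  rw [Windows.mk_eq_mk] at h1
  -- Prefixes of length `k`, not just `k - 1`, determine the words with fewer than `k` letters and
  -- tell them apart from the longer ones.
  have hlen := congrArg List.length h2.1
  rw [List.length_take, List.length_take, length_toList, length_toList] at hlen
  by_cases hw : w.length < k
  · refine Or.inl ⟨hw, toList_injective ?_⟩
    have h3 := h2.1
    rwa [List.take_of_length_le (by rw [length_toList]; omega),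
      List.take_of_length_le (by rw [length_toList]; omega)] at h3
  · refine Or.inr ⟨by omega, by omega, ?_, ?_, fun v hv => thresholdEq_occ ?_⟩
    · have := congrArg (List.take (k - 1)) h2.1
      rwa [List.take_take, List.take_take, Nat.min_eq_left (by omega)] at this
    · have hr : ∀ l : List A, (l.rtake k).rtake (k - 1) = l.rtake (k - 1) := by
        intro l
        simp only [List.rtake_eq_reverse_take_reverse, List.reverse_reverse, List.take_take]
        rw [Nat.min_eq_left (by omega)]
      rw [← hr, h2.2, hr]
    · set x := toList v with hx
      have hxn : x ≠ [] := toList_ne_nil v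
      have hxk : x.length ≤ k := hv
      -- `P`: an occurrence of `v` starts at the distinguished letter. `Q`: an occurrence of `v†`
      -- ends there. Reversal exchanges them, and both fit into the window of radius `k`.
      let P : Split A → Prop := fun p => x <+: p.2.1 :: p.2.2
      let Q : Split A → Prop := fun p => star x <:+ p.1 ++ [p.2.1]
      have hPt : ∀ p, P p ↔ P (p.1.rtake k, p.2.1, p.2.2.take k) := by
        intro p
        change x <+: p.2.1 :: p.2.2 ↔ x <+: p.2.1 :: p.2.2.take k
        rw [← List.take_succ_cons, List.prefix_take_iff]
        exact ⟨fun h => ⟨h, by omega⟩, fun h => h.1⟩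
      have hPQ : ∀ p, P (starSplit p) ↔ Q p := by
        intro p
        have : star p.2.1 :: star p.1 = star (p.1 ++ [p.2.1]) := by
          rw [star_list_append]
          rfl
        change x <+: star p.2.1 :: star p.1 ↔ star x <:+ p.1 ++ [p.2.1]
        rw [this, ← star_suffix_star, star_star]
      have hQP : ∀ p, Q (starSplit p) ↔ P p := by
        intro p
        rw [← hPQ, starSplit_starSplit]
      have hQt : ∀ p, Q p ↔ Q (p.1.rtake k, p.2.1, p.2.2.take k) := by
        intro p
        rw [← hPQ, ← hPQ, hPt]
        change _ ↔ x <+: star p.2.1 :: star (p.1.rtake k)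
        rw [← take_star_list]
        rfl
      obtain ⟨R, hR⟩ : ∃ R : Split A → Prop, ∀ p, R p ↔ P p ∨ Q p := ⟨_, fun _ => Iff.rfl⟩
      obtain ⟨S, hS⟩ : ∃ S : Split A → Prop, ∀ p, S p ↔ P p ∧ Q p := ⟨_, fun _ => Iff.rfl⟩
      have hor : IsWindowTest k R :=
        ⟨fun p => by rw [hR, hR]; exact or_congr (hPt p) (hQt p),
          fun p _ _ => by rw [hR, hR, hPQ, hQP, or_comm]⟩
      have hand : IsWindowTest k S :=
        ⟨fun p => by rw [hS, hS]; exact and_congr (hPt p) (hQt p),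
          fun p _ _ => by rw [hS, hS, hPQ, hQP, and_comm]⟩
      rw [← countP_splits_prefix hxn, ← countP_splits_prefix hxn, ← countP_splits_suffix hxn,
        ← countP_splits_suffix hxn]
      have := (h1 _ hor).add (h1 _ hand)
      rwa [countP_or_add_countP_and hR hS, countP_or_add_countP_and hR hS] at this

end Recogniser

theorem isLRTT_mem_languagesOf {A : InvAlphabet} {L : Set (FreeSemigroup A)} (hL : IsLRTT L) :
    L ∈ languagesOf (lhProduct AcomStar LIStar) A := by
  obtain ⟨k, t, hk, _, C, rfl⟩ := hL
  refine ⟨⟨(windowAction A k (2 * t)).Sdp⟩, subset_generated _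
    ⟨⟨Windows A k (2 * t)⟩, ⟨isAperiodic_windows A k (2 * t), mul_comm⟩, ⟨Ends A k⟩,
      isLocallyTrivial_ends A k, windowAction A k (2 * t),
      locallyHermitian_windowAction A k (2 * t), rfl⟩,
    windowHom A k (2 * t), isInvolutory_windowHom A k (2 * t),
    windowHom A k (2 * t) '' ⋃ u ∈ C, {w | LREquiv k t u w}, ?_⟩
  apply Set.Subset.antisymm
  · exact Set.subset_preimage_image _ _
  · rintro w ⟨w', hw', h⟩
    simp only [Set.mem_iUnion] at hw' ⊢
    obtain ⟨u, hu, hw'⟩ := hw'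
    exact ⟨u, hu, (LREquiv.equivalence k t).trans hw' (LREquiv.of_windowHom_eq hk h)⟩

/-! ### Walks in graphs with involution -/

section Walks

variable {V E : Type}

/-- A directed graph, given by the set of its edges with their sources and targets. -/
structure EdgeGraph (V E : Type) where
  edges : Set E
  src : E → V
  tgt : E → V

/-- The list of edges `l` is a walk from `v` to `u`. -/
def EdgeGraph.IsWalk (G : EdgeGraph V E) : V → List E → V → Prop
  | v, [], u => v = u
  | v, e :: l, u => e ∈ G.edges ∧ G.src e = v ∧ G.IsWalk (G.tgt e) l u

theorem EdgeGraph.isWalk_nil (G : EdgeGraph V E) {v u : V} : G.IsWalk v [] u ↔ v = u := Iff.rfl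

theorem EdgeGraph.isWalk_cons (G : EdgeGraph V E) {v u : V} {e : E} {l : List E} :
    G.IsWalk v (e :: l) u ↔ e ∈ G.edges ∧ G.src e = v ∧ G.IsWalk (G.tgt e) l u := Iff.rfl

theorem EdgeGraph.isWalk_append (G : EdgeGraph V E) {a b : List E} {v u : V} :
    G.IsWalk v (a ++ b) u ↔ ∃ x, G.IsWalk v a x ∧ G.IsWalk x b u := by
  induction a generalizing v with
  | nil => simp [isWalk_nil]
  | cons e a ih => simp only [List.cons_append, isWalk_cons, ih]; tauto

theorem EdgeGraph.IsWalk.append {G : EdgeGraph V E} {a b : List E} {v x u : V}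
    (h : G.IsWalk v a x) (h' : G.IsWalk x b u) : G.IsWalk v (a ++ b) u :=
  G.isWalk_append.2 ⟨x, h, h'⟩

theorem EdgeGraph.IsWalk.unique {G : EdgeGraph V E} {l : List E} {v u u' : V}
    (h : G.IsWalk v l u) (h' : G.IsWalk v l u') : u = u' := by
  induction l generalizing v with
  | nil => exact h.symm.trans h'
  | cons e l ih => exact ih h.2.2 h'.2.2

theorem EdgeGraph.IsWalk.mem_edges {G : EdgeGraph V E} {l : List E} {v u : V}
    (h : G.IsWalk v l u) : ∀ e ∈ l, e ∈ G.edges := by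
  induction l generalizing v with
  | nil => simp
  | cons e l ih =>
    intro g hg
    rcases List.mem_cons.1 hg with rfl | hg
    · exact h.1
    · exact ih h.2.2 g hg

theorem EdgeGraph.IsWalk.replicate {G : EdgeGraph V E} {C : List E} {v : V}
    (h : G.IsWalk v C v) (n : ℕ) : G.IsWalk v (List.replicate n C).flatten v := by
  induction n with
  | zero => exact rfl
  | succ n ih => exact h.append ih

/-- A graph with an involution reversing the edges. -/
structure InvGraph (V E : Type) [InvolutiveStar V] [InvolutiveStar E] extends EdgeGraph V E where
  star_mem : ∀ e ∈ edges, star e ∈ edges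
  src_star : ∀ e, src (star e) = star (tgt e)

variable [InvolutiveStar V] [InvolutiveStar E] (G : InvGraph V E)

theorem InvGraph.tgt_star (e : E) : G.tgt (star e) = star (G.src e) := by
  have := G.src_star (star e)
  rw [star_star] at this
  rw [this, star_star]

/-- The reversal of a list of edges. -/
def revWalk (l : List E) : List E := (l.map star).reverse

theorem revWalk_append (a b : List E) : revWalk (a ++ b) = revWalk b ++ revWalk a := by
  simp [revWalk]

theorem InvGraph.isWalk_revWalk {l : List E} {v u : V} (h : G.IsWalk v l u) :
    G.IsWalk (star u) (revWalk l) (star v) := by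
  induction l generalizing v with
  | nil => exact congrArg star h.symm
  | cons e l ih =>
    have : revWalk (e :: l) = revWalk l ++ [star e] := by simp [revWalk]
    rw [this]
    exact (ih h.2.2).append
      ⟨G.star_mem e h.1, G.src_star e, by rw [G.tgt_star, h.2.1]; exact rfl⟩

/-- An edge up to reversal. -/
def edgeClass (e : E) : Sym2 E := s(e, star e)

theorem edgeClass_eq_iff {e g : E} : edgeClass e = edgeClass g ↔ e = g ∨ e = star g := by
  unfold edgeClass
  rw [Sym2.eq_iff]
  constructor
  · rintro (⟨h, -⟩ | ⟨h, -⟩)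
    · exact Or.inl h
    · exact Or.inr h
  · rintro (rfl | rfl)
    · simp
    · simp

theorem edgeClass_star (e : E) : edgeClass (star e) = edgeClass e :=
  edgeClass_eq_iff.2 (Or.inr rfl)

/-- The multiset of the edges of a walk, up to reversal. -/
def edgeClasses (l : List E) : Multiset (Sym2 E) := ↑(l.map edgeClass)

theorem edgeClasses_append (a b : List E) :
    edgeClasses (a ++ b) = edgeClasses a + edgeClasses b := by
  simp [edgeClasses]

theorem edgeClasses_cons (e : E) (l : List E) :
    edgeClasses (e :: l) = edgeClass e ::ₘ edgeClasses l := rfl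

theorem edgeClasses_revWalk (l : List E) : edgeClasses (revWalk l) = edgeClasses l := by
  simp only [edgeClasses, revWalk, List.map_reverse, List.map_map, Multiset.coe_eq_coe]
  refine (List.reverse_perm _).trans (List.Perm.of_eq (List.map_congr_left fun e _ => ?_))
  exact edgeClass_star e

theorem edgeClasses_replicate (n : ℕ) (C : List E) :
    edgeClasses (List.replicate n C).flatten = n • edgeClasses C := by
  induction n with
  | zero => simp [edgeClasses]
  | succ n ih =>
    rw [List.replicate_succ, List.flatten_cons, edgeClasses_append, ih, succ_nsmul']

theorem edgeClass_mem_edgeClasses {e : E} {l : List E} :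
    edgeClass e ∈ edgeClasses l ↔ e ∈ l ∨ star e ∈ l := by
  simp only [edgeClasses, Multiset.mem_coe, List.mem_map, edgeClass_eq_iff]
  constructor
  · rintro ⟨g, hg, rfl | rfl⟩
    · exact Or.inl hg
    · exact Or.inr hg
  · rintro (h | h)
    · exact ⟨e, h, Or.inl rfl⟩
    · exact ⟨star e, h, Or.inr rfl⟩

/-- `F` is invariant, on the walks from `v₀` to `u₀`, under permutations of the edges, under
reversal of subwalks between a vertex and its image by the involution, and under passing from
the `n`-th to the `n+1`-st power of a closed subwalk. -/
structure InvGraph.Invariant {T : Type} (v₀ u₀ : V) (F : List E → T) (n : ℕ) : Prop where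
  perm : ∀ l l', G.IsWalk v₀ l u₀ → G.IsWalk v₀ l' u₀ → l.Perm l' → F l = F l'
  rev : ∀ a p b v, G.IsWalk v₀ a v → G.IsWalk v p (star v) → G.IsWalk (star v) b u₀ →
    F (a ++ (p ++ b)) = F (a ++ (revWalk p ++ b))
  pump : ∀ a C b v, G.IsWalk v₀ a v → G.IsWalk v C v → G.IsWalk v b u₀ →
    F (a ++ ((List.replicate n C).flatten ++ b)) =
      F (a ++ ((List.replicate (n + 1) C).flatten ++ b))

variable {G} {T : Type} {v₀ u₀ : V} {F : List E → T} {n : ℕ}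

/-- A walk `L` from `v` to `v` whose vertices are not met, even up to the involution, by the
walk `e :: s` from `v` has no edges in common with a walk starting with `e` on the same edges. -/
theorem InvGraph.loop_eq_nil_of_disjoint {v u : V} {L s s' : List E} {e : E}
    (hL : G.IsWalk v L v) (hM : G.IsWalk v (e :: s) u) (hr : G.IsWalk v (e :: s') u)
    (hm : edgeClasses (L ++ e :: s) = edgeClasses (e :: s'))
    (hd : ∀ M₁ M₂ L₁ L₂ x y, e :: s = M₁ ++ M₂ → L = L₁ ++ L₂ → M₁ ≠ [] → G.IsWalk v M₁ x →
      G.IsWalk v L₁ y → x ≠ y ∧ star x ≠ y) : L = [] := by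
  -- The vertices of `L`, up to the involution. Edges of `L`, in either direction, have both ends in
  -- `VL`; edges of `s` have both ends outside.
  let VL : V → Prop := fun y => ∃ L₁ L₂, L = L₁ ++ L₂ ∧ (G.IsWalk v L₁ y ∨ G.IsWalk v L₁ (star y))
  have hVstar : ∀ y, VL (star y) → VL y := by
    rintro y ⟨L₁, L₂, h, h' | h'⟩
    · exact ⟨L₁, L₂, h, Or.inr h'⟩
    · exact ⟨L₁, L₂, h, Or.inl (by rwa [star_star] at h')⟩
  have hVstar' : ∀ y, VL y → VL (star y) := fun y h => hVstar _ (by rwa [star_star])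
  have hv : VL v := ⟨[], L, rfl, Or.inl rfl⟩
  have hLmem : ∀ g ∈ L, VL (G.src g) ∧ VL (G.tgt g) := by
    intro g hg
    obtain ⟨a, b, rfl⟩ := List.append_of_mem hg
    obtain ⟨x, h1, h2, rfl, h4⟩ := G.isWalk_append.1 hL
    refine ⟨⟨a, g :: b, rfl, Or.inl h1⟩, ⟨a ++ [g], b, by simp, Or.inl ?_⟩⟩
    exact h1.append ⟨h2, rfl, rfl⟩
  have hLcls : ∀ g, g ∈ L ∨ star g ∈ L → VL (G.src g) ∧ VL (G.tgt g) := by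
    rintro g (hg | hg)
    · exact hLmem g hg
    · have := hLmem _ hg
      rw [G.src_star, G.tgt_star] at this
      exact ⟨hVstar _ this.2, hVstar _ this.1⟩
  have hMd : ∀ M₁ M₂ x, e :: s = M₁ ++ M₂ → M₁ ≠ [] → G.IsWalk v M₁ x → ¬ VL x := by
    rintro M₁ M₂ x h1 h2 h3 ⟨L₁, L₂, h4, h5 | h5⟩
    · exact (hd M₁ M₂ L₁ L₂ x x h1 h4 h2 h3 h5).1 rfl
    · exact (hd M₁ M₂ L₁ L₂ x _ h1 h4 h2 h3 h5).2 rfl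
  have hMtgt : ∀ g ∈ e :: s, ¬ VL (G.tgt g) := by
    intro g hg
    obtain ⟨a, b, hab⟩ := List.append_of_mem hg
    rw [hab] at hM
    obtain ⟨x, h1, h2, rfl, h4⟩ := G.isWalk_append.1 hM
    exact hMd (a ++ [g]) b _ (by simp [hab]) (by simp) (h1.append ⟨h2, rfl, rfl⟩)
  have hMsrc : ∀ g ∈ s, ¬ VL (G.src g) := by
    intro g hg
    obtain ⟨a, b, rfl⟩ := List.append_of_mem hg
    obtain ⟨x, h1, h2, rfl, h4⟩ := G.isWalk_append (a := e :: a).1 hM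
    exact hMd (e :: a) (g :: b) _ rfl (by simp) h1
  have hm' : edgeClasses L + edgeClasses s = edgeClasses s' := by
    rw [edgeClasses_append, edgeClasses_cons, edgeClasses_cons, Multiset.add_cons] at hm
    exact (Multiset.cons_inj_right _).1 hm
  have he : ¬ VL (G.tgt e) := hMtgt e List.mem_cons_self
  have hes' : ∀ g ∈ s', g ≠ e ∧ star g ≠ e := by
    have h0 : edgeClass e ∉ edgeClasses s' := by
      rw [← hm', Multiset.mem_add, edgeClass_mem_edgeClasses, edgeClass_mem_edgeClasses]
      rintro (h | h | h)
      · exact he (hLcls e h).2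
      · exact hMsrc e h (by rw [hM.2.1]; exact hv)
      · refine hMtgt _ (List.mem_cons_of_mem _ h) ?_
        rw [G.tgt_star, hM.2.1]
        exact hVstar' _ hv
    rw [edgeClass_mem_edgeClasses] at h0
    push Not at h0
    intro g hg
    refine ⟨?_, ?_⟩
    · rintro rfl
      exact h0.1 hg
    · rintro rfl
      exact h0.2 (by rwa [star_star])
  have hmem : ∀ g ∈ s', (g ∈ L ∨ star g ∈ L) ∨ (g ∈ s ∨ star g ∈ s) := by
    intro g hg
    have h0 : edgeClass g ∈ edgeClasses s' := edgeClass_mem_edgeClasses.2 (Or.inl hg)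
    rwa [← hm', Multiset.mem_add, edgeClass_mem_edgeClasses, edgeClass_mem_edgeClasses] at h0
  -- All edges of `s'` come from `L` or `s`, up to reversal. A walk over such edges that starts
  -- outside `VL` can only use those of `s` and stays outside, so it never meets `L`.
  have key : ∀ (r : List E) (y : V), (∀ g ∈ r, g ∈ s') → G.IsWalk y r u → ¬ VL y →
      ∀ g ∈ r, ¬ (g ∈ L ∨ star g ∈ L) := by
    intro r
    induction r with
    | nil => simp
    | cons g r ih =>
      intro y hs hw hy
      have hgL : ¬ (g ∈ L ∨ star g ∈ L) := fun h => hy (by rw [← hw.2.1]; exact (hLcls g h).1)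
      have hg' := (hmem g (hs g List.mem_cons_self)).resolve_left hgL
      have ht : ¬ VL (G.tgt g) := by
        rcases hg' with hg' | hg'
        · exact hMtgt g (List.mem_cons_of_mem _ hg')
        · intro h
          refine hMsrc _ hg' ?_
          rw [G.src_star]
          exact hVstar' _ h
      intro g' hgr
      rcases List.mem_cons.1 hgr with rfl | hgr
      · exact hgL
      · exact ih _ (fun x hx => hs x (List.mem_cons_of_mem _ hx)) hw.2.2 ht g' hgr
  have hno := key s' _ (fun g hg => hg) hr.2.2 he
  by_contra hne
  obtain ⟨g, hg⟩ := List.exists_mem_of_ne_nil L hne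
  have h1 : edgeClass g ∈ edgeClasses s' := by
    rw [← hm', Multiset.mem_add]
    exact Or.inl (edgeClass_mem_edgeClasses.2 (Or.inl hg))
  rcases edgeClass_mem_edgeClasses.1 h1 with h | h
  · exact hno g h (Or.inl hg)
  · exact hno _ h (Or.inr (by rwa [star_star]))

/-- A walk can be rearranged, without changing `F`, to agree one edge longer with a given walk on
the same edges up to reversal. -/
theorem InvGraph.Invariant.exists_front (hF : G.Invariant v₀ u₀ F n) {q r s' : List E} {e : E}
    {v : V} (hq : G.IsWalk v₀ q v) (hr : G.IsWalk v r u₀) (hr' : G.IsWalk v (e :: s') u₀)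
    (hm : edgeClasses r = edgeClasses (e :: s')) :
    ∃ s, G.IsWalk v (e :: s) u₀ ∧ edgeClasses (e :: s) = edgeClasses r ∧
      F (q ++ r) = F (q ++ (e :: s)) := by
  have hmem : edgeClass e ∈ edgeClasses r := by
    rw [hm, edgeClass_mem_edgeClasses]
    exact Or.inl List.mem_cons_self
  rcases edgeClass_mem_edgeClasses.1 hmem with he | he
  · obtain ⟨L, s, rfl⟩ := List.append_of_mem he
    obtain ⟨x, hL, hM⟩ := G.isWalk_append.1 hr
    -- `e` starts at `v`, so the part `L` of the walk before `e` is closed.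
    obtain rfl : x = v := hM.2.1.symm.trans hr'.2.1
    by_cases hd : ∀ M₁ M₂ L₁ L₂ y z, e :: s = M₁ ++ M₂ → L = L₁ ++ L₂ → M₁ ≠ [] →
      G.IsWalk x M₁ y → G.IsWalk x L₁ z → y ≠ z ∧ star y ≠ z
    · obtain rfl := InvGraph.loop_eq_nil_of_disjoint hL hM hr' hm hd
      exact ⟨s, hM, rfl, rfl⟩
    · push Not at hd
      obtain ⟨M₁, M₂, L₁, L₂, y, z, h1, rfl, h3, h4, h5, h6⟩ := hd
      have hM₂ : G.IsWalk y M₂ u₀ := by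
        rw [h1] at hM
        obtain ⟨y', h7, h8⟩ := G.isWalk_append.1 hM
        rwa [h7.unique h4] at h8
      have hL₂ : G.IsWalk z L₂ x := by
        obtain ⟨y', h7, h8⟩ := G.isWalk_append.1 hL
        rwa [h7.unique h5] at h8
      have front : ∀ N, ∃ t, M₁ ++ N = e :: t := by
        intro N
        cases M₁ with
        | nil => exact absurd rfl h3
        | cons g M =>
          rw [List.cons_append, List.cons.injEq] at h1
          exact ⟨M ++ N, by rw [h1.1, List.cons_append]⟩
      rw [h1]
      -- The loop `L₁ L₂` and the walk `M₁ M₂` meet at `y`. Exchanging `L₁` and `M₁` gives the walk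
      -- `M₁ L₂ L₁ M₂`, a permutation of the same edges with `e` in front.
      by_cases hyz : y = z
      · subst hyz
        obtain ⟨t, ht⟩ := front (L₂ ++ (L₁ ++ M₂))
        refine ⟨t, ?_, ?_, ?_⟩
        · rw [← ht]
          exact h4.append (hL₂.append (h5.append hM₂))
        · rw [← ht]
          simp only [edgeClasses_append]
          abel
        · rw [← ht]
          refine hF.perm _ _ (hq.append ((h5.append hL₂).append (h4.append hM₂)))
            (hq.append (h4.append (hL₂.append (h5.append hM₂)))) (List.Perm.append_left _ ?_)
          rw [← Multiset.coe_eq_coe]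
          simp only [← Multiset.coe_add]
          abel
      -- Here `L₁` ends at `star y`. Reversing `L₂ M₁`, from `star y` to `y`, and then `L₁ M₁†`,
      -- from `x` to `star x`, turns `L₁ L₂ M₁ M₂` into `M₁ L₁† L₂† M₂`.
      · obtain rfl := h6 hyz
        have h4' := G.isWalk_revWalk h4
        have h5' := G.isWalk_revWalk h5
        have hL₂' := G.isWalk_revWalk hL₂
        rw [star_star] at h5' hL₂'
        obtain ⟨t, ht⟩ := front (revWalk L₁ ++ (revWalk L₂ ++ M₂))
        refine ⟨t, ?_, ?_, ?_⟩
        · rw [← ht]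
          exact h4.append (h5'.append (hL₂'.append hM₂))
        · rw [← ht]
          simp only [edgeClasses_append, edgeClasses_revWalk]
          abel
        · have e1 := hF.rev (q ++ L₁) (L₂ ++ M₁) M₂ (star y) (hq.append h5)
            (by rw [star_star]; exact hL₂.append h4) (by rw [star_star]; exact hM₂)
          have e2 := hF.rev q (L₁ ++ revWalk M₁) (revWalk L₂ ++ M₂) x hq (h5.append h4')
            (hL₂'.append hM₂)
          have inv : revWalk (revWalk M₁) = M₁ := by
            simp [revWalk, List.map_reverse, Function.comp_def]
          rw [revWalk_append] at e1 e2
          rw [inv] at e2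
          rw [← ht]
          simp only [List.append_assoc] at e1 e2 ⊢
          rw [e1, e2]
  -- If `star e` occurs, the walk up to and including it leads from `v` to `star v`; its reversal
  -- starts with `e`.
  · obtain ⟨L, s, rfl⟩ := List.append_of_mem he
    obtain ⟨x, hL, hx, hx', hM⟩ := G.isWalk_append.1 hr
    have hp : G.IsWalk v (L ++ [star e]) (star v) :=
      hL.append ⟨hx, hx', by rw [G.tgt_star, hr'.2.1]; exact rfl⟩
    have hs : G.IsWalk (star v) s u₀ := by
      rwa [G.tgt_star, hr'.2.1] at hM
    have hrev : revWalk (L ++ [star e]) = e :: revWalk L := by simp [revWalk]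
    have hp' := G.isWalk_revWalk hp
    rw [hrev, star_star] at hp'
    refine ⟨revWalk L ++ s, hp'.append hs, ?_, ?_⟩
    · rw [← List.cons_append, edgeClasses_append, ← hrev, edgeClasses_revWalk,
        ← edgeClasses_append, List.append_assoc, List.singleton_append]
    · have := hF.rev q (L ++ [star e]) s v hq hp hs
      rwa [hrev, List.append_assoc, List.singleton_append, List.cons_append] at this

/-- An invariant function only depends on the multiset of edges up to reversal. -/
theorem InvGraph.Invariant.eq_of_edgeClasses_eq (hF : G.Invariant v₀ u₀ F n) {l l' : List E}
    (hl : G.IsWalk v₀ l u₀) (hl' : G.IsWalk v₀ l' u₀) (hm : edgeClasses l = edgeClasses l') :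
    F l = F l' := by
  have key : ∀ r' q r v, G.IsWalk v₀ q v → G.IsWalk v r u₀ → G.IsWalk v r' u₀ →
      edgeClasses r = edgeClasses r' → F (q ++ r) = F (q ++ r') := by
    intro r'
    induction r' with
    | nil =>
      intro q r v _ _ _ h
      have : r = [] := by simpa [edgeClasses] using h
      rw [this]
    | cons e r' ih =>
      intro q r v hq hr hr' h
      obtain ⟨s, h1, h2, h3⟩ := hF.exists_front hq hr hr' h
      rw [h3]
      have h4 := ih (q ++ [e]) s (G.tgt e) (hq.append ⟨h1.1, h1.2.1, rfl⟩) h1.2.2 hr'.2.2 (by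
        rw [h, edgeClasses_cons, edgeClasses_cons] at h2
        exact (Multiset.cons_inj_right _).1 h2)
      simpa using h4
  exact key l' [] l v₀ rfl hl hl' hm

end Walks

/-! ### Pumping closed walks -/

section Pumping

variable {V E : Type} [InvolutiveStar V] [InvolutiveStar E] {G : InvGraph V E}
  {T : Type} {v₀ u₀ : V} {F : List E → T} {n : ℕ}

/-- The multiset of edge classes of some walk from `v₀` to `u₀`. -/
def InvGraph.Realizable (G : InvGraph V E) (v₀ u₀ : V) (c : Multiset (Sym2 E)) : Prop :=
  ∃ l, G.IsWalk v₀ l u₀ ∧ edgeClasses l = c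

/-- The value of `F` at the walks with a given multiset of edge classes. -/
noncomputable def multisetValue (G : InvGraph V E) (v₀ u₀ : V) (F : List E → T)
    (c : Multiset (Sym2 E)) : T :=
  F (Classical.epsilon fun l => G.IsWalk v₀ l u₀ ∧ edgeClasses l = c)

theorem InvGraph.Invariant.multisetValue_eq (hF : G.Invariant v₀ u₀ F n) {l : List E}
    (hl : G.IsWalk v₀ l u₀) : multisetValue G v₀ u₀ F (edgeClasses l) = F l := by
  have := Classical.epsilon_spec (p := fun l' => G.IsWalk v₀ l' u₀ ∧ edgeClasses l' = edgeClasses l)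
    ⟨l, hl, rfl⟩
  exact hF.eq_of_edgeClasses_eq this.1 hl this.2

/-- The multisets of edge classes of unions of closed walks. -/
def InvGraph.cyclic (G : InvGraph V E) : AddSubmonoid (Multiset (Sym2 E)) :=
  AddSubmonoid.closure {Y | ∃ v C, G.IsWalk v C v ∧ Y = edgeClasses C}

/-- If the walk uses the first edge of `C`, then `C` is inserted before it; if it uses the reversed
edge, then the reversal of `C` is inserted after it, at `star v`. -/
theorem InvGraph.Realizable.exists_insert {c : Multiset (Sym2 E)} (hc : G.Realizable v₀ u₀ c)
    {v : V} {C : List E} (hC : G.IsWalk v C v) (hsub : ∀ z ∈ edgeClasses C, z ∈ c) :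
    ∃ a b y C', G.IsWalk v₀ a y ∧ G.IsWalk y C' y ∧ G.IsWalk y b u₀ ∧
      edgeClasses C' = edgeClasses C ∧ edgeClasses (a ++ b) = c := by
  obtain ⟨l, hl, rfl⟩ := hc
  cases C with
  | nil => exact ⟨[], l, v₀, [], rfl, rfl, hl, rfl, rfl⟩
  | cons g C =>
    rcases edgeClass_mem_edgeClasses.1 (hsub (edgeClass g)
        (edgeClass_mem_edgeClasses.2 (Or.inl List.mem_cons_self)))
      with h | h
    · obtain ⟨a, b, rfl⟩ := List.append_of_mem h
      obtain ⟨x, h1, h2⟩ := G.isWalk_append.1 hl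
      obtain rfl : x = v := h2.2.1.symm.trans hC.2.1
      exact ⟨a, g :: b, x, g :: C, h1, hC, h2, rfl, rfl⟩
    · obtain ⟨a, b, rfl⟩ := List.append_of_mem h
      obtain ⟨x, h1, h2, h3, h4⟩ := G.isWalk_append.1 hl
      rw [G.tgt_star, hC.2.1] at h4
      refine ⟨a ++ [star g], b, star v, revWalk (g :: C), h1.append ⟨h2, h3, ?_⟩,
        G.isWalk_revWalk hC, h4, edgeClasses_revWalk _, by simp⟩
      rw [G.tgt_star, hC.2.1]
      exact rfl

/-- A single closed walk is inserted and repeated; a sum is pumped one summand at a time. The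
statement quantifies over `c` because the second summand is pumped over a multiset already enlarged
by the first. -/
theorem InvGraph.Invariant.realizable_add_and_pump (hF : G.Invariant v₀ u₀ F n)
    {X : Multiset (Sym2 E)} (hX : X ∈ G.cyclic) :
    ∀ c, G.Realizable v₀ u₀ c → (∀ z ∈ X, z ∈ c) → (∀ N : ℕ, G.Realizable v₀ u₀ (c + N • X)) ∧
      multisetValue G v₀ u₀ F (c + n • X) = multisetValue G v₀ u₀ F (c + (n + 1) • X) := by
  induction hX using AddSubmonoid.closure_induction with
  | mem X hX =>
    obtain ⟨v, C, hC, rfl⟩ := hX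
    intro c hc hsub
    obtain ⟨a, b, y, C', h1, h2, h3, h4, h5⟩ := hc.exists_insert hC hsub
    have hw : ∀ N, G.IsWalk v₀ (a ++ ((List.replicate N C').flatten ++ b)) u₀ := fun N =>
      h1.append ((h2.replicate N).append h3)
    have hm : ∀ N : ℕ, edgeClasses (a ++ ((List.replicate N C').flatten ++ b)) =
        c + N • edgeClasses C := by
      intro N
      rw [← h5, ← h4, ← edgeClasses_replicate]
      simp only [edgeClasses_append]
      abel
    refine ⟨fun N => ⟨_, hw N, hm N⟩, ?_⟩
    rw [← hm, ← hm, hF.multisetValue_eq (hw _), hF.multisetValue_eq (hw _)]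
    exact hF.pump a C' b y h1 h2 h3
  | zero => exact fun c hc _ => ⟨fun N => by simpa using hc, by simp⟩
  | add X Y _ _ ihX ihY =>
    intro c hc hsub
    have hXc : ∀ z ∈ X, z ∈ c := fun z hz => hsub z (Multiset.mem_add.2 (Or.inl hz))
    have hYc : ∀ z ∈ Y, z ∈ c := fun z hz => hsub z (Multiset.mem_add.2 (Or.inr hz))
    have hX1 := fun N => (ihX c hc hXc).1 N
    have hY1 := fun N => (ihY c hc hYc).1 N
    have hle : ∀ (d : Multiset (Sym2 E)) z, z ∈ c → z ∈ c + d := fun d z hz =>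
      Multiset.mem_add.2 (Or.inl hz)
    refine ⟨fun N => ?_, ?_⟩
    · rw [nsmul_add, ← add_assoc]
      exact (ihY _ (hX1 N) fun z hz => hle _ z (hYc z hz)).1 N
    · have e1 := (ihX _ (hY1 n) fun z hz => hle _ z (hXc z hz)).2
      have e2 := (ihY _ (hX1 (n + 1)) fun z hz => hle _ z (hYc z hz)).2
      rw [nsmul_add, nsmul_add, ← add_assoc, ← add_assoc, ← e2, add_right_comm, e1,
        add_right_comm]

/-! ### Balanced multisets of edges -/

open Classical in
/-- The number of ends of an edge at a vertex; the ends of an edge `e` are at the vertices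
`src e` and `src e†`. -/
noncomputable def InvGraph.ends (G : InvGraph V E) (x : V) : Sym2 E → ℕ :=
  Sym2.lift ⟨fun e f => (if G.src e = x then 1 else 0) + (if G.src f = x then 1 else 0),
    fun _ _ => add_comm _ _⟩

/-- The degree of a vertex. -/
noncomputable def InvGraph.degree (G : InvGraph V E) (x : V) (X : Multiset (Sym2 E)) : ℕ :=
  (X.map (G.ends x)).sum

theorem InvGraph.degree_add (x : V) (X Y : Multiset (Sym2 E)) :
    G.degree x (X + Y) = G.degree x X + G.degree x Y := by
  simp [degree]

open Classical in
theorem InvGraph.degree_edgeClasses_cons (x : V) (e : E) (l : List E) :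
    G.degree x (edgeClasses (e :: l)) = (if G.src e = x then 1 else 0) +
      (if G.tgt e = star x then 1 else 0) + G.degree x (edgeClasses l) := by
  have : G.src (star e) = x ↔ G.tgt e = star x := by
    rw [G.src_star]
    constructor
    · rintro rfl
      rw [star_star]
    · intro h
      rw [h, star_star]
  simp [degree, edgeClasses_cons, ends, edgeClass, this]

-- `p` and `q` are the numbers of visits to `x` and to `star x`, the two ends of the walk included.
-- A visit to `x` gives an end at `x` on departure, a visit to `star x` gives one on arrival; the
-- last visit lacks a departure and the first an arrival.
open Classical in
theorem InvGraph.exists_degree_eq {l : List E} {v u : V} (h : G.IsWalk v l u) (x : V) :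
    ∃ p q : ℕ, (∀ y, y = x → G.degree y (edgeClasses l) + (if u = y then 1 else 0) +
        (if v = star y then 1 else 0) = p + q) ∧
      (∀ y, y = star x → G.degree y (edgeClasses l) + (if u = y then 1 else 0) +
        (if v = star y then 1 else 0) = p + q) ∧ (x = star x → p = q) := by
  induction l generalizing v with
  | nil =>
    obtain rfl : v = u := h
    refine ⟨if v = x then 1 else 0, if v = star x then 1 else 0, ?_, ?_, ?_⟩
    · rintro y rfl
      simp [degree, edgeClasses]
    · rintro y rfl
      simp [degree, edgeClasses, add_comm]
    · intro hx
      rw [← hx]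
  | cons e l ih =>
    obtain ⟨p, q, h1, h2, h3⟩ := ih h.2.2
    have hv := h.2.1
    refine ⟨p + (if v = x then 1 else 0), q + (if v = star x then 1 else 0), ?_, ?_, ?_⟩
    · rintro y rfl
      have := h1 y rfl
      rw [degree_edgeClasses_cons, hv]
      omega
    · rintro y rfl
      have := h2 _ rfl
      rw [degree_edgeClasses_cons, hv]
      rw [star_star] at this ⊢
      omega
    · intro hx
      rw [← hx, h3 hx]

/-- As many ends at `x` as at `x†`, and an even number of them if `x = x†`. -/
def InvGraph.Balanced (G : InvGraph V E) (X : Multiset (Sym2 E)) : Prop :=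
  ∀ x, G.degree x X = G.degree (star x) X ∧ (x = star x → Even (G.degree x X))

/-- The corrections to the degrees depend only on the ends `v` and `u`, so they cancel in the
difference of two walks with these ends. -/
theorem EdgeGraph.IsWalk.balanced_of_add {l l' : List E} {v u : V} (h : G.IsWalk v l u)
    (h' : G.IsWalk v l' u) {X : Multiset (Sym2 E)} (hX : edgeClasses l' = edgeClasses l + X) :
    G.Balanced X := by
  classical
  intro x
  obtain ⟨p, q, h1, h2, h3⟩ := InvGraph.exists_degree_eq h x
  obtain ⟨p', q', h1', h2', h3'⟩ := InvGraph.exists_degree_eq h' x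
  have e1 := h1 _ rfl
  have e2 := h2 _ rfl
  have e1' := h1' _ rfl
  have e2' := h2' _ rfl
  rw [hX, InvGraph.degree_add] at e1' e2'
  refine ⟨by omega, fun hx => ?_⟩
  have := h3 hx
  have := h3' hx
  rw [Nat.even_iff]
  omega

theorem InvGraph.exists_mem_of_degree_pos {X : Multiset (Sym2 E)} {u : V}
    (hX : ∀ z ∈ X, ∃ e ∈ G.edges, z = edgeClass e) (h : 0 < G.degree u X) :
    ∃ e ∈ G.edges, edgeClass e ∈ X ∧ G.src e = u := by
  classical
  have : ∃ z ∈ X, G.ends u z ≠ 0 := by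
    by_contra! hcon
    rw [degree, Multiset.map_congr rfl hcon] at h
    simp at h
  obtain ⟨z, hz, hz'⟩ := this
  obtain ⟨e, he, rfl⟩ := hX z hz
  by_cases h1 : G.src e = u
  · exact ⟨e, he, hz, h1⟩
  · refine ⟨star e, G.star_mem e he, by rwa [edgeClass_star], ?_⟩
    by_contra h2
    simp [ends, edgeClass, h1, h2] at hz'

/-- The walk `C` is prolonged by unused edges from `R` until it closes. As long as its last vertex
`u` is not `v`, the degrees of `C` at `u` violate the balance (in parity, if `u = star u`), so `R`
has an end at `u`. -/
theorem InvGraph.Balanced.exists_closed {X : Multiset (Sym2 E)} (hb : G.Balanced X)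
    (hX : ∀ z ∈ X, ∃ e ∈ G.edges, z = edgeClass e) :
    ∀ R : Multiset (Sym2 E), ∀ C v u, G.IsWalk v C u → C ≠ [] → X = edgeClasses C + R →
      ∃ C' v', G.IsWalk v' C' v' ∧ C' ≠ [] ∧ edgeClasses C' ≤ X := by
  classical
  intro R
  induction hk : R.card generalizing R with
  | zero =>
    intro C v u hC hne hXR
    obtain rfl : R = 0 := Multiset.card_eq_zero.1 hk
    by_cases huv : u = v
    · subst huv
      exact ⟨C, u, hC, hne, by rw [hXR]; exact Multiset.le_add_right _ _⟩
    · exfalso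
      obtain ⟨p, q, h1, h2, h3⟩ := InvGraph.exists_degree_eq hC u
      have e1 := h1 _ rfl
      have e2 := h2 _ rfl
      rw [add_zero] at hXR
      obtain ⟨b1, b2⟩ := hb u
      rw [hXR] at b1 b2
      rw [Nat.even_iff] at b2
      rw [star_star, if_neg (Ne.symm huv)] at e2
      rw [if_pos rfl] at e1
      by_cases hu : u = star u
      · have := h3 hu
        have := b2 hu
        rw [if_neg (by rw [← hu]; exact Ne.symm huv)] at e1
        omega
      · rw [if_neg hu] at e2
        omega
  | succ k ih =>
    intro C v u hC hne hXR
    by_cases huv : u = v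
    · subst huv
      exact ⟨C, u, hC, hne, by rw [hXR]; exact Multiset.le_add_right _ _⟩
    · have hpos : 0 < G.degree u R := by
        obtain ⟨p, q, h1, h2, h3⟩ := InvGraph.exists_degree_eq hC u
        have e1 := h1 _ rfl
        have e2 := h2 _ rfl
        obtain ⟨b1, b2⟩ := hb u
        rw [hXR, degree_add, degree_add] at b1
        rw [hXR, degree_add, Nat.even_iff] at b2
        rw [star_star, if_neg (Ne.symm huv)] at e2
        rw [if_pos rfl] at e1
        by_cases hu : u = star u
        · have := h3 hu
          have := b2 hu
          rw [if_neg (by rw [← hu]; exact Ne.symm huv)] at e1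
          omega
        · rw [if_neg hu] at e2
          omega
      obtain ⟨e, he, heR, hs⟩ := exists_mem_of_degree_pos (G := G) (X := R) (u := u)
        (fun z hz => hX z (by rw [hXR]; exact Multiset.mem_add.2 (Or.inr hz))) hpos
      obtain ⟨R', rfl⟩ := Multiset.exists_cons_of_mem heR
      refine ih R' (by simpa using hk) (C ++ [e]) v (G.tgt e) (hC.append ⟨he, hs, rfl⟩)
        (by simp) ?_
      rw [hXR, edgeClasses_append, edgeClasses_cons, Multiset.add_cons, add_assoc,
        Multiset.cons_add, Multiset.add_cons]
      simp [edgeClasses]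

/-- The analogue of the decomposition of an Eulerian graph into cycles: removing a closed walk
leaves a smaller balanced multiset. -/
theorem InvGraph.Balanced.mem_cyclic {X : Multiset (Sym2 E)} (hb : G.Balanced X)
    (hX : ∀ z ∈ X, ∃ e ∈ G.edges, z = edgeClass e) : X ∈ G.cyclic := by
  induction hk : X.card using Nat.strong_induction_on generalizing X with
  | _ k ih =>
  subst hk
  rcases X.empty_or_exists_mem with rfl | ⟨z, hz⟩
  · exact G.cyclic.zero_mem
  · obtain ⟨e, he, rfl⟩ := hX z hz
    obtain ⟨R, hR⟩ := Multiset.exists_cons_of_mem hz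
    obtain ⟨C, v, hC, hne, hle⟩ := hb.exists_closed hX R [e] (G.src e) (G.tgt e)
      ⟨he, rfl, rfl⟩ (by simp) (by rw [hR]; simp [edgeClasses])
    obtain ⟨Y, rfl⟩ := Multiset.le_iff_exists_add.1 hle
    have hCb : G.Balanced (edgeClasses C) :=
      EdgeGraph.IsWalk.balanced_of_add (l := []) (v := v) (u := v) rfl hC (by simp [edgeClasses])
    refine G.cyclic.add_mem (AddSubmonoid.subset_closure ⟨v, C, hC, rfl⟩)
      (ih Y.card ?_ ?_ (fun z hz => hX z (Multiset.mem_add.2 (Or.inr hz))) rfl)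
    · have : 0 < (edgeClasses C).card := by
        simpa [edgeClasses] using List.length_pos_iff.2 hne
      rw [Multiset.card_add]
      omega
    · intro x
      have h1 := hb x
      have h2 := hCb x
      rw [degree_add, degree_add, Nat.even_iff] at h1
      rw [Nat.even_iff] at h2
      rw [Nat.even_iff]
      refine ⟨by omega, fun hx => ?_⟩
      have := h1.2 hx
      have := h2.2 hx
      omega

end Pumping

/-! ### Counting edges up to a threshold -/

section Threshold

variable {V E : Type} [InvolutiveStar V] [InvolutiveStar E] {G : InvGraph V E}
  {T : Type} {v₀ u₀ : V} {F : List E → T} {n : ℕ}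

theorem InvGraph.Balanced.add {X Y : Multiset (Sym2 E)} (hX : G.Balanced X) (hY : G.Balanced Y) :
    G.Balanced (X + Y) := by
  intro x
  rw [degree_add, degree_add, (hX x).1, (hY x).1]
  refine ⟨rfl, fun hx => ?_⟩
  rw [← (hX x).1, ← (hY x).1]
  exact ((hX x).2 hx).add ((hY x).2 hx)

theorem InvGraph.Balanced.of_add {X Y : Multiset (Sym2 E)} (h : G.Balanced (X + Y))
    (hX : G.Balanced X) : G.Balanced Y := by
  intro x
  have h1 := h x
  have h2 := hX x
  rw [degree_add, degree_add, Nat.even_iff] at h1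
  rw [Nat.even_iff] at h2
  rw [Nat.even_iff]
  refine ⟨by omega, fun hx => ?_⟩
  have := h1.2 hx
  have := h2.2 hx
  omega

theorem InvGraph.Balanced.nsmul {X : Multiset (Sym2 E)} (hX : G.Balanced X) (N : ℕ) :
    G.Balanced (N • X) := by
  induction N with
  | zero => intro x; simp [degree]
  | succ N ih => rw [succ_nsmul]; exact ih.add hX

/-- Write `Q` as `n • P + Q'`. Then `Q'` is balanced, hence cyclic, so `c + Q'` is realizable; over
it, `P` is pumped from `n` to `n + 1` copies. -/
theorem InvGraph.Invariant.multisetValue_add (hF : G.Invariant v₀ u₀ F n)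
    {c P Q : Multiset (Sym2 E)} (hc : G.Realizable v₀ u₀ c) (hP : G.Balanced P)
    (hQ : G.Balanced Q) (hPc : ∀ z ∈ P, z ∈ c) (hQc : ∀ z ∈ Q, z ∈ c) (hle : n • P ≤ Q) :
    multisetValue G v₀ u₀ F (c + Q) = multisetValue G v₀ u₀ F (c + (Q + P)) := by
  have hce : ∀ z ∈ c, ∃ e ∈ G.edges, z = edgeClass e := by
    obtain ⟨l, hl, rfl⟩ := hc
    intro z hz
    obtain ⟨e, he, rfl⟩ := List.mem_map.1 (Multiset.mem_coe.1 hz)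
    exact ⟨e, hl.mem_edges e he, rfl⟩
  obtain ⟨Q', rfl⟩ := Multiset.le_iff_exists_add.1 hle
  have hQ'c : ∀ z ∈ Q', z ∈ c := fun z hz => hQc z (Multiset.mem_add.2 (Or.inr hz))
  have hQ' : Q' ∈ G.cyclic :=
    (hQ.of_add (hP.nsmul n)).mem_cyclic fun z hz => hce z (hQ'c z hz)
  have hP' : P ∈ G.cyclic := hP.mem_cyclic fun z hz => hce z (hPc z hz)
  have hr := (hF.realizable_add_and_pump hQ' c hc hQ'c).1 1
  rw [one_nsmul] at hr
  have := (hF.realizable_add_and_pump hP' _ hr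
    fun z hz => Multiset.mem_add.2 (Or.inl (hPc z hz))).2
  rw [add_comm (n • P) Q', ← add_assoc, this, succ_nsmul]
  congr 1
  abel

theorem eventually_eq_or_tendsto_atTop {ι : Type} (𝒰 : Ultrafilter ι) (u : ι → ℕ) :
    (∃ b, ∀ᶠ j in 𝒰, u j = b) ∨ Filter.Tendsto u 𝒰 Filter.atTop := by
  by_cases h : Filter.Tendsto u 𝒰 Filter.atTop
  · exact Or.inr h
  · left
    rw [Filter.tendsto_atTop] at h
    push Not at h
    obtain ⟨M, hM⟩ := h
    have h2 : ∀ᶠ j in 𝒰, ∃ b ∈ Finset.range M, u j = b := by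
      filter_upwards [hM] with j hj
      exact ⟨u j, by simpa using hj, rfl⟩
    obtain ⟨b, -, hb⟩ :=
      (Ultrafilter.eventually_exists_mem_iff (Finset.finite_toSet (Finset.range M))).1 h2
    exact ⟨b, hb⟩

open Classical in
/-- An invariant function only depends on the numbers of edges in each class up to some
threshold. -/
theorem InvGraph.Invariant.exists_threshold (hF : G.Invariant v₀ u₀ F n)
    (hfin : G.edges.Finite) :
    ∃ t : ℕ, ∀ l l', G.IsWalk v₀ l u₀ → G.IsWalk v₀ l' u₀ →
      (∀ e ∈ G.edges, ThresholdEq t ((edgeClasses l).count (edgeClass e))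
        ((edgeClasses l').count (edgeClass e))) → F l = F l' := by
  -- A compactness argument: one counterexample for each threshold `t`, compared along a
  -- nonprincipal ultrafilter. `Φ` consists of the edge classes whose counts are unbounded there;
  -- every other count is eventually constant.
  by_contra! hcon
  choose l l' hl hl' hthr hne using hcon
  let 𝒰 : Ultrafilter ℕ := Filter.hyperfilter ℕ
  have h𝒰 : ∀ M : ℕ, ∀ᶠ j in (𝒰 : Filter ℕ), M ≤ j := fun M => by
    refine Filter.Eventually.filter_mono (Nat.hyperfilter_le_atTop) ?_
    exact Filter.eventually_ge_atTop M
  let K : Set (Sym2 E) := edgeClass '' G.edges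
  have hK : K.Finite := hfin.image _
  let Φ : Set (Sym2 E) :=
    {z | Filter.Tendsto (fun j => (edgeClasses (l j)).count z) 𝒰 Filter.atTop}
  have hΦ : ∀ z, ∃ b, z ∉ Φ → ∀ᶠ j in (𝒰 : Filter ℕ), (edgeClasses (l j)).count z = b := by
    intro z
    rcases eventually_eq_or_tendsto_atTop 𝒰 (fun j => (edgeClasses (l j)).count z)
      with ⟨b, hb⟩ | h
    · exact ⟨b, fun _ => hb⟩
    · exact ⟨0, fun h' => absurd h h'⟩
  choose b hb using hΦ
  have hKmem : ∀ {l v u}, G.IsWalk v l u → ∀ z ∈ edgeClasses l, z ∈ K := by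
    intro l v u hl z hz
    obtain ⟨e, he, rfl⟩ := List.mem_map.1 (Multiset.mem_coe.1 hz)
    exact ⟨e, hl.mem_edges e he, rfl⟩
  have good : ∀ μ : Multiset (Sym2 E), ∀ᶠ j in (𝒰 : Filter ℕ), ∀ z ∈ K,
      (z ∉ Φ → (edgeClasses (l j)).count z = b z ∧ (edgeClasses (l' j)).count z = b z) ∧
      (z ∈ Φ → μ.count z ≤ (edgeClasses (l j)).count z ∧
        μ.count z ≤ (edgeClasses (l' j)).count z) := by
    intro μ
    rw [Filter.eventually_all_finite hK]
    rintro _ ⟨e, he, rfl⟩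
    by_cases hz : edgeClass e ∈ Φ
    · filter_upwards [h𝒰 (μ.count (edgeClass e)),
        Filter.tendsto_atTop.1 hz (μ.count (edgeClass e))] with j h1 h2
      refine ⟨fun h => absurd hz h, fun _ => ⟨h2, ?_⟩⟩
      rcases hthr j e he with h3 | h3
      · omega
      · omega
    · filter_upwards [h𝒰 (b (edgeClass e) + 1), hb _ hz] with j h1 h2
      refine ⟨fun _ => ⟨h2, ?_⟩, fun h => absurd h hz⟩
      rcases hthr j e he with h3 | h3
      · omega
      · omega
  -- extending a multiset that is constant off `Φ`
  obtain ⟨i, hi⟩ := (good hK.toFinset.val).exists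
  set c := edgeClasses (l i) with hc
  have hcΦ : ∀ z ∈ K, z ∈ Φ → z ∈ c := by
    intro z hzK hz
    rw [← Multiset.one_le_count_iff_mem]
    refine le_trans ?_ ((hi z hzK).2 hz).1
    rw [Multiset.one_le_count_iff_mem]
    simpa using hzK
  have split : ∀ (μ : Multiset (Sym2 E)) (L : List E), G.IsWalk v₀ L u₀ →
      (∀ z ∈ K, (z ∉ Φ → (edgeClasses L).count z = b z) ∧
        (z ∈ Φ → (c + μ).count z ≤ (edgeClasses L).count z)) →
      ∃ X, edgeClasses L = c + X ∧ G.Balanced X ∧ (∀ z ∈ X, z ∈ K ∧ z ∈ Φ) ∧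
        ∀ z ∈ K, z ∈ Φ → μ.count z ≤ X.count z := by
    intro μ L hL h
    have hle : c ≤ edgeClasses L := by
      rw [Multiset.le_iff_count]
      intro z
      by_cases hzK : z ∈ K
      · by_cases hz : z ∈ Φ
        · refine le_trans ?_ ((h z hzK).2 hz)
          rw [Multiset.count_add]
          omega
        · rw [(h z hzK).1 hz, ((hi z hzK).1 hz).1]
      · rw [Multiset.count_eq_zero_of_notMem fun hz => hzK (hKmem (hl i) z hz)]
        exact Nat.zero_le _
    obtain ⟨X, hX⟩ := Multiset.le_iff_exists_add.1 hle
    refine ⟨X, hX, (hl i).balanced_of_add hL hX, fun z hz => ?_, fun z hzK hz => ?_⟩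
    · have hzK : z ∈ K := hKmem hL z (by rw [hX]; exact Multiset.mem_add.2 (Or.inr hz))
      refine ⟨hzK, ?_⟩
      by_contra hz'
      have h1 := (h z hzK).1 hz'
      have h2 := ((hi z hzK).1 hz').1
      have h3 := Multiset.one_le_count_iff_mem.2 hz
      rw [hX, Multiset.count_add] at h1
      omega
    · have := (h z hzK).2 hz
      rw [hX, Multiset.count_add, Multiset.count_add] at this
      omega
  have hcR : G.Realizable v₀ u₀ c := ⟨l i, hl i, rfl⟩
  -- A balanced multiset `Z` supported on `Φ` that contains each class of `K` in `Φ`. Multiples of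
  -- it will dominate any multiset over these classes.
  obtain ⟨i', hi'⟩ := (good (c + hK.toFinset.val)).exists
  obtain ⟨Z, hZ, hZb, hZΦ, hZ1⟩ := split hK.toFinset.val (l i') (hl i') fun z hz =>
    ⟨fun h => ((hi' z hz).1 h).1, fun h => ((hi' z hz).2 h).1⟩
  -- So late an index that the excesses `X` and `Y` of both walks over `c` contain `n • Z`, so `Z`
  -- can be added freely.
  obtain ⟨j, hj⟩ := (good (c + n • Z)).exists
  obtain ⟨X, hX, hXb, hXΦ, hX1⟩ := split (n • Z) (l j) (hl j) fun z hz =>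
    ⟨fun h => ((hj z hz).1 h).1, fun h => ((hj z hz).2 h).1⟩
  obtain ⟨Y, hY, hYb, hYΦ, hY1⟩ := split (n • Z) (l' j) (hl' j) fun z hz =>
    ⟨fun h => ((hj z hz).1 h).2, fun h => ((hj z hz).2 h).2⟩
  have hZpos : ∀ z ∈ K, z ∈ Φ → 1 ≤ Z.count z := by
    intro z hzK hz
    refine le_trans ?_ (hZ1 z hzK hz)
    rw [Multiset.one_le_count_iff_mem]
    simpa using hzK
  have le_of : ∀ A B : Multiset (Sym2 E), (∀ z ∈ A, z ∈ K ∧ z ∈ Φ) →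
      (∀ z ∈ K, z ∈ Φ → (n • A).count z ≤ B.count z) → n • A ≤ B := by
    intro A B hA h
    rw [Multiset.le_iff_count]
    intro z
    by_cases hz : z ∈ A
    · exact h z (hA z hz).1 (hA z hz).2
    · rw [Multiset.count_nsmul, Multiset.count_eq_zero_of_notMem hz]
      omega
  have sub_c : ∀ A : Multiset (Sym2 E), (∀ z ∈ A, z ∈ K ∧ z ∈ Φ) → ∀ z ∈ A, z ∈ c :=
    fun A hA z hz => hcΦ z (hA z hz).1 (hA z hz).2
  have add_sub : ∀ (A : Multiset (Sym2 E)) (N : ℕ), (∀ z ∈ A, z ∈ K ∧ z ∈ Φ) →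
      ∀ z ∈ A + N • Z, z ∈ c := by
    intro A N hA z hz
    rcases Multiset.mem_add.1 hz with h | h
    · exact sub_c A hA z h
    · exact sub_c Z hZΦ z (Multiset.mem_of_mem_nsmul h)
  have pumpZ : ∀ A : Multiset (Sym2 E), G.Balanced A → (∀ z ∈ A, z ∈ K ∧ z ∈ Φ) →
      (∀ z ∈ K, z ∈ Φ → (n • Z).count z ≤ A.count z) → ∀ N : ℕ,
      multisetValue G v₀ u₀ F (c + A) = multisetValue G v₀ u₀ F (c + (A + N • Z)) := by
    intro A hAb hA h N
    induction N with
    | zero => simp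
    | succ N ih =>
      rw [ih, hF.multisetValue_add hcR hZb (hAb.add (hZb.nsmul N)) (sub_c Z hZΦ)
        (add_sub A N hA) ((le_of Z A hZΦ h).trans (Multiset.le_add_right _ _)), succ_nsmul,
        add_assoc]
  have cross : ∀ (A B : Multiset (Sym2 E)) (N : ℕ), G.Balanced A → G.Balanced B →
      (∀ z ∈ A, z ∈ K ∧ z ∈ Φ) → (∀ z ∈ B, z ∈ K ∧ z ∈ Φ) → n * A.card ≤ N →
      multisetValue G v₀ u₀ F (c + (B + N • Z)) =
        multisetValue G v₀ u₀ F (c + ((B + N • Z) + A)) := by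
    intro A B N hAb hBb hA hB hN
    refine hF.multisetValue_add hcR hAb (hBb.add (hZb.nsmul N)) (sub_c A hA) (add_sub B N hB)
      (le_of A _ hA fun z hzK hz => ?_)
    rw [Multiset.count_add, Multiset.count_nsmul, Multiset.count_nsmul]
    have h1 : n * A.count z ≤ n * A.card := Nat.mul_le_mul_left _ (Multiset.count_le_card _ _)
    have h2 : N * 1 ≤ N * Z.count z := Nat.mul_le_mul_left _ (hZpos z hzK hz)
    omega
  -- `N • Z` contains `n • X` and `n • Y`, so both values equal the value at `c + X + Y + N • Z`.
  let N := n * X.card + n * Y.card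
  apply hne j
  rw [← hF.multisetValue_eq (hl j), ← hF.multisetValue_eq (hl' j), hX, hY,
    pumpZ X hXb hXΦ hX1 N, pumpZ Y hYb hYΦ hY1 N,
    cross X Y N hXb hYb hXΦ hYΦ (Nat.le_add_right _ _),
    cross Y X N hYb hXb hYΦ hXΦ (Nat.le_add_left _ _)]
  congr 1
  abel

end Threshold

/-! ### Words as walks -/

section WordGraph

variable {A B : Type}

/-- The graph with the words of length `m + 1` as edges, from their prefix of length `m` to their
suffix of length `m`. -/
def wordGraph (A : Type) (m : ℕ) : EdgeGraph (List A) (List A) where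
  edges := {e | e.length = m + 1}
  src := List.dropLast
  tgt := List.tail

/-- The word spelled by a walk from `v`. -/
def spell (m : ℕ) (v : List A) (l : List (List A)) : List A := v ++ l.flatMap (List.drop m)

theorem map_spell (f : A → B) (m : ℕ) (v : List A) (l : List (List A)) :
    (spell m v l).map f = spell m (v.map f) (l.map (List.map f)) := by
  simp [spell, List.map_flatMap, List.flatMap_map, List.map_drop]

theorem isWalk_map (f : A → B) {m : ℕ} {v u : List A} {l : List (List A)}
    (h : (wordGraph A m).IsWalk v l u) :
    (wordGraph B m).IsWalk (v.map f) (l.map (List.map f)) (u.map f) := by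
  induction l generalizing v with
  | nil => exact congrArg _ h
  | cons e l ih =>
    refine ⟨?_, ?_, ?_⟩
    · have : e.length = m + 1 := h.1
      change (e.map f).length = m + 1
      rw [List.length_map, this]
    · rw [← h.2.1]
      exact (List.map_dropLast ..).symm
    · have := ih h.2.2
      rwa [show ((wordGraph A m).tgt e).map f = (wordGraph B m).tgt (e.map f) from
        List.map_tail ..] at this

end WordGraph

/-! ### A property of involution semigroups inherited by divisors and products -/

section Good

variable {S T : Type} [Semigroup S] [Semigroup T]

/-- The product of a list, with `1` adjoined for the empty list. -/
def wprod (l : List T) : WithOne T := (l.map (WithOne.coe : T → WithOne T)).prod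

theorem wprod_append (l l' : List T) : wprod (l ++ l') = wprod l * wprod l' := by
  simp [wprod]

theorem wprod_cons (a : T) (l : List T) : wprod (a :: l) = a * wprod l := by
  simp [wprod]

theorem wprod_nil : wprod ([] : List T) = 1 := rfl

theorem wprod_replicate (s : T) (k : ℕ) : wprod (List.replicate k s) = (s : WithOne T) ^ k := by
  rw [wprod, List.map_replicate, List.prod_replicate]

theorem exists_coe_eq_wprod {l : List T} (hl : l ≠ []) : ∃ s : T, wprod l = s := by
  induction l with
  | nil => exact absurd rfl hl
  | cons a l ih =>
    rw [wprod_cons]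
    by_cases h : l = []
    · exact ⟨a, by rw [h, wprod_nil, mul_one]⟩
    · obtain ⟨s, hs⟩ := ih h
      exact ⟨a * s, by rw [hs, WithOne.coe_mul]⟩

theorem mapMulHom_wprod (h : S →ₙ* T) (l : List S) :
    WithOne.mapMulHom h (wprod l) = wprod (l.map h) := by
  induction l with
  | nil => simp [wprod]
  | cons a l ih => rw [wprod_cons, map_mul, ih, List.map_cons, wprod_cons, WithOne.mapMulHom_coe]

variable [StarMul S] [StarMul T]

/-- Products of lists only depend on the edges of the corresponding walks in `wordGraph T m`,
with multiplicities; products of `m` elements are locally hermitian; and `T` is aperiodic. -/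
structure IsWalkInvariant (T : Type) [Semigroup T] [StarMul T] (m : ℕ) : Prop where
  perm : ∀ (v u : List T) (l l' : List (List T)), v.length = m →
    (wordGraph T m).IsWalk v l u → (wordGraph T m).IsWalk v l' u → l.Perm l' →
    wprod (spell m v l) = wprod (spell m v l')
  hermitian : ∀ p : List T, m ≤ p.length → ∀ s : T,
    wprod p * s * wprod (star p) = wprod p * (star s : T) * wprod (star p)
  aperiodic : ∀ s : T, (s : WithOne T) ^ (m + 1) = (s : WithOne T) ^ m

theorem map_star_list {A B : Type} [InvolutiveStar A] [InvolutiveStar B] {f : A → B}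
    (hf : ∀ a, f (star a) = star (f a)) (l : List A) : (star l).map f = star (l.map f) := by
  simp only [star_list_def, List.map_reverse, List.map_map]
  congr 1
  exact List.map_congr_left fun a _ => hf a

theorem IsWalkInvariant.of_injective {h : S →ₙ* T} (hh : IsInvolutory h)
    (hi : Function.Injective h) {m : ℕ} (hT : IsWalkInvariant T m) : IsWalkInvariant S m where
  perm v u l l' hv hl hl' hp := by
    apply WithOne.mapMulHom_injective hi
    rw [mapMulHom_wprod, mapMulHom_wprod, map_spell, map_spell]
    exact hT.perm _ _ _ _ (by rwa [List.length_map]) (isWalk_map h hl) (isWalk_map h hl')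
      (hp.map _)
  hermitian p hp s := by
    apply WithOne.mapMulHom_injective hi
    simp only [map_mul, mapMulHom_wprod, map_star_list hh, WithOne.mapMulHom_coe, hh s]
    exact hT.hermitian _ (by rwa [List.length_map]) _
  aperiodic s := by
    apply WithOne.mapMulHom_injective hi
    simp only [map_pow, WithOne.mapMulHom_coe]
    exact hT.aperiodic _

/-- A section `σ` of `h` need not be a morphism: applied letter by letter it still maps walks to
walks, and `h` maps the identities back. -/
theorem IsWalkInvariant.of_surjective {h : S →ₙ* T} (hh : IsInvolutory h)
    (hs : Function.Surjective h) {m : ℕ} (hS : IsWalkInvariant S m) : IsWalkInvariant T m := by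
  obtain ⟨σ, hσ⟩ := hs.hasRightInverse
  have lift : ∀ l : List T, (l.map σ).map h = l := fun l => by
    simp [List.map_map, hσ.comp_eq_id]
  have lift' : ∀ l : List (List T), (l.map (List.map σ)).map (List.map h) = l := fun l => by
    rw [List.map_map]
    conv_rhs => rw [← List.map_id l]
    exact List.map_congr_left fun x _ => lift x
  refine ⟨fun v u l l' hv hl hl' hp => ?_, fun p hp s => ?_, fun s => ?_⟩
  · have := congrArg (WithOne.mapMulHom h) (hS.perm _ _ _ _ (by rwa [List.length_map])
      (isWalk_map σ hl) (isWalk_map σ hl') (hp.map _))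
    rwa [mapMulHom_wprod, mapMulHom_wprod, map_spell, map_spell, lift, lift', lift'] at this
  · have := congrArg (WithOne.mapMulHom h) (hS.hermitian (p.map σ) (by rwa [List.length_map])
      (σ s))
    simp only [map_mul, mapMulHom_wprod, map_star_list hh, WithOne.mapMulHom_coe, lift] at this
    rwa [hh, hσ] at this
  · have := congrArg (WithOne.mapMulHom h) (hS.aperiodic (σ s))
    rwa [map_pow, map_pow, WithOne.mapMulHom_coe, hσ] at this

/-- For the empty family the components do not distinguish the adjoined identity from the element of
the product, so both sides must come from the product itself. -/
theorem withOne_pi_ext {ι : Type} [Finite ι] {F : ι → FinStarSemigroup}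
    {x y : WithOne (FinStarSemigroup.pi F)} (hx : ∃ a : FinStarSemigroup.pi F, x = a)
    (hy : ∃ b : FinStarSemigroup.pi F, y = b)
    (h : ∀ i, WithOne.mapMulHom (piProj F i) x = WithOne.mapMulHom (piProj F i) y) : x = y := by
  obtain ⟨a, rfl⟩ := hx
  obtain ⟨b, rfl⟩ := hy
  congr 1
  funext i
  have := h i
  rw [WithOne.mapMulHom_coe, WithOne.mapMulHom_coe, WithOne.coe_inj] at this
  exact this

theorem IsWalkInvariant.pi {ι : Type} [Finite ι] {F : ι → FinStarSemigroup} {m : ℕ} (hm : 0 < m)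
    (hF : ∀ i, IsWalkInvariant (F i) m) : IsWalkInvariant (FinStarSemigroup.pi F) m where
  perm v u l l' hv hl hl' hp := by
    have hne : ∀ l, spell m v l ≠ [] := by
      intro l h
      have := congrArg List.length h
      simp only [spell, List.length_append, List.length_nil] at this
      omega
    refine withOne_pi_ext (exists_coe_eq_wprod (hne _)) (exists_coe_eq_wprod (hne _)) fun i => ?_
    rw [mapMulHom_wprod, mapMulHom_wprod, map_spell, map_spell]
    exact (hF i).perm _ _ _ _ (by rwa [List.length_map]) (isWalk_map _ hl) (isWalk_map _ hl')
      (hp.map _)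
  hermitian p hp s := by
    have key : ∀ s : FinStarSemigroup.pi F, wprod p * s * wprod (star p) =
        wprod (p ++ s :: star p) := fun s => by
      rw [wprod_append, wprod_cons, mul_assoc]
    rw [key, key]
    refine withOne_pi_ext (exists_coe_eq_wprod (by simp)) (exists_coe_eq_wprod (by simp))
      fun i => ?_
    rw [← key, ← key]
    simp only [map_mul, mapMulHom_wprod, WithOne.mapMulHom_coe,
      map_star_list (f := piProj F i) (fun _ => rfl)]
    exact (hF i).hermitian _ (by rwa [List.length_map]) _
  aperiodic s := by
    have key := wprod_replicate s
    rw [← key, ← key]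
    refine withOne_pi_ext (exists_coe_eq_wprod (by simp)) (exists_coe_eq_wprod ?_) fun i => ?_
    · simp only [ne_eq, List.replicate_eq_nil_iff]
      omega
    rw [key, key, map_pow, map_pow, WithOne.mapMulHom_coe]
    exact (hF i).aperiodic _

/-- `IsWalkInvariant T m` for all large `m`. -/
def EventuallyWalkInvariant : Set FinStarSemigroup :=
  {T | ∃ M : ℕ, ∀ m, M < m → IsWalkInvariant T m}

theorem isPseudovariety_eventuallyWalkInvariant : IsPseudovariety EventuallyWalkInvariant where
  pi_mem S hS := by
    choose M hM using hS
    obtain ⟨K, hK⟩ := (Set.finite_range M).bddAbove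
    exact ⟨K, fun m hm => IsWalkInvariant.pi (by omega) fun i =>
      hM i m (lt_of_le_of_lt (hK ⟨i, rfl⟩) hm)⟩
  sub_mem h hh hi := by
    rintro ⟨M, hM⟩
    exact ⟨M, fun m hm => (hM m hm).of_injective hh hi⟩
  quot_mem h hh hs := by
    rintro ⟨M, hM⟩
    exact ⟨M, fun m hm => (hM m hm).of_surjective hh hs⟩

end Good

/-! ### Long products in finite locally trivial semigroups -/

section LocallyTrivial

variable {T : Type} [Semigroup T]

/-- The `x` with `p = p * x` form a nonempty finite subsemigroup, which contains an idempotent. -/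
theorem exists_idempotent_of_mul_eq [Finite T] {p q : WithOne T} {y : T} (hq : q = y)
    (h : p = p * q) : ∃ e : T, IsIdempotentElem e ∧ p = p * e := by
  let : TopologicalSpace T := ⊥
  have : DiscreteTopology T := ⟨rfl⟩
  obtain ⟨e, he, hee⟩ := exists_idempotent_in_compact_subsemigroup (M := T)
    (fun r => continuous_of_discreteTopology) {x : T | p = p * x} ⟨y, by rwa [hq] at h⟩
    (Set.toFinite _).isCompact (by
      intro a ha b hb
      change p = p * (a * b : T)
      rw [WithOne.coe_mul, ← mul_assoc, ← ha]
      exact hb)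
  exact ⟨e, hee, he⟩

/-- Long products in a finite semigroup have an idempotent factor. -/
theorem exists_idempotent_factor (T : Type) [Semigroup T] [Finite T] :
    ∃ N, ∀ l : List T, N ≤ l.length →
      ∃ c e d : T, IsIdempotentElem e ∧ wprod l = ((c * e * d : T) : WithOne T) := by
  have := Fintype.ofFinite T
  -- Two of the first `|T| + 1` nonempty prefixes have the same value, so the factor between them
  -- stabilises that value.
  refine ⟨Fintype.card T + 1, fun l hl => ?_⟩
  have hp : ∀ i : Fin (Fintype.card T + 1), ∃ s : T, wprod (l.take (i + 1)) = s := fun i =>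
    exists_coe_eq_wprod (by
      intro h
      have := congrArg List.length h
      simp only [List.length_take, List.length_nil] at this
      omega)
  choose f hf using hp
  obtain ⟨i, j, hij, hfij⟩ := Fintype.exists_ne_map_eq_of_card_lt f (by simp)
  wlog hlt : i < j generalizing i j
  · exact this j i hij.symm hfij.symm (lt_of_le_of_ne (not_lt.1 hlt) hij.symm)
  have hlt' : i.1 < j.1 := hlt
  have hj := j.2
  have hsplit : l.take (j + 1) = l.take (i + 1) ++ (l.take (j + 1)).drop (i + 1) := by
    conv_lhs => rw [← List.take_append_drop (i + 1) (l.take (j + 1))]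
    rw [List.take_take, Nat.min_eq_left (by omega)]
  obtain ⟨y, hy⟩ := exists_coe_eq_wprod (l := (l.take (j + 1)).drop (i + 1)) (by
      intro h
      have := congrArg List.length h
      simp only [List.length_drop, List.length_take, List.length_nil] at this
      omega)
  obtain ⟨e, he, hpe⟩ := exists_idempotent_of_mul_eq hy (p := (f i : WithOne T)) (by
    rw [← hf i, ← wprod_append, ← hsplit, hf i, hf j, hfij])
  have hl' : wprod l = f i * wprod (l.drop (i + 1)) := by
    rw [← hf i, ← wprod_append, List.take_append_drop]
  rcases eq_or_ne (l.drop (i + 1)) [] with h | h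
  · refine ⟨f i, e, e, he, ?_⟩
    rw [hl', h, wprod_nil, mul_one, mul_assoc, he.eq, WithOne.coe_mul, ← hpe]
  · obtain ⟨r, hr⟩ := exists_coe_eq_wprod h
    refine ⟨f i, e, r, he, ?_⟩
    rw [hl', hr, WithOne.coe_mul, WithOne.coe_mul, ← hpe]

theorem IsLocallyTrivial.mul_mul_eq (hT : IsLocallyTrivial T) {e f : T} (he : IsIdempotentElem e)
    (hf : IsIdempotentElem f) (x y : WithOne T) : (e : WithOne T) * x * f = e * y * f := by
  have key : ∀ z : WithOne T, (e : WithOne T) * z * f = e * f := by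
    intro z
    induction z using WithOne.recOneCoe with
    | one => rw [mul_one]
    | coe z =>
      simp only [← WithOne.coe_mul]
      congr 1
      have h1 := hT e he f
      have h2 := hT f hf (e * z)
      calc e * z * f = e * f * e * z * f := by rw [h1]
        _ = e * (f * (e * z) * f) := by simp only [mul_assoc]
        _ = e * f := by rw [h2]
  rw [key, key]

/-- `N` is so large that a product of `N` elements, followed by anything and by a product of `N`
elements, does not depend on what is in the middle. -/
theorem IsLocallyTrivial.wprod_mul_eq (hT : IsLocallyTrivial T) {N : ℕ}
    (hN : ∀ l : List T, N ≤ l.length →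
      ∃ c e d : T, IsIdempotentElem e ∧ wprod l = ((c * e * d : T) : WithOne T))
    {l l' : List T} (hl : N ≤ l.length) (hl' : N ≤ l'.length) (x y : WithOne T) :
    wprod l * x * wprod l' = wprod l * y * wprod l' := by
  obtain ⟨c, e, d, he, h⟩ := hN l hl
  obtain ⟨c', e', d', he', h'⟩ := hN l' hl'
  rw [h, h']
  simp only [WithOne.coe_mul]
  have := hT.mul_mul_eq he he' (d * x * c') (d * y * c')
  calc (c * e * d : WithOne T) * x * (c' * e' * d') = c * (e * (d * x * c') * e') * d' := by
        simp only [mul_assoc]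
    _ = c * (e * (d * y * c') * e') * d' := by rw [this]
    _ = _ := by simp only [mul_assoc]

end LocallyTrivial

/-! ### Products of lists in a semidirect product -/

section Terms

variable {S T : Type} [Semigroup S] [StarMul S] [Semigroup T] [StarMul T] (α : InvAction S T)

/-- The action `(x, s, y) ↦ x s y`, where `x` and `y` may be empty. -/
def InvAction.act (x : WithOne T) (s : S) (y : WithOne T) : S :=
  WithOne.recOneCoe (motive := fun _ => S → S) id α.left x
    (WithOne.recOneCoe (motive := fun _ => S) s (α.right s) y)

theorem InvAction.act_mul (x : WithOne T) (s s' : S) (y : WithOne T) :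
    α.act x (s * s') y = α.act x s y * α.act x s' y := by
  induction x using WithOne.recOneCoe <;> induction y using WithOne.recOneCoe <;>
    simp [act, α.mul_right, α.left_mul]

theorem InvAction.act_right (x : WithOne T) (s : S) (t : T) (y : WithOne T) :
    α.act x (α.right s t) y = α.act x s (t * y) := by
  induction y using WithOne.recOneCoe with
  | one => rw [mul_one]; rfl
  | coe y => simp only [act, ← WithOne.coe_mul, WithOne.recOneCoe_coe, α.right_mul]

theorem InvAction.act_left (x : WithOne T) (s : S) (t : T) (y : WithOne T) :
    α.act x (α.left t s) y = α.act (x * t) s y := by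
  induction x using WithOne.recOneCoe <;> induction y using WithOne.recOneCoe <;>
    simp [act, α.mul_left, α.compatible, ← WithOne.coe_mul]

/-- The projection of a semidirect product to the acting semigroup. -/
def InvAction.sndHom : α.Sdp →ₙ* T where
  toFun x := x.snd
  map_mul' _ _ := rfl

/-- The product of the second components. -/
def InvAction.sndProd (w : List α.Sdp) : WithOne T := wprod (w.map α.sndHom)

theorem InvAction.sndProd_append (w w' : List α.Sdp) :
    α.sndProd (w ++ w') = α.sndProd w * α.sndProd w' := by
  rw [sndProd, List.map_append, wprod_append]
  rfl

theorem InvAction.sndProd_cons (x : α.Sdp) (w : List α.Sdp) :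
    α.sndProd (x :: w) = x.snd * α.sndProd w := by
  rw [sndProd, List.map_cons, wprod_cons]
  rfl

theorem InvAction.sndProd_eq {w : List α.Sdp} {x : α.Sdp} (h : wprod w = x) :
    α.sndProd w = x.snd := by
  rw [sndProd, ← mapMulHom_wprod, h, WithOne.mapMulHom_coe]
  rfl

/-- The terms of the first component of a product, in a context. -/
def InvAction.terms : WithOne T → List α.Sdp → WithOne T → List S
  | _, [], _ => []
  | x, a :: w, y => α.act x a.fst (α.sndProd w * y) :: InvAction.terms (x * a.snd) w y

theorem InvAction.terms_append (x y : WithOne T) (w w' : List α.Sdp) :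
    α.terms x (w ++ w') y =
      α.terms x w (α.sndProd w' * y) ++ α.terms (x * α.sndProd w) w' y := by
  induction w generalizing x with
  | nil => simp [terms, sndProd, wprod]
  | cons a w ih =>
    simp only [List.cons_append, terms]
    rw [ih, α.sndProd_append, α.sndProd_cons, mul_assoc, mul_assoc]

/-- The first component of a product of pairs `(sᵢ, tᵢ)` is the sum of the terms `t₁ ⋯ tᵢ₋₁ sᵢ tᵢ₊₁
⋯ tₙ`. -/
theorem InvAction.wprod_terms {w : List α.Sdp} {z : α.Sdp} (h : wprod w = z) (x y : WithOne T) :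
    wprod (α.terms x w y) = α.act x z.fst y := by
  induction w generalizing x z with
  | nil => exact absurd h WithOne.one_ne_coe
  | cons a w ih =>
    by_cases hw : w = []
    · subst hw
      rw [wprod_cons, wprod_nil, mul_one, WithOne.coe_inj] at h
      subst h
      simp [terms, wprod, sndProd]
    · obtain ⟨b, hb⟩ := exists_coe_eq_wprod hw
      rw [wprod_cons, hb, ← WithOne.coe_mul, WithOne.coe_inj] at h
      subst h
      rw [terms, wprod_cons, ih hb, α.sndProd_eq hb, ← WithOne.coe_mul]
      congr 1
      change _ = α.act x (α.right a.fst b.snd * α.left a.snd b.fst) y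
      rw [α.act_mul, α.act_right, α.act_left]

/-- Nonempty lists have the same product if the second components and the terms of the first
components have the same product. -/
theorem InvAction.wprod_eq_of_terms {w w' : List α.Sdp} (hw : w ≠ []) (hw' : w' ≠ [])
    (h1 : wprod (α.terms 1 w 1) = wprod (α.terms 1 w' 1)) (h2 : α.sndProd w = α.sndProd w') :
    wprod w = wprod w' := by
  obtain ⟨z, hz⟩ := exists_coe_eq_wprod hw
  obtain ⟨z', hz'⟩ := exists_coe_eq_wprod hw'
  rw [α.wprod_terms hz, α.wprod_terms hz', WithOne.coe_inj] at h1
  rw [α.sndProd_eq hz, α.sndProd_eq hz', WithOne.coe_inj] at h2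
  rw [hz, hz']
  congr 1
  exact InvAction.Sdp.ext h1 h2

theorem wprod_perm {S : Type} [Semigroup S] (hS : ∀ x y : S, x * y = y * x) {l l' : List S}
    (h : l.Perm l') : wprod l = wprod l' := by
  let : CommSemigroup S := { mul_comm := hS }
  exact (h.map _).prod_eq

end Terms

/-! ### Locally hermitian semidirect products of `Acom⋆` by `LI⋆` -/

section SdpWalk

variable {S T : Type} [Semigroup S] [StarMul S] [Semigroup T] [StarMul T] (α : InvAction S T)

theorem InvAction.sndProd_absorb (hT : IsLocallyTrivial T) {N : ℕ}
    (hN : ∀ l : List T, N ≤ l.length →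
      ∃ c e d : T, IsIdempotentElem e ∧ wprod l = ((c * e * d : T) : WithOne T))
    {l l' : List α.Sdp} (hl : N ≤ l.length) (hl' : N ≤ l'.length) (x : WithOne T) :
    α.sndProd l * x * α.sndProd l' = α.sndProd l * α.sndProd l' := by
  conv_rhs => rw [← mul_one (α.sndProd l)]
  exact hT.wprod_mul_eq hN (by rwa [List.length_map]) (by rwa [List.length_map]) _ _

/-- The product of second components only depends on a long prefix and a long suffix. -/
theorem InvAction.sndProd_eq_ends (hT : IsLocallyTrivial T) {N : ℕ}
    (hN : ∀ l : List T, N ≤ l.length →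
      ∃ c e d : T, IsIdempotentElem e ∧ wprod l = ((c * e * d : T) : WithOne T))
    {a b c d : List α.Sdp} (h : a ++ b = c ++ d) (ha : N ≤ a.length) (hc : N ≤ c.length)
    (hd : N ≤ d.length) :
    α.sndProd (a ++ b) = α.sndProd (a.take N) * α.sndProd d := by
  have h1 : c.take N = a.take N := by
    rw [← take_append_of_le hc d, ← h, take_append_of_le ha]
  rw [h, ← List.take_append_drop N c, α.sndProd_append, α.sndProd_append, h1]
  exact α.sndProd_absorb hT hN (by rw [List.length_take]; omega) hd _

/-- The term of the letter at position `2 * N` of a word, in the context of this word, of the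
first letters of a word with prefix `p` and of the last letters of a word with suffix `q`. -/
def InvAction.centerTerm (N : ℕ) (p q e : List α.Sdp) : List S :=
  match e.drop (2 * N) with
  -- A default: edges have more than `2 * N` letters.
  | [] => []
  | c :: r => [α.act (α.sndProd p * α.sndProd ((e.take (2 * N)).drop N)) c.fst
      (α.sndProd (r.take N) * α.sndProd q)]

/-- Each letter of `w` is the letter at position `2 * N` of exactly one edge of the walk. By local
triviality its left context depends only on `p` and the `N` letters before it, its right context
only on the `N` letters after it and the end of `u`, so its term is a function of that edge. The
element `x` collects what is absorbed on the left. -/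
theorem InvAction.exists_terms_eq_flatMap (hT : IsLocallyTrivial T) {N m : ℕ}
    (hN : ∀ l : List T, N ≤ l.length →
      ∃ c e d : T, IsIdempotentElem e ∧ wprod l = ((c * e * d : T) : WithOne T))
    (hm : 4 * N < m) {p u : List α.Sdp} (hp : N ≤ p.length) (hu : u.length = m)
    (l : List (List α.Sdp)) : ∀ (v : List α.Sdp) (x : WithOne T), v.length = m →
      (wordGraph α.Sdp m).IsWalk v l u →
      ∃ w x', v.drop (2 * N) ++ l.flatMap (List.drop m) = w ++ u.drop (2 * N) ∧
        α.terms (α.sndProd p * x * α.sndProd ((v.take (2 * N)).drop N)) w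
          (α.sndProd (u.drop (2 * N))) =
            l.flatMap (α.centerTerm N p (u.drop (3 * N))) ∧
        α.sndProd p * x * α.sndProd ((v.take (2 * N)).drop N) * α.sndProd w =
          α.sndProd p * x' * α.sndProd ((u.take (2 * N)).drop N) := by
  induction l with
  | nil =>
    intro v x hv hw
    obtain rfl : v = u := hw
    exact ⟨[], x, by simp, by simp [terms], by simp [sndProd, wprod]⟩
  | cons e l ih =>
    rintro v x hv ⟨he, hsrc, hw⟩
    have he' : e.length = m + 1 := he
    have hv' : v = e.take m := by
      have : v = e.dropLast := hsrc.symm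
      rw [this, List.dropLast_eq_take, he', Nat.add_sub_cancel]
    have htl : (wordGraph α.Sdp m).tgt e = e.tail := rfl
    rw [htl] at hw
    obtain ⟨w, x', h1, h2, h3⟩ := ih e.tail
      (x * α.sndProd ((e.drop N).take 1)) (by rw [List.length_tail]; omega) hw
    have hdrop : e.drop (2 * N) = e[2 * N] :: e.drop (2 * N + 1) :=
      List.drop_eq_getElem_cons (by omega)
    have htail : e.tail.drop (2 * N) = e.drop (2 * N + 1) := by
      rw [← List.drop_one, List.drop_drop, add_comm]
    rw [htail] at h1
    have hvd : v.drop (2 * N) ++ e.drop m = e.drop (2 * N) := by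
      conv_rhs => rw [← List.take_append_drop m e]
      rw [List.drop_append_of_le_length (by rw [List.length_take]; omega), hv']
    have hvt : v.take (2 * N) = e.take (2 * N) := by
      rw [hv', List.take_take, Nat.min_eq_left (by omega)]
    -- The left context advances by one letter: the letter at position `N` of `e` moves into the
    -- absorbed part.
    have hctx : α.sndProd ((v.take (2 * N)).drop N) * (e[2 * N]).snd =
        α.sndProd ((e.drop N).take 1) * α.sndProd ((e.tail.take (2 * N)).drop N) := by
      have hs : ∀ c : α.Sdp, α.sndProd [c] = c.snd := fun c => by
        rw [α.sndProd_cons]; exact mul_one _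
      rw [← hs, ← α.sndProd_append, ← α.sndProd_append, hvt]
      congr 1
      have hA : (e.take (2 * N + 1)).drop N = (e.take (2 * N)).drop N ++ [e[2 * N]] := by
        rw [List.take_succ_eq_append_getElem (by omega),
          List.drop_append_of_le_length (by rw [List.length_take]; omega)]
      have hB : (e.take (2 * N + 1)).drop N =
          (e.drop N).take 1 ++ (e.tail.take (2 * N)).drop N := by
        conv_lhs => rw [← List.take_append_drop 1 ((e.take (2 * N + 1)).drop N)]
        congr 1
        · rw [List.drop_take, List.take_take, Nat.min_eq_left (by omega)]
        · rw [List.drop_drop, ← List.drop_one, List.drop_take, List.drop_take, List.drop_drop]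
          congr 1
          · omega
          · rw [add_comm]
      rw [← hA, hB]
    refine ⟨e[2 * N] :: w, x', ?_, ?_, ?_⟩
    · rw [List.flatMap_cons, ← List.append_assoc, hvd, hdrop, List.cons_append, h1,
        List.cons_append]
    · rw [terms, List.flatMap_cons]
      have hcenter : α.centerTerm N p (u.drop (3 * N)) e =
          [α.act (α.sndProd p * α.sndProd ((e.take (2 * N)).drop N)) (e[2 * N]).fst
            (α.sndProd ((e.drop (2 * N + 1)).take N) * α.sndProd (u.drop (3 * N)))] := by
        rw [centerTerm, hdrop]
      rw [hcenter, List.singleton_append]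
      congr 1
      · rw [← α.sndProd_append w, ← h1, hvt]
        rw [α.sndProd_absorb hT hN hp (by rw [List.length_drop, List.length_take]; omega)]
        rw [α.sndProd_eq_ends hT hN (c := w ++ (u.drop (2 * N)).take N)
          (d := u.drop (3 * N)) ?_ (by rw [List.length_drop]; omega)
          (by rw [List.length_append, List.length_take, List.length_drop]; omega)
          (by rw [List.length_drop]; omega)]
        rw [h1, List.append_assoc]
        congr 1
        conv_lhs => rw [← List.take_append_drop N (u.drop (2 * N))]
        rw [List.drop_drop]
        congr 2
        omega
      · rw [← h2, mul_assoc _ (α.sndProd _) ((e[2 * N]).snd : WithOne T), hctx]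
        simp only [mul_assoc]
    · rw [α.sndProd_cons, ← h3]
      rw [← mul_assoc, mul_assoc _ (α.sndProd _) ((e[2 * N]).snd : WithOne T), hctx]
      simp only [mul_assoc]

/-- The terms of the first `2 * N` letters and those of the letters in `u.drop (2 * N)` depend only
on `v` and `u`. The others are one for each edge, and their sum is commutative. -/
theorem InvAction.wprod_spell_eq_of_perm (hS : ∀ x y : S, x * y = y * x)
    (hT : IsLocallyTrivial T) {N m : ℕ}
    (hN : ∀ l : List T, N ≤ l.length →
      ∃ c e d : T, IsIdempotentElem e ∧ wprod l = ((c * e * d : T) : WithOne T))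
    (hm : 4 * N < m) {v u : List α.Sdp} {l l' : List (List α.Sdp)} (hv : v.length = m)
    (hl : (wordGraph α.Sdp m).IsWalk v l u) (hl' : (wordGraph α.Sdp m).IsWalk v l' u)
    (hp : l.Perm l') : wprod (spell m v l) = wprod (spell m v l') := by
  have hu : u.length = m := by
    clear hl' hp l'
    induction l generalizing v with
    | nil => rw [← hv, show v = u from hl]
    | cons e l ih =>
      refine ih (v := e.tail) ?_ hl.2.2
      rw [List.length_tail, show e.length = m + 1 from hl.1, Nat.add_sub_cancel]
  have hne : ∀ l, spell m v l ≠ [] := by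
    intro l h
    have := congrArg List.length h
    simp only [spell, List.length_append, List.length_nil] at this
    omega
  have key : ∀ l, (wordGraph α.Sdp m).IsWalk v l u →
      (α.terms 1 (spell m v l) 1 =
        α.terms 1 (v.take (2 * N)) (α.sndProd ((v.drop (2 * N)).take N) *
          α.sndProd (u.drop (3 * N))) ++
        l.flatMap (α.centerTerm N (v.take N) (u.drop (3 * N))) ++
        α.terms (α.sndProd (v.take N) * α.sndProd ((u.take (2 * N)).drop N))
          (u.drop (2 * N)) 1) ∧
      α.sndProd (spell m v l) = α.sndProd (v.take N) * α.sndProd (u.drop (3 * N)) := by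
    intro l hl
    obtain ⟨w, x', h1, h2, h3⟩ := α.exists_terms_eq_flatMap hT hN hm (p := v.take N)
      (by rw [List.length_take]; omega) hu l v 1 hv hl
    have hud : u.drop (2 * N) = (u.drop (2 * N)).take N ++ u.drop (3 * N) := by
      conv_lhs => rw [← List.take_append_drop N (u.drop (2 * N))]
      rw [List.drop_drop]
      congr 2
      omega
    have h4 : v.drop (2 * N) ++ l.flatMap (List.drop m) =
        (w ++ (u.drop (2 * N)).take N) ++ u.drop (3 * N) := by
      rw [List.append_assoc, ← hud, h1]
    have hvt : α.sndProd (v.take N) * α.sndProd ((v.take (2 * N)).drop N) =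
        α.sndProd (v.take (2 * N)) := by
      rw [← α.sndProd_append]
      congr 1
      conv_rhs => rw [← List.take_append_drop N (v.take (2 * N))]
      rw [List.take_take, Nat.min_eq_left (by omega)]
    have hspell : spell m v l = v.take (2 * N) ++ (w ++ u.drop (2 * N)) := by
      rw [← h1, ← List.append_assoc, List.take_append_drop]
      rfl
    rw [mul_one, hvt] at h2 h3
    rw [α.sndProd_absorb hT hN (by rw [List.length_take]; omega)
      (by rw [List.length_drop, List.length_take]; omega)] at h3
    constructor
    · rw [hspell, α.terms_append, α.terms_append, ← h1,
        α.sndProd_eq_ends hT hN h4 (by rw [List.length_drop]; omega)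
          (by rw [List.length_append, List.length_take, List.length_drop]; omega)
          (by rw [List.length_drop]; omega), one_mul, mul_one, mul_one, h2, h3,
        List.append_assoc]
    · rw [spell, α.sndProd_eq_ends hT hN (c := v.take (2 * N) ++ (w ++ (u.drop (2 * N)).take N))
        (d := u.drop (3 * N)) ?_ (by omega)
        (by simp only [List.length_append, List.length_take]; omega)
        (by rw [List.length_drop]; omega)]
      rw [List.append_assoc, ← h4, ← List.append_assoc, List.take_append_drop]
  refine α.wprod_eq_of_terms (hne l) (hne l') ?_ ?_
  · rw [(key l hl).1, (key l' hl').1]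
    exact wprod_perm hS (((hp.flatMap_right _).append_left _).append_right _)
  · rw [(key l hl).2, (key l' hl').2]

end SdpWalk

/-! ### The hermitian and aperiodic laws in semidirect products -/

section SdpHermitian

variable {S T : Type} [Semigroup S] [StarMul S] [Semigroup T] [StarMul T] {α : InvAction S T}

theorem wprod_star {R : Type} [Semigroup R] [StarMul R] {l : List R} {x : R}
    (h : wprod l = x) : wprod (star l) = (star x : R) := by
  induction l generalizing x with
  | nil => exact absurd h WithOne.one_ne_coe
  | cons a l ih =>
    rw [star_list_cons, wprod_append, wprod_cons, wprod_nil, mul_one]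
    by_cases hl : l = []
    · subst hl
      rw [wprod_cons, wprod_nil, mul_one, WithOne.coe_inj] at h
      rw [← h]
      exact one_mul _
    · obtain ⟨b, hb⟩ := exists_coe_eq_wprod hl
      rw [wprod_cons, hb, ← WithOne.coe_mul, WithOne.coe_inj] at h
      rw [ih hb, ← h, star_mul, WithOne.coe_mul]

theorem isIdempotentElem_star {R : Type} [Semigroup R] [StarMul R] {e : R}
    (he : IsIdempotentElem e) : IsIdempotentElem (star e) := by
  change star e * star e = star e
  rw [← star_mul, he.eq]

/-- If the action is locally hermitian then `t s t† = t s⋆ t†` for `t` with an idempotent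
factor. -/
theorem InvAction.LocallyHermitian.right_left_star (hα : α.LocallyHermitian) {c e d : T}
    (he : IsIdempotentElem e) (s : S) :
    α.right (α.left (c * e * d) s) (star (c * e * d)) =
      α.right (α.left (c * e * d) (star s)) (star (c * e * d)) := by
  have key : ∀ s : S, α.right (α.left (c * e * d) s) (star (c * e * d)) =
      α.right (α.left c (α.right (α.left e (α.right (α.left d s) (star d))) (star e)))
        (star c) := by
    intro s
    rw [α.mul_left, α.mul_left, star_mul, star_mul, α.right_mul, α.right_mul,
      α.compatible c, α.compatible c, α.compatible e]
  have hs : star (α.right (α.left d s) (star d)) = α.right (α.left d (star s)) (star d) := by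
    rw [α.star_right, α.star_left, star_star, α.compatible]
  rw [key, key, hα e he, hs]

/-- In `(a, t)(b, u)(a, t)⋆` the middle term `t b t†` is unchanged under `b ↦ b⋆` by the hermitian
law. For the outer terms write `a = a₁t₂ + t₁a₂`. The part from `a₁t₂` does not see `u`, by local
triviality of conjugation by `t₂`. The part from `t₁a₂` has the form `t₁ r t₁†` and is its own star,
so starring `u` only exchanges two summands, which commute. Hence two factors are needed, each with
an idempotent in its second component. -/
theorem InvAction.LocallyHermitian.mul_star_mul (hα : α.LocallyHermitian)
    (hS : ∀ x y : S, x * y = y * x) (hT : IsLocallyTrivial T) {x y : α.Sdp}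
    (hx : ∃ c e d : T, IsIdempotentElem e ∧ x.snd = c * e * d)
    (hy : ∃ c e d : T, IsIdempotentElem e ∧ y.snd = c * e * d) (z : α.Sdp) :
    (x * y) * z * star (x * y) = (x * y) * star z * star (x * y) := by
  obtain ⟨a₁, t₁⟩ := x
  obtain ⟨a₂, t₂⟩ := y
  obtain ⟨b, u⟩ := z
  obtain ⟨c, e, d, he, h1⟩ := hx
  obtain ⟨c', e', d', he', h2⟩ := hy
  simp only at h1 h2
  -- conjugates do not depend on the middle element
  have conj : ∀ {f g : T}, IsIdempotentElem f → IsIdempotentElem g → ∀ r r' : T,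
      f * r * g = f * r' * g := by
    intro f g hf hg r r'
    have := hT.mul_mul_eq hf hg r r'
    simpa only [← WithOne.coe_mul, WithOne.coe_inj] using this
  have hsnd : ∀ r r' : T, t₂ * r * (star t₂ * star t₁) = t₂ * r' * (star t₂ * star t₁) := by
    intro r r'
    have h3 := conj he' (isIdempotentElem_star he') (d' * r * star d') (d' * r' * star d')
    rw [h2, star_mul, star_mul]
    calc c' * e' * d' * r * (star d' * (star e' * star c') * star t₁)
        = c' * (e' * (d' * r * star d') * star e') * star c' * star t₁ := by
          simp only [mul_assoc]
      _ = c' * (e' * (d' * r' * star d') * star e') * star c' * star t₁ := by rw [h3]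
      _ = _ := by simp only [mul_assoc]
  set t := t₁ * t₂ with ht
  set a := α.right a₁ t₂ * α.left t₁ a₂ with ha
  have hst : star t = star t₂ * star t₁ := star_mul _ _
  have expand : ∀ (b : S) (u : T),
      ((⟨a, t⟩ : α.Sdp) * ⟨b, u⟩ * star (⟨a, t⟩ : α.Sdp)) =
      ⟨α.right a (u * star t) * α.right (α.left t b) (star t) *
        star (α.right a (star u * star t)), t * u * star t⟩ := by
    intro b u
    apply InvAction.Sdp.ext
    · change α.right (α.right a u * α.left t b) (star t) * α.left (t * u) (star a) = _
      simp only [α.mul_right, α.star_right, star_star, α.right_mul, α.mul_left]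
    · rfl
  have hxy : (⟨a₁, t₁⟩ : α.Sdp) * ⟨a₂, t₂⟩ = ⟨a, t⟩ := rfl
  have hz : star (⟨b, u⟩ : α.Sdp) = ⟨star b, star u⟩ := rfl
  rw [hxy, hz, expand, expand]
  have hb : α.right (α.left t b) (star t) = α.right (α.left t (star b)) (star t) := by
    rw [ht, h1, mul_assoc]
    exact hα.right_left_star he b
  have hZ : ∀ r r' : T, α.right (α.right a₁ t₂) (r * star t) =
      α.right (α.right a₁ t₂) (r' * star t) := by
    intro r r'
    rw [← α.right_mul, ← α.right_mul, hst, ← mul_assoc, ← mul_assoc t₂, hsnd r r']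
  have hY : ∀ r : T, star (α.right (α.left t₁ a₂) (r * star t)) =
      α.right (α.left t₁ a₂) (r * star t) := by
    intro r
    have h4 : α.right (α.left t₁ a₂) (r * star t) =
        α.right (α.left t₁ (α.right a₂ (r * star t₂))) (star t₁) := by
      rw [α.compatible t₁ a₂, α.compatible, ← α.right_mul, hst, mul_assoc]
    rw [h4]
    conv_rhs => rw [h1, hα.right_left_star he, ← h1]
    rw [α.star_right, α.star_left, star_star, α.compatible]
  apply InvAction.Sdp.ext
  · change α.right a (u * star t) * α.right (α.left t b) (star t) *
        star (α.right a (star u * star t)) =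
      α.right a (star u * star t) * α.right (α.left t (star b)) (star t) *
        star (α.right a (star (star u) * star t))
    rw [star_star, ← hb, ha, α.mul_right, α.mul_right,
      star_mul (α.right (α.right a₁ t₂) (star u * star t)),
      star_mul (α.right (α.right a₁ t₂) (u * star t)), hY, hY, hZ (star u) u]
    generalize α.right (α.right a₁ t₂) (u * star t) = Z
    generalize α.right (α.left t₁ a₂) (u * star t) = Y
    generalize α.right (α.left t₁ a₂) (star u * star t) = Y'
    generalize α.right (α.left t b) (star t) = H
    calc Z * Y * H * (Y' * star Z) = Z * (Y * H * Y') * star Z := by simp only [mul_assoc]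
      _ = Z * (Y' * H * Y) * star Z := by rw [hS (Y * H) Y', hS Y H, mul_assoc Y']
      _ = _ := by simp only [mul_assoc]
  · change t * u * star t = t * star u * star t
    have := hsnd u (star u)
    rw [ht, star_mul, mul_assoc t₁, mul_assoc t₁, mul_assoc t₁, mul_assoc t₁, this]

theorem InvAction.terms_replicate (α : InvAction S T) (a : α.Sdp) {x : WithOne T}
    (h1 : x * a.snd = x) (h2 : a.snd * x = x) (j : ℕ) :
    α.terms x (List.replicate j a) x = List.replicate j (α.act x a.fst x) := by
  have h3 : ∀ j, α.sndProd (List.replicate j a) * x = x := by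
    intro j
    induction j with
    | zero => exact one_mul x
    | succ j ih => rw [List.replicate_succ, α.sndProd_cons, mul_assoc, ih, h2]
  induction j with
  | zero => rfl
  | succ j ih => rw [List.replicate_succ, terms, h3, h1, ih, List.replicate_succ]

/-- Away from the first and last `2 * N` letters all terms of a power of `a` are equal, because the
context `x` absorbs `a.snd` on both sides. There are more than `n` of them, so by aperiodicity of
`S` one more changes nothing. -/
theorem InvAction.pow_succ_eq (α : InvAction S T) (hT : IsLocallyTrivial T) {N n : ℕ}
    (hN : ∀ l : List T, N ≤ l.length →
      ∃ c e d : T, IsIdempotentElem e ∧ wprod l = ((c * e * d : T) : WithOne T))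
    (hn : ∀ s : S, (s : WithOne S) ^ (n + 1) = (s : WithOne S) ^ n) {m : ℕ}
    (hm : 4 * N + n < m) (a : α.Sdp) :
    (a : WithOne α.Sdp) ^ (m + 1) = (a : WithOne α.Sdp) ^ m := by
  set x := α.sndProd (List.replicate (2 * N) a) with hx
  have hxN : x = α.sndProd (List.replicate N a) * α.sndProd (List.replicate N a) := by
    rw [hx, ← α.sndProd_append, ← List.replicate_add, two_mul]
  have hlen : N ≤ (List.replicate N a).length := by rw [List.length_replicate]
  have hcomm : (a.snd : WithOne T) * α.sndProd (List.replicate N a) =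
      α.sndProd (List.replicate N a) * a.snd := by
    rw [← α.sndProd_cons, ← List.replicate_succ, List.replicate_succ', α.sndProd_append,
      α.sndProd_cons]
    congr 1
  have h1 : x * a.snd = x := by
    rw [hxN, mul_assoc, ← hcomm, ← mul_assoc, α.sndProd_absorb hT hN hlen hlen]
  have h2 : a.snd * x = x := by
    rw [hxN, ← mul_assoc, hcomm, α.sndProd_absorb hT hN hlen hlen]
  have h3 : ∀ j, α.sndProd (List.replicate j a) * x = x := by
    intro j
    induction j with
    | zero => exact one_mul x
    | succ j ih => rw [List.replicate_succ, α.sndProd_cons, mul_assoc, ih, h2]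
  have h4 : ∀ j, x * α.sndProd (List.replicate j a) = x := by
    intro j
    induction j with
    | zero => exact mul_one x
    | succ j ih => rw [List.replicate_succ, α.sndProd_cons, ← mul_assoc, h1, ih]
  have split : ∀ j, List.replicate (2 * N + (j + 2 * N)) a =
      List.replicate (2 * N) a ++ (List.replicate j a ++ List.replicate (2 * N) a) := fun j => by
    rw [List.replicate_add, List.replicate_add]
  have key : ∀ j, wprod (α.terms 1 (List.replicate (2 * N + (j + 2 * N)) a) 1) =
      wprod (α.terms 1 (List.replicate (2 * N) a) x) *
        ((α.act x a.fst x : S) : WithOne S) ^ j * wprod (α.terms x (List.replicate (2 * N) a) 1) ∧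
      α.sndProd (List.replicate (2 * N + (j + 2 * N)) a) = x := by
    intro j
    have h5 : α.sndProd (List.replicate j a) * α.sndProd (List.replicate (2 * N) a) = x := h3 j
    rw [split, α.terms_append, α.terms_append, α.sndProd_append, α.sndProd_append, h5,
      mul_one, one_mul, ← hx, h4, α.terms_replicate a h1 h2, wprod_append, wprod_append, wprod_replicate,
      mul_assoc]
    refine ⟨rfl, ?_⟩
    rw [α.sndProd_append, h5]
    exact h3 _
  obtain ⟨j, rfl⟩ : ∃ j, m = 2 * N + (j + 2 * N) := ⟨m - 4 * N, by omega⟩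
  have hpow : ∀ (s : S) (i : ℕ), n ≤ i → (s : WithOne S) ^ (i + 1) = (s : WithOne S) ^ i := by
    intro s i hi
    induction i, hi using Nat.le_induction with
    | base => exact hn s
    | succ i _ ih => rw [pow_succ, ih, ← pow_succ, ih]
  have hsucc : 2 * N + (j + 2 * N) + 1 = 2 * N + (j + 1 + 2 * N) := by omega
  rw [hsucc, ← wprod_replicate, ← wprod_replicate]
  refine α.wprod_eq_of_terms ?_ ?_ ?_ ?_
  · simp only [ne_eq, List.replicate_eq_nil_iff]
    omega
  · simp only [ne_eq, List.replicate_eq_nil_iff]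
    omega
  · rw [(key _).1, (key _).1, hpow _ j (by omega)]
  · rw [(key _).2, (key _).2]

end SdpHermitian

theorem lhProduct_subset_eventuallyWalkInvariant :
    lhProduct AcomStar LIStar ⊆ EventuallyWalkInvariant := by
  intro S hS
  refine hS _ isPseudovariety_eventuallyWalkInvariant ?_
  rintro _ ⟨S, ⟨⟨n, hn⟩, hS⟩, T, hT, α, hα, rfl⟩
  have hT' : IsLocallyTrivial T := hT
  obtain ⟨N, hN⟩ := exists_idempotent_factor T
  -- The bound leaves room for `4 * N` letters of context and for `n` equal terms, and lets a list
  -- of length `m` be cut into two parts longer than `N`.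
  refine ⟨4 * N + n, fun m hm => ⟨?_, ?_, ?_⟩⟩
  · intro v u l l' hv hl hl' hp
    exact α.wprod_spell_eq_of_perm hS hT' hN (by omega) hv hl hl' hp
  · intro p hp z
    have hlong : ∀ q : List α.Sdp, N < q.length → ∃ y : α.Sdp, wprod q = y ∧
        ∃ c e d : T, IsIdempotentElem e ∧ y.snd = c * e * d := by
      intro q hq
      obtain ⟨y, hy⟩ := exists_coe_eq_wprod (l := q) (by rintro rfl; simp at hq)
      obtain ⟨c, e, d, he, h⟩ := hN (q.map α.sndHom) (by rw [List.length_map]; omega)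
      refine ⟨y, hy, c, e, d, he, ?_⟩
      have := α.sndProd_eq hy
      rw [InvAction.sndProd, h, WithOne.coe_inj] at this
      exact this.symm
    obtain ⟨x, hx, hx'⟩ := hlong (p.take (N + 1)) (by rw [List.length_take]; omega)
    -- `N` is positive because the empty product is the adjoined identity.
    by_cases hN0 : N = 0
    · obtain ⟨c, e, d, he, h⟩ := hN [] (by simp [hN0])
      exact absurd h WithOne.one_ne_coe
    obtain ⟨y, hy, hy'⟩ := hlong (p.drop (N + 1)) (by rw [List.length_drop]; omega)
    have hxy : wprod p = ((x * y : α.Sdp) : WithOne α.Sdp) := by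
      rw [← List.take_append_drop (N + 1) p, wprod_append, hx, hy, WithOne.coe_mul]
    rw [wprod_star hxy, hxy, ← WithOne.coe_mul, ← WithOne.coe_mul, ← WithOne.coe_mul,
      ← WithOne.coe_mul]
    congr 1
    exact hα.mul_star_mul hS hT' hx' hy' z
  · exact α.pow_succ_eq hT' hN hn hm

/-! ### Languages recognised by walk-invariant involution semigroups -/

section Spell

variable {A : Type}

theorem spell_append (m : ℕ) (v : List A) (a b : List (List A)) :
    spell m v (a ++ b) = spell m v a ++ b.flatMap (List.drop m) := by
  simp [spell]

theorem spell_dropLast_cons {m : ℕ} {e : List A} (he : e.length = m + 1) (l : List (List A)) :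
    spell m e.dropLast (e :: l) = e.take 1 ++ spell m e.tail l := by
  have h1 : e.dropLast = e.take m := by rw [List.dropLast_eq_take, he, Nat.add_sub_cancel]
  rw [spell, spell, List.flatMap_cons, ← List.append_assoc, ← List.append_assoc, h1,
    List.take_append_drop, ← List.drop_one, List.take_append_drop]

theorem exists_spell_eq_append {m : ℕ} {v u : List A} {l : List (List A)}
    (h : (wordGraph A m).IsWalk v l u) : ∃ y, spell m v l = y ++ u := by
  induction l generalizing v with
  | nil =>
    obtain rfl : v = u := h
    exact ⟨[], by simp [spell]⟩
  | cons e l ih =>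
    obtain ⟨he, rfl, hl⟩ := h
    obtain ⟨y, hy⟩ := ih hl
    refine ⟨e.take 1 ++ y, ?_⟩
    rw [List.append_assoc, ← hy]
    exact spell_dropLast_cons he l

theorem isWalk_windows {m : ℕ} {l : List A} (h : m ≤ l.length) :
    (wordGraph A m).IsWalk (l.take m) (windows (m + 1) l) (l.rtake m) ∧
      spell m (l.take m) (windows (m + 1) l) = l := by
  induction l with
  | nil =>
    obtain rfl : m = 0 := Nat.le_zero.1 h
    exact ⟨rfl, rfl⟩
  | cons a l ih =>
    rw [windows]
    split_ifs with hm
    · obtain ⟨h1, h2⟩ := ih (by omega)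
      have hd : (a :: l).take m = ((a :: l).take (m + 1)).dropLast := by
        rw [List.dropLast_eq_take, List.take_take, List.length_take, List.length_cons]
        congr 1
        omega
      have hlen : ((a :: l).take (m + 1)).length = m + 1 := by
        rw [List.length_take, List.length_cons]
        omega
      refine ⟨⟨hlen, hd.symm, ?_⟩, ?_⟩
      · have : (a :: l).rtake m = l.rtake m := rtake_append_of_le (by omega) [a]
        rw [this]
        exact h1
      · rw [hd, spell_dropLast_cons hlen]
        simp [h2]
    · have hl : (a :: l).length = m := by
        rw [List.length_cons] at h ⊢
        omega
      rw [List.take_of_length_le hl.le, rtake_of_length_le hl.le]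
      exact ⟨rfl, by simp [spell]⟩

variable [InvolutiveStar A]

/-- The words of length `m + 1`, with their reversal, as the edges of a graph. -/
def invWordGraph (A : Type) [InvolutiveStar A] (m : ℕ) : InvGraph (List A) (List A) where
  toEdgeGraph := wordGraph A m
  star_mem e he := (length_star_list e).trans he
  src_star e := by
    change (star e).dropLast = star e.tail
    cases e with
    | nil => rfl
    | cons a e => rw [star_list_cons, List.dropLast_concat, List.tail_cons]

theorem spell_revWalk {m : ℕ} {v u : List A} {l : List (List A)}
    (h : (wordGraph A m).IsWalk v l u) :
    spell m (star u) (revWalk l) = star (spell m v l) := by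
  induction l generalizing v with
  | nil =>
    obtain rfl : v = u := h
    simp [spell, revWalk]
  | cons e l ih =>
    obtain ⟨he, rfl, hl⟩ := h
    have h1 : spell m ((wordGraph A m).src e) (e :: l) = e.take 1 ++ spell m e.tail l :=
      spell_dropLast_cons he l
    have h2 : revWalk (e :: l) = revWalk l ++ [star e] := by simp [revWalk]
    rw [h1, h2, spell_append, ih hl, star_list_append]
    congr 1
    cases e with
    | nil => exact absurd he (by simp [wordGraph])
    | cons a e =>
      have he' : (star e).length = m := by
        rw [length_star_list]
        exact Nat.succ_injective he
      simp [← he', star_list_def]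

end Spell

/-! ### From walk invariance to threshold testability -/

section Recognition

theorem coe_hom_eq_wprod {A T : Type} [Semigroup T] (h : FreeSemigroup A →ₙ* T)
    (w : FreeSemigroup A) : (h w : WithOne T) = wprod ((toList w).map fun a => h (FreeSemigroup.of a)) := by
  induction w using FreeSemigroup.recOnMul with
  | ih1 a => exact (mul_one _).symm
  | ih2 a w ha hw =>
    rw [map_mul, WithOne.coe_mul, ha, hw, toList_mul, List.map_append, wprod_append]

variable {T : Type} [Semigroup T] [StarMul T] {m : ℕ}

/-- A word that starts with a long word `v` and ends with `v†` has the same value as its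
reversal. -/
theorem IsWalkInvariant.wprod_star_eq (hT : IsWalkInvariant T m) {v y z : List T}
    (hv : m ≤ v.length) (h : v ++ z = y ++ star v) : wprod (star (v ++ z)) = wprod (v ++ z) := by
  -- If the prefix `v` and the suffix `v†` do not overlap, the word is `v r v†` and the hermitian
  -- law applies to `r`; if they overlap, or `r` is empty, the word is its own reversal.
  rcases List.append_eq_append_iff.1 h with ⟨r, rfl, rfl⟩ | ⟨r, rfl, hr⟩
  · by_cases hr : r = []
    · subst hr
      rw [List.nil_append, star_list_append, star_star]
    · obtain ⟨s, hs⟩ := exists_coe_eq_wprod hr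
      rw [star_list_append, star_list_append, star_star, wprod_append, wprod_append,
        wprod_append, wprod_append, wprod_star hs, hs, ← mul_assoc]
      exact (hT.hermitian v hv s).symm
  · rw [star_list_append] at hr
    obtain ⟨h1, rfl⟩ := List.append_inj hr (by rw [length_star_list])
    rw [star_list_append, star_list_append, star_star, h1, List.append_assoc]

/-- A walk from `v` to `star v` spells a word that starts with `v` and ends with `v†`, and `v` has
length `m`; so reversing this subwalk is covered by `IsWalkInvariant.wprod_star_eq`. -/
theorem IsWalkInvariant.invariant {A : Type} [InvolutiveStar A] (hT : IsWalkInvariant T m)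
    {f : A → T} (hf : ∀ a, f (star a) = star (f a)) {v₀ : List A} (hv₀ : v₀.length = m)
    (u₀ : List A) :
    (invWordGraph A m).Invariant v₀ u₀ (fun l => wprod ((spell m v₀ l).map f)) m where
  perm l l' hl hl' hp := by
    simp only [map_spell]
    exact hT.perm _ _ _ _ (by rwa [List.length_map]) (isWalk_map f hl) (isWalk_map f hl')
      (hp.map _)
  rev a p b v ha hp hb := by
    have hv : v.length = m := by
      clear hp hb
      induction a generalizing v₀ with
      | nil =>
        obtain rfl : v₀ = v := ha
        exact hv₀
      | cons e a ih =>
        refine ih ?_ ha.2.2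
        have he : e.length = m + 1 := ha.1
        change e.tail.length = m
        rw [List.length_tail, he, Nat.add_sub_cancel]
    obtain ⟨x, hx⟩ := exists_spell_eq_append ha
    obtain ⟨y, hy⟩ := exists_spell_eq_append hp
    have hrev : spell m v (revWalk p) = star (spell m v p) := by
      have := spell_revWalk hp
      rwa [star_star] at this
    have key : ∀ q : List (List A), spell m v₀ (a ++ (q ++ b)) =
        x ++ (spell m v q ++ b.flatMap (List.drop m)) := fun q => by
      rw [spell_append, hx]
      simp [spell]
    have h := hT.wprod_star_eq (v := v.map f) (y := y.map f)
      (z := (p.flatMap (List.drop m)).map f) (by rw [List.length_map, hv]) (by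
        rw [← map_star_list hf, ← List.map_append, ← List.map_append, ← hy, spell])
    rw [← List.map_append, ← map_star_list hf] at h
    change wprod ((star (spell m v p)).map f) = wprod ((spell m v p).map f) at h
    simp only [key, hrev, List.map_append, wprod_append, h]
  pump a C b v _ _ _ := by
    have key : ∀ n, wprod (((List.replicate n C).flatten.flatMap (List.drop m)).map f) =
        wprod ((C.flatMap (List.drop m)).map f) ^ n := fun n => by
      induction n with
      | zero => rfl
      | succ n ih =>
        rw [List.replicate_succ, List.flatten_cons, List.flatMap_append, List.map_append,
          wprod_append, ih, pow_succ']
    simp only [spell_append, List.flatMap_append, List.map_append, wprod_append, key]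
    congr 2
    by_cases hC : (C.flatMap (List.drop m)).map f = []
    · rw [hC, wprod_nil, one_pow, one_pow]
    · obtain ⟨s, hs⟩ := exists_coe_eq_wprod hC
      rw [hs, hT.aperiodic]

open Classical in
theorem occ_eq_count {A : Type} [InvolutiveStar A] (w v : FreeSemigroup A) :
    occ w v = (edgeClasses (windows (toList v).length (toList w))).count
      (edgeClass (toList v)) := by
  rw [occ_eq, edgeClasses, Multiset.coe_count, List.count_eq_countP, List.countP_map]
  refine List.countP_congr fun x _ => ?_
  simp [edgeClass_eq_iff]

/-- A word with at least `m` letters is spelled by the walk of its factors of length `m + 1`, and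
its edge counts are values of `occ`. There are finitely many pairs of ends, so one threshold is
large enough for all. -/
theorem IsWalkInvariant.exists_threshold {A : Type} [InvolutiveStar A] [Finite A]
    (hT : IsWalkInvariant T m) {h : FreeSemigroup A →ₙ* T} (hh : IsInvolutory h) :
    ∃ t : ℕ, 0 < t ∧ ∀ w w', LREquiv (m + 1) t w w' → h w = h w' := by
  classical
  have hf : ∀ a, h (FreeSemigroup.of (star a)) = star (h (FreeSemigroup.of a)) := fun a =>
    hh (FreeSemigroup.of a)
  have hfin : (invWordGraph A m).edges.Finite := List.finite_length_eq A (m + 1)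
  have hs : {p : List A × List A | p.1.length = m ∧ p.2.length = m}.Finite :=
    (List.finite_length_eq A m).prod (List.finite_length_eq A m)
  have hev : ∀ᶠ t in Filter.atTop, ∀ p ∈ {p : List A × List A | p.1.length = m ∧ p.2.length = m},
      ∀ l l', (wordGraph A m).IsWalk p.1 l p.2 → (wordGraph A m).IsWalk p.1 l' p.2 →
        (∀ e ∈ (wordGraph A m).edges, ThresholdEq t ((edgeClasses l).count (edgeClass e))
          ((edgeClasses l').count (edgeClass e))) →
        wprod ((spell m p.1 l).map fun a => h (FreeSemigroup.of a)) =
          wprod ((spell m p.1 l').map fun a => h (FreeSemigroup.of a)) := by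
    rw [Filter.eventually_all_finite hs]
    rintro ⟨v₀, u₀⟩ ⟨hv₀, -⟩
    obtain ⟨t, ht⟩ := (hT.invariant (f := fun a => h (FreeSemigroup.of a)) hf hv₀
      u₀).exists_threshold hfin
    filter_upwards [Filter.eventually_ge_atTop t] with t' htt l l' hl hl' hc
    exact ht l l' hl hl' fun e he => by convert (hc e he).mono htt
  obtain ⟨t, ht, ht0⟩ := (hev.and (Filter.eventually_gt_atTop 0)).exists
  refine ⟨t, ht0, ?_⟩
  rintro w w' (⟨-, rfl⟩ | ⟨hw, hw', hp, hs, hv⟩)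
  · rfl
  · rw [← length_toList] at hw hw'
    rw [Nat.add_sub_cancel] at hp hs
    obtain ⟨h1, h2⟩ := isWalk_windows (m := m) (l := toList w) (by omega)
    obtain ⟨h1', h2'⟩ := isWalk_windows (m := m) (l := toList w') (by omega)
    rw [← hp, ← hs] at h1'
    rw [← hp] at h2'
    have := ht ((toList w).take m, (toList w).rtake m)
      ⟨by rw [List.length_take]; omega, by rw [length_rtake]; omega⟩ _ _ h1 h1' fun e he => by
        have he' : e.length = m + 1 := he
        obtain ⟨v, rfl⟩ := exists_toList_eq (l := e) (by rintro rfl; simp at he')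
        have := hv v (by rw [← length_toList, he'])
        rw [occ_eq_count, occ_eq_count, he'] at this
        convert this
    rw [h2, h2', ← coe_hom_eq_wprod, ← coe_hom_eq_wprod, WithOne.coe_inj] at this
    exact this

end Recognition

theorem isLRTT_of_recognises {S : FinStarSemigroup} (hS : S ∈ EventuallyWalkInvariant)
    {A : InvAlphabet} {L : Set (FreeSemigroup A)} (hL : Recognises S L) : IsLRTT L := by
  obtain ⟨M, hM⟩ := hS
  obtain ⟨h, hh, P, rfl⟩ := hL
  obtain ⟨t, ht0, ht⟩ := (hM (M + 1) M.lt_succ_self).exists_threshold hh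
  refine ⟨M + 1 + 1, t, Nat.succ_pos _, ht0, h ⁻¹' P, Set.ext fun w => ?_⟩
  simp only [Set.mem_iUnion]
  constructor
  · exact fun hw => ⟨w, hw, (LREquiv.equivalence _ _).refl w⟩
  · rintro ⟨u, hu, huw⟩
    change h w ∈ P
    rw [← ht u w huw]
    exact hu

theorem languagesOf_lhProduct : languagesOf (lhProduct AcomStar LIStar) = LRTT := by
  funext A
  ext L
  constructor
  · rintro ⟨S, hS, hL⟩
    exact isLRTT_of_recognises (lhProduct_subset_eventuallyWalkInvariant hS) hL
  · exact isLRTT_mem_languagesOf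

end InvLang

/-- The involution variety of locally-reversible threshold testable languages over involutory
alphabets corresponds to the locally hermitian semidirect product of the pseudovarieties
`Acom⋆` and `LI⋆`. -/
theorem mainTheorem4 :
    InvLang.Corresponds InvLang.LRTT (InvLang.lhProduct InvLang.AcomStar InvLang.LIStar) :=
  InvLang.corresponds_of_languagesOf_eq (InvLang.isPseudovariety_generated _)
    InvLang.languagesOf_lhProduct
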